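/- Let $H$ be a complex Hilbert space with $\dim H \ge 3$ (possibly infinite-dimensional), let $P(H)$ be the set of all one-dimensional subspaces (lines) $[v] = \mathbb{C}v$, $0 \ne v \in H$, and for unit vectors $u, v \in H$ let $\measuredangle([u],[v]) := \arccos|\langle u,v\rangle| \in [0,\pi/2]$ denote the quantum angle. Fix a number $\alpha$ with $\frac{\pi}{4} < \alpha < \frac{\pi}{2}$. Let $\phi\colon P(H)\to P(H)$ be a bijective map which preserves the quantum angle $\alpha$ in both directions, that is, for all $[u],[v]\in P(H)$, $$\measuredangle([u],[v]) = \alpha \iff \measuredangle(\phi([u]),\phi([v])) = \alpha .$$ Then $\phi$ is a Wigner symmetry, that is, there exists a unitary operator or an antiunitary operator (a bijective conjugate-linear isometry) $U\colon H\to H$ such that $\phi([v]) = [Uv]$ for all $[v]\in P(H)$. -/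

import Mathlib

open scoped LinearAlgebra.Projectivization

section QuantumAngle

variable {H : Type*} [NormedAddCommGroup H] [InnerProductSpace ℂ H]

/-- The quantum angle (Fubini-Study distance) between two lines of `H`: the arccosine of
`|⟪u, v⟫| / (‖u‖ ‖v‖)`, where `u`, `v` are arbitrary nonzero vectors spanning the two lines
(see `quantumAngle_mk` for the independence of the choice). -/
noncomputable def quantumAngle (p q : ℙ ℂ H) : ℝ :=
  Real.arccos (‖inner ℂ p.rep q.rep‖ / (‖p.rep‖ * ‖q.rep‖))

theorem quantumAngle_mk (u v : H) (hu : u ≠ 0) (hv : v ≠ 0) :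
    quantumAngle (Projectivization.mk ℂ u hu) (Projectivization.mk ℂ v hv) =
      Real.arccos (‖inner ℂ u v‖ / (‖u‖ * ‖v‖)) := by
  obtain ⟨a, ha⟩ := Projectivization.exists_smul_eq_mk_rep ℂ u hu
  obtain ⟨b, hb⟩ := Projectivization.exists_smul_eq_mk_rep ℂ v hv
  have ha0 : ‖(a : ℂ)‖ ≠ 0 := norm_ne_zero_iff.mpr a.ne_zero
  have hb0 : ‖(b : ℂ)‖ ≠ 0 := norm_ne_zero_iff.mpr b.ne_zero
  have hu0 : ‖u‖ ≠ 0 := norm_ne_zero_iff.mpr hu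
  have hv0 : ‖v‖ ≠ 0 := norm_ne_zero_iff.mpr hv
  unfold quantumAngle
  rw [← ha, ← hb, Units.smul_def, Units.smul_def, inner_smul_left, inner_smul_right,
    norm_smul, norm_smul, norm_mul, norm_mul, RCLike.norm_conj]
  congr 1
  field_simp

/-- On lines spanned by unit vectors the quantum angle is `arccos |⟪u, v⟫|`. -/
theorem quantumAngle_mk_of_norm_eq_one (u v : H) (hu : u ≠ 0) (hv : v ≠ 0)
    (hu1 : ‖u‖ = 1) (hv1 : ‖v‖ = 1) :
    quantumAngle (Projectivization.mk ℂ u hu) (Projectivization.mk ℂ v hv) =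
      Real.arccos ‖inner ℂ u v‖ := by
  rw [quantumAngle_mk, hu1, hv1, mul_one, div_one]

/-- A self-map of the projective space is a Wigner symmetry if it is `[v] ↦ [U v]` for a unitary
(surjective linear isometry) or an antiunitary (surjective conjugate-linear isometry)
operator `U` on `H`. -/
def IsWignerSymmetry (φ : ℙ ℂ H → ℙ ℂ H) : Prop :=
  (∃ U : H ≃ₗᵢ[ℂ] H, ∀ (v : H) (hv : v ≠ 0),
    φ (Projectivization.mk ℂ v hv) =
      Projectivization.mk ℂ (U v) ((map_ne_zero_iff U U.injective).mpr hv)) ∨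
  (∃ U : H ≃ₛₗᵢ[starRingEnd ℂ] H, ∀ (v : H) (hv : v ≠ 0),
    φ (Projectivization.mk ℂ v hv) =
      Projectivization.mk ℂ (U v) ((map_ne_zero_iff U U.injective).mpr hv))

end QuantumAngle

/-! ### Equations in unimodular complex numbers -/

section UnimodularNumbers

open Polynomial

/-! With c = cos α, the map preserves the relation `overlap p q = c` in both directions, where 0 < c
and 2c² < 1. From this one relation the proof recovers collinearity, orthogonality and finally every
overlap; Wigner's theorem, also proved here, then gives the operator.

Collinearity. A projective line is a Bloch sphere on which orthogonal points are antipodal. If a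
vector has the same overlap with three distinct points of a circle of latitude, it is orthogonal to
one of the two poles (`inner_eq_zero_or_of_norm_inner_eq`). So a point equiangular to three points
of a great circle is equiangular to all of it, and a third dimension together with 2c² < 1 supplies
infinitely many such points. `CircleLike` records these properties using the relation alone, hence
images of circle-like sets are circle-like. The core of the proof is that a circle-like set lies on
a line (`CircleLike.onLine`). If no three of its points were collinear, the equiangular points would
lie in the span of any three of them, and an elimination argument
(`finite_setOf_two_unimodular_equations`) or a rotation argument gives a contradiction. If three are
collinear, a further point off their line is excluded by perturbing an equiangular vector
(`exists_equiangular_perturbation`). Since two orthogonal points and any third point of their line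
lie on a great circle, collinearity is preserved (`OnLine.map`).

Orthogonality. Orthogonal points are the poles of a great circle, and being a pole can be read off
from lines and equiangular points (`overlap_map_eq_zero`).

Overlaps. If N ⊥ N', P is on the line NN' and W ⊥ N', then overlap P W = overlap N P · overlap N W.
Tuning W so that the product is c shows that equal overlaps go to equal overlaps. The induced
function of the squared overlap is bounded and, by Pythagoras, additive on [0, 1], so it is the
identity (`overlap_map`). -/

theorem norm_add_mul_sq (a b z : ℂ) (hz : ‖z‖ = 1) :
    ‖a + z * b‖ ^ 2 = ‖a‖ ^ 2 + ‖b‖ ^ 2 + 2 * (z * (b * star a)).re := by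
  have h1 : ‖z‖ ^ 2 = 1 := by rw [hz]; norm_num
  rw [← Complex.normSq_eq_norm_sq] at *
  rw [← Complex.normSq_eq_norm_sq, ← Complex.normSq_eq_norm_sq]
  simp only [Complex.normSq_apply, Complex.add_re, Complex.add_im, Complex.mul_re,
    Complex.mul_im, Complex.star_def, Complex.conj_re, Complex.conj_im] at *
  linear_combination (b.re * b.re + b.im * b.im) * h1

/-- A vertical line meets the unit circle in at most two points. -/
theorem eq_zero_of_re_mul_eq {μ z₁ z₂ z₃ : ℂ} {t : ℝ} (h₁ : ‖z₁‖ = 1) (h₂ : ‖z₂‖ = 1)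
    (h₃ : ‖z₃‖ = 1) (h12 : z₁ ≠ z₂) (h13 : z₁ ≠ z₃) (h23 : z₂ ≠ z₃)
    (e₁ : (z₁ * μ).re = t) (e₂ : (z₂ * μ).re = t) (e₃ : (z₃ * μ).re = t) : μ = 0 := by
  by_contra hμ
  have key : ∀ z w : ℂ, ‖z‖ = 1 → ‖w‖ = 1 → (z * μ).re = (w * μ).re →
      z = w ∨ (z * μ).im = -(w * μ).im := by
    intro z w hz hw h
    have h1 : ‖z * μ‖ ^ 2 = ‖w * μ‖ ^ 2 := by simp [hz, hw]
    rw [← Complex.normSq_eq_norm_sq, ← Complex.normSq_eq_norm_sq, Complex.normSq_apply,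
      Complex.normSq_apply, h] at h1
    have h2 : ((z * μ).im - (w * μ).im) * ((z * μ).im + (w * μ).im) = 0 := by linarith
    rcases mul_eq_zero.mp h2 with h3 | h3
    · left
      exact mul_right_cancel₀ hμ (Complex.ext h (by linarith))
    · right; linarith
  have k1 := (key _ _ h₁ h₂ (e₁.trans e₂.symm)).resolve_left h12
  have k2 := (key _ _ h₁ h₃ (e₁.trans e₃.symm)).resolve_left h13
  exact h23 (mul_right_cancel₀ hμ (Complex.ext (e₂.trans e₃.symm) (by linarith)))

/-- Squaring the modulus fixes the real part of z · (b · star a). If that product were nonzero, at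
most two unimodular z would do. -/
theorem eq_zero_or_eq_zero_of_norm_add_mul {a b z₁ z₂ z₃ : ℂ} {t : ℝ} (h₁ : ‖z₁‖ = 1)
    (h₂ : ‖z₂‖ = 1) (h₃ : ‖z₃‖ = 1) (h12 : z₁ ≠ z₂) (h13 : z₁ ≠ z₃) (h23 : z₂ ≠ z₃)
    (e₁ : ‖a + z₁ * b‖ = t) (e₂ : ‖a + z₂ * b‖ = t) (e₃ : ‖a + z₃ * b‖ = t) :
    a = 0 ∨ b = 0 := by
  have f₁ := norm_add_mul_sq a b z₁ h₁
  have f₂ := norm_add_mul_sq a b z₂ h₂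
  have f₃ := norm_add_mul_sq a b z₃ h₃
  rw [e₁] at f₁
  rw [e₂] at f₂
  rw [e₃] at f₃
  have := eq_zero_of_re_mul_eq (μ := b * star a) (t := (t ^ 2 - ‖a‖ ^ 2 - ‖b‖ ^ 2) / 2)
    h₁ h₂ h₃ h12 h13 h23 (by linarith) (by linarith) (by linarith)
  rcases mul_eq_zero.mp this with h | h
  · exact Or.inr h
  · exact Or.inl (star_eq_zero.mp h)

theorem eq_zero_or_eq_zero_of_norm_add_mul_of_norm_eq {a b z₁ z₂ z₃ : ℂ} {r t : ℝ}
    (h₁ : ‖z₁‖ = r) (h₂ : ‖z₂‖ = r) (h₃ : ‖z₃‖ = r) (h12 : z₁ ≠ z₂) (h13 : z₁ ≠ z₃)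
    (h23 : z₂ ≠ z₃) (e₁ : ‖a + z₁ * b‖ = t) (e₂ : ‖a + z₂ * b‖ = t) (e₃ : ‖a + z₃ * b‖ = t) :
    a = 0 ∨ b = 0 := by
  have hr : 0 < r := by
    refine lt_of_le_of_ne (h₁ ▸ norm_nonneg _) fun h => h12 ?_
    rw [norm_eq_zero.mp (h₁.trans h.symm), norm_eq_zero.mp (h₂.trans h.symm)]
  have hrc : (r : ℂ) ≠ 0 := by exact_mod_cast hr.ne'
  have hn : ∀ z : ℂ, ‖z‖ = r → ‖z / r‖ = 1 := fun z hz => by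
    rw [norm_div, hz, Complex.norm_real, Real.norm_of_nonneg hr.le, div_self hr.ne']
  have hd : ∀ z w : ℂ, z ≠ w → z / r ≠ w / r := fun z w h hc => h ((div_left_inj' hrc).mp hc)
  have he : ∀ z : ℂ, z / r * (r * b) = z * b := fun z => by field_simp
  have := eq_zero_or_eq_zero_of_norm_add_mul (a := a) (b := r * b) (hn _ h₁) (hn _ h₂) (hn _ h₃)
    (hd _ _ h12) (hd _ _ h13) (hd _ _ h23) (by rw [he, e₁]) (by rw [he, e₂]) (by rw [he, e₃])
  exact this.imp_right fun h => (mul_eq_zero.mp h).resolve_left hrc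

theorem eq_zero_or_eq_zero_of_forall_norm_add_mul {a b : ℂ} {t : ℝ}
    (h : ∀ z : ℂ, ‖z‖ = 1 → ‖a + z * b‖ = t) : a = 0 ∨ b = 0 := by
  refine eq_zero_or_eq_zero_of_norm_add_mul (z₁ := 1) (z₂ := -1) (z₃ := Complex.I)
    (by simp) (by simp) (by simp) ?_ ?_ ?_ (h _ (by simp)) (h _ (by simp)) (h _ (by simp))
  all_goals norm_num [Complex.ext_iff]

theorem exists_two_unimodular_re_mul_eq {μ : ℂ} {t : ℝ} (h : |t| < ‖μ‖) :
    ∃ z₁ z₂ : ℂ, ‖z₁‖ = 1 ∧ ‖z₂‖ = 1 ∧ z₁ ≠ z₂ ∧ (z₁ * μ).re = t ∧ (z₂ * μ).re = t := by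
  have hμ0 : 0 < ‖μ‖ := lt_of_le_of_lt (abs_nonneg t) h
  have hμ : μ ≠ 0 := norm_pos_iff.mp hμ0
  have ht : 0 < ‖μ‖ ^ 2 - t ^ 2 := by
    have := sq_lt_sq' (by linarith [abs_nonneg t]) h
    rw [sq_abs] at this
    linarith
  set s := Real.sqrt (‖μ‖ ^ 2 - t ^ 2) with hs
  have hs0 : 0 < s := Real.sqrt_pos.mpr ht
  have hs2 : s ^ 2 = ‖μ‖ ^ 2 - t ^ 2 := Real.sq_sqrt ht.le
  have aux : ∀ r : ℝ, r ^ 2 = s ^ 2 → ‖(⟨t, r⟩ : ℂ) / μ‖ = 1 := by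
    intro r hr
    rw [norm_div, div_eq_one_iff_eq hμ0.ne']
    have : ‖(⟨t, r⟩ : ℂ)‖ ^ 2 = ‖μ‖ ^ 2 := by
      rw [← Complex.normSq_eq_norm_sq, Complex.normSq_apply]
      simp only
      nlinarith
    exact (pow_left_inj₀ (norm_nonneg _) (norm_nonneg _) two_ne_zero).mp this
  refine ⟨⟨t, s⟩ / μ, ⟨t, -s⟩ / μ, aux _ rfl, aux _ (by ring), ?_, ?_, ?_⟩
  · intro hc
    have := congrArg Complex.im ((div_left_inj' hμ).mp hc)
    simp only at this
    linarith
  · rw [div_mul_cancel₀ _ hμ]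
  · rw [div_mul_cancel₀ _ hμ]

theorem exists_two_unimodular_near_one {ε : ℝ} (hε : 0 < ε) :
    ∃ z₁ z₂ : ℂ, ‖z₁‖ = 1 ∧ ‖z₂‖ = 1 ∧ z₁ ≠ 1 ∧ z₂ ≠ 1 ∧ z₁ ≠ z₂ ∧ ‖z₁ - 1‖ < ε ∧
      ‖z₂ - 1‖ < ε := by
  set x := min (ε / 2) 1 with hx
  have hx0 : 0 < x := lt_min (by linarith) one_pos
  have hx1 : x ≤ 1 := min_le_right _ _
  have hxe : x < ε := lt_of_le_of_lt (min_le_left _ _) (by linarith)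
  have hs : 0 < Real.sin x := Real.sin_pos_of_pos_of_lt_pi hx0 (by linarith [Real.pi_gt_three])
  have him : ∀ y : ℝ, (Complex.exp (Complex.I * y)).im = Real.sin y := by
    intro y
    rw [mul_comm, Complex.exp_ofReal_mul_I_im]
  have hn : ∀ y : ℝ, ‖Complex.exp (Complex.I * y)‖ = 1 := by
    intro y
    rw [mul_comm, Complex.norm_exp_ofReal_mul_I]
  have hd : ∀ y : ℝ, |y| = x → ‖Complex.exp (Complex.I * y) - 1‖ < ε := fun y hy =>
    lt_of_le_of_lt Real.norm_exp_I_mul_ofReal_sub_one_le (by rw [Real.norm_eq_abs, hy]; exact hxe)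
  refine ⟨Complex.exp (Complex.I * (x : ℝ)), Complex.exp (Complex.I * ((-x : ℝ) : ℂ)), hn _, hn _,
    ?_, ?_, ?_, hd _ (abs_of_pos hx0), hd _ (by rw [abs_neg, abs_of_pos hx0])⟩
  all_goals
    intro hc
    have := congrArg Complex.im hc
    simp only [him, Real.sin_neg, Complex.one_im] at this
    linarith

theorem infinite_unimodular : {z : ℂ | ‖z‖ = 1}.Infinite := by
  have h : (Set.range fun z : Circle => (z : ℂ)) = {z : ℂ | ‖z‖ = 1} := by
    ext z
    constructor
    · rintro ⟨w, rfl⟩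
      exact Circle.norm_coe w
    · intro hz
      exact ⟨⟨z, mem_sphere_zero_iff_norm.mpr hz⟩, rfl⟩
  rw [← h]
  have : Infinite Circle := by
    refine Infinite.of_injective (fun n : ℕ => Circle.exp ((1 : ℝ) / (n + 1))) ?_
    intro m n hmn
    have hr : ∀ k : ℕ, 0 < (1 : ℝ) / (k + 1) ∧ (1 : ℝ) / (k + 1) ≤ 1 := fun k =>
      ⟨by positivity, by rw [div_le_one (by positivity)]; linarith [(Nat.cast_nonneg k : (0:ℝ) ≤ k)]⟩
    have h2 : (1 : ℝ) / (m + 1) = 1 / (n + 1) := by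
      have := congrArg Circle.argEquiv hmn
      have hp := Real.pi_gt_three
      have e1 := Circle.arg_exp (x := (1 : ℝ) / (m + 1)) (by linarith [hr m]) (by linarith [hr m])
      have e2 := Circle.arg_exp (x := (1 : ℝ) / (n + 1)) (by linarith [hr n]) (by linarith [hr n])
      have e3 : Complex.arg (Circle.exp ((1 : ℝ) / (m + 1))) =
          Complex.arg (Circle.exp ((1 : ℝ) / (n + 1))) := congrArg (fun z : Circle => Complex.arg z) hmn
      rw [e1, e2] at e3
      exact e3
    field_simp at h2
    exact_mod_cast (by linarith : (m : ℝ) = n)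
  exact Set.infinite_range_of_injective Subtype.val_injective

/-- On the unit circle conjugation is inversion, so each equation is linear in b and its conjugate,
with coefficients depending on a. Solving both and imposing b · star b = 1 leaves a polynomial
equation Φ(a) = 0; the nonvanishing hypotheses keep its coefficient of degree 6 away from zero. -/
theorem finite_setOf_two_unimodular_equations {x y z x' y' z' : ℂ} (hx : x ≠ 0) (hy : y ≠ 0)
    (hx' : x' ≠ 0) (hy' : y' ≠ 0) (hxz : x * z' - x' * z ≠ 0) (hyz : y * z' - y' * z ≠ 0) :
    {a : ℂ | ‖a‖ = 1 ∧ ∃ b : ℂ, ‖b‖ = 1 ∧ ‖x + y * a + z * b‖ = 1 ∧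
      ‖x' + y' * a + z' * b‖ = 1}.Finite := by
  set A : ℂ[X] := C x + C y * X with hA
  set A' : ℂ[X] := C x' + C y' * X with hA'
  -- At a unimodular a, S takes the value a · star (A a), and β the value a(|A a|² + |z|² - 1).
  set S : ℂ[X] := C (star x) * X + C (star y) with hS
  set S' : ℂ[X] := C (star x') * X + C (star y') with hS'
  set β : ℂ[X] := A * S + C (star z * z - 1) * X with hβ
  set β' : ℂ[X] := A' * S' + C (star z' * z' - 1) * X with hβ'
  -- Cramer's rule: P eliminates star b and Q eliminates b. At a solution P = -D · b and Q = a · D ·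
  -- star b, whence P · Q + a · D² = 0.
  set P : ℂ[X] := C (star z') * (β * A') - C (star z) * (β' * A) with hP
  set Q : ℂ[X] := C z' * (β * S') - C z * (β' * S) with hQ
  set D : ℂ[X] := C (z * star z') * (S * A') - C (z' * star z) * (S' * A) with hD
  set Φ : ℂ[X] := P * Q + X * D ^ 2 with hΦ
  have dA : A.natDegree ≤ 1 := by rw [hA]; compute_degree
  have dA' : A'.natDegree ≤ 1 := by rw [hA']; compute_degree
  have dS : S.natDegree ≤ 1 := by rw [hS]; compute_degree
  have dS' : S'.natDegree ≤ 1 := by rw [hS']; compute_degree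
  have dβ : β.natDegree ≤ 2 := by
    rw [hβ]
    refine natDegree_add_le_of_degree_le (natDegree_mul_le_of_le dA dS) ?_
    exact (natDegree_C_mul_le _ _).trans (natDegree_X_le.trans one_le_two)
  have dβ' : β'.natDegree ≤ 2 := by
    rw [hβ']
    refine natDegree_add_le_of_degree_le (natDegree_mul_le_of_le dA' dS') ?_
    exact (natDegree_C_mul_le _ _).trans (natDegree_X_le.trans one_le_two)
  have dP : P.natDegree ≤ 3 :=
    natDegree_sub_le_of_le ((natDegree_C_mul_le _ _).trans (natDegree_mul_le_of_le dβ dA'))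
      ((natDegree_C_mul_le _ _).trans (natDegree_mul_le_of_le dβ' dA))
  have dQ : Q.natDegree ≤ 3 :=
    natDegree_sub_le_of_le ((natDegree_C_mul_le _ _).trans (natDegree_mul_le_of_le dβ dS'))
      ((natDegree_C_mul_le _ _).trans (natDegree_mul_le_of_le dβ' dS))
  have dD : D.natDegree ≤ 2 :=
    natDegree_sub_le_of_le ((natDegree_C_mul_le _ _).trans (natDegree_mul_le_of_le dS dA'))
      ((natDegree_C_mul_le _ _).trans (natDegree_mul_le_of_le dS' dA))
  have cA : A.coeff 1 = y := by simp [hA, coeff_C]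
  have cA' : A'.coeff 1 = y' := by simp [hA', coeff_C]
  have cS : S.coeff 1 = star x := by simp [hS, coeff_C]
  have cS' : S'.coeff 1 = star x' := by simp [hS', coeff_C]
  have cβ : β.coeff 2 = y * star x := by
    rw [hβ, coeff_add, show (2 : ℕ) = 1 + 1 from rfl, coeff_mul_add_eq_of_natDegree_le dA dS, cA, cS]
    simp [coeff_one]
  have cβ' : β'.coeff 2 = y' * star x' := by
    rw [hβ', coeff_add, show (2 : ℕ) = 1 + 1 from rfl, coeff_mul_add_eq_of_natDegree_le dA' dS', cA', cS']
    simp [coeff_one]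
  have cP : P.coeff 3 = star z' * (y * star x * y') - star z * (y' * star x' * y) := by
    rw [hP, coeff_sub, coeff_C_mul, coeff_C_mul, show (3 : ℕ) = 2 + 1 from rfl,
      coeff_mul_add_eq_of_natDegree_le dβ dA', coeff_mul_add_eq_of_natDegree_le dβ' dA, cβ, cβ', cA, cA']
  have cQ : Q.coeff 3 = z' * (y * star x * star x') - z * (y' * star x' * star x) := by
    rw [hQ, coeff_sub, coeff_C_mul, coeff_C_mul, show (3 : ℕ) = 2 + 1 from rfl,
      coeff_mul_add_eq_of_natDegree_le dβ dS', coeff_mul_add_eq_of_natDegree_le dβ' dS, cβ, cβ', cS, cS']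
  -- The term X · D² has degree at most 5, so degree 6 sees only P · Q.
  have cΦ : Φ.coeff 6 = P.coeff 3 * Q.coeff 3 := by
    have h2 : (X * D ^ 2).natDegree ≤ 1 + 2 * 2 :=
      natDegree_mul_le_of_le natDegree_X_le (natDegree_pow_le_of_le 2 dD)
    rw [hΦ, coeff_add, coeff_eq_zero_of_natDegree_lt (p := X * D ^ 2) (by omega), add_zero,
      show (6 : ℕ) = 3 + 3 from rfl, coeff_mul_add_eq_of_natDegree_le dP dQ]
  have hΦ0 : Φ ≠ 0 := by
    intro h0
    rw [h0, coeff_zero] at cΦ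
    rcases mul_eq_zero.mp cΦ.symm with h | h
    · rw [cP] at h
      have h1 : star (x * z' - x' * z) * (y * y') = 0 := by
        simp only [star_sub, star_mul]
        linear_combination h
      rcases mul_eq_zero.mp h1 with h2 | h2
      · exact hxz (star_eq_zero.mp h2)
      · exact mul_ne_zero hy hy' h2
    · rw [cQ] at h
      have h1 : (y * z' - y' * z) * (star x * star x') = 0 := by linear_combination h
      exact mul_ne_zero hyz (mul_ne_zero (star_ne_zero.mpr hx) (star_ne_zero.mpr hx')) h1
  refine (finite_setOfPred_isRoot hΦ0).subset ?_
  rintro a ⟨ha, b, hb, e1, e2⟩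
  have conj_mul : ∀ w : ℂ, ‖w‖ = 1 → w * star w = 1 := by
    intro w hw
    rw [Complex.star_def, Complex.mul_conj, Complex.normSq_eq_norm_sq, hw]
    norm_num
  have ha1 := conj_mul a ha
  have hb1 := conj_mul b hb
  have e1' := conj_mul _ e1
  have e2' := conj_mul _ e2
  simp only [star_add, star_mul] at e1' e2'
  simp only [Set.mem_ofPred_eq, IsRoot.def, hΦ, hP, hQ, hD, hβ, hβ', hA, hA', hS, hS', eval_add,
    eval_mul, eval_sub, eval_C, eval_X, eval_pow]
  generalize star a = a₁ at *
  generalize star b = b₁ at *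
  generalize star x = x₁ at *
  generalize star y = y₁ at *
  generalize star z = z₁ at *
  generalize star x' = x₂ at *
  generalize star y' = y₂ at *
  generalize star z' = z₂ at *
  have s1 : x₁ * a + y₁ = a * (x₁ + a₁ * y₁) := by linear_combination -y₁ * ha1
  have s2 : x₂ * a + y₂ = a * (x₂ + a₁ * y₂) := by linear_combination -y₂ * ha1
  rw [s1, s2]
  generalize hu : x + y * a = u at *
  generalize hu' : x' + y' * a = u' at *
  generalize hv : x₁ + a₁ * y₁ = v at *
  generalize hv' : x₂ + a₁ * y₂ = v' at *
  have f1 : (u * v + z₁ * z - 1) = -(u * (b₁ * z₁) + z * b * v) := by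
    linear_combination e1' - z * z₁ * hb1
  have f2 : (u' * v' + z₂ * z' - 1) = -(u' * (b₁ * z₂) + z' * b * v') := by
    linear_combination e2' - z' * z₂ * hb1
  have g1 : u * (a * v) + (z₁ * z - 1) * a = -a * (u * (b₁ * z₁) + z * b * v) := by
    linear_combination a * f1
  have g2 : u' * (a * v') + (z₂ * z' - 1) * a = -a * (u' * (b₁ * z₂) + z' * b * v') := by
    linear_combination a * f2
  rw [g1, g2]
  linear_combination (-(a ^ 3) * (z * z₂ * v * u' - z' * z₁ * v' * u) ^ 2) * hb1

end UnimodularNumbers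

/-! ### Rays, overlaps, projective lines and poles -/

section Rays

set_option linter.unusedSectionVars false

variable {H : Type*} [NormedAddCommGroup H] [InnerProductSpace ℂ H]

theorem ne_zero_of_norm_one {v : H} (hv : ‖v‖ = 1) : v ≠ 0 := by
  rintro rfl
  simp at hv

theorem inner_self_of_norm_one {v : H} (hv : ‖v‖ = 1) : inner ℂ v v = 1 := by
  rw [inner_self_eq_norm_sq_to_K, hv]
  simp

theorem exists_normalization {v : H} (hv : v ≠ 0) :
    ∃ u : H, ‖u‖ = 1 ∧ v = (‖v‖ : ℂ) • u := by
  have h : (‖v‖ : ℂ) ≠ 0 := by exact_mod_cast norm_ne_zero_iff.mpr hv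
  refine ⟨(‖v‖ : ℂ)⁻¹ • v, ?_, ?_⟩
  · rw [norm_smul, norm_inv, Complex.norm_real, norm_norm,
      inv_mul_cancel₀ (norm_ne_zero_iff.mpr hv)]
  · rw [smul_smul, mul_inv_cancel₀ h, one_smul]

theorem inner_eq_zero_comm' {u v : H} (h : inner ℂ u v = 0) : inner ℂ v u = 0 := by
  rw [← inner_conj_symm, h, map_zero]

/-- The cosine of the quantum angle. -/
noncomputable def overlap (p q : ℙ ℂ H) : ℝ :=
  ‖inner ℂ p.rep q.rep‖ / (‖p.rep‖ * ‖q.rep‖)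

theorem overlap_comm (p q : ℙ ℂ H) : overlap p q = overlap q p := by
  unfold overlap
  rw [norm_inner_symm, mul_comm]

theorem overlap_nonneg (p q : ℙ ℂ H) : 0 ≤ overlap p q := by
  unfold overlap
  positivity

theorem overlap_le_one (p q : ℙ ℂ H) : overlap p q ≤ 1 := by
  unfold overlap
  exact div_le_one_of_le₀ (norm_inner_le_norm _ _) (by positivity)

variable [Nontrivial H]

/-- The line spanned by a nonzero vector (an arbitrary line if the vector is zero). -/
noncomputable def ray (v : H) : ℙ ℂ H := by
  classical
  exact if h : v ≠ 0 then Projectivization.mk ℂ v h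
    else Projectivization.mk ℂ _ (exists_ne (0 : H)).choose_spec

theorem ray_eq_mk {v : H} (hv : v ≠ 0) : ray v = Projectivization.mk ℂ v hv := by
  unfold ray
  rw [dif_pos hv]

theorem ray_eq_ray_iff {u v : H} (hu : u ≠ 0) (hv : v ≠ 0) :
    ray u = ray v ↔ ∃ z : ℂ, z • v = u := by
  rw [ray_eq_mk hu, ray_eq_mk hv, Projectivization.mk_eq_mk_iff']

theorem ray_smul {v : H} {z : ℂ} (hz : z ≠ 0) (hv : v ≠ 0) : ray (z • v) = ray v :=
  (ray_eq_ray_iff (smul_ne_zero hz hv) hv).mpr ⟨z, rfl⟩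

theorem exists_rep_smul {v : H} (hv : v ≠ 0) : ∃ z : ℂ, z ≠ 0 ∧ (ray v).rep = z • v := by
  rw [ray_eq_mk hv]
  obtain ⟨a, ha⟩ := Projectivization.exists_smul_eq_mk_rep ℂ v hv
  exact ⟨a, a.ne_zero, ha.symm⟩

theorem overlap_ray {u v : H} (hu : ‖u‖ = 1) (hv : ‖v‖ = 1) :
    overlap (ray u) (ray v) = ‖inner ℂ u v‖ := by
  obtain ⟨a, ha, hau⟩ := exists_rep_smul (ne_zero_of_norm_one hu)
  obtain ⟨b, hb, hbv⟩ := exists_rep_smul (ne_zero_of_norm_one hv)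
  unfold overlap
  rw [hau, hbv, inner_smul_left, inner_smul_right, norm_smul, norm_smul, norm_mul, norm_mul,
    RCLike.norm_conj, hu, hv]
  have := norm_ne_zero_iff.mpr ha
  have := norm_ne_zero_iff.mpr hb
  field_simp

theorem exists_ray (p : ℙ ℂ H) : ∃ u : H, ‖u‖ = 1 ∧ ray u = p := by
  obtain ⟨u, hu, he⟩ := exists_normalization p.rep_nonzero
  refine ⟨u, hu, ?_⟩
  rw [← ray_smul (z := (‖p.rep‖ : ℂ)) (by exact_mod_cast norm_ne_zero_iff.mpr p.rep_nonzero)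
    (ne_zero_of_norm_one hu), ← he, ray_eq_mk p.rep_nonzero, Projectivization.mk_rep]

/-- The point `r` of the projective space lies on the projective line through `p` and `q`. -/
def OnLine (p q r : ℙ ℂ H) : Prop := r.rep ∈ Submodule.span ℂ {p.rep, q.rep}

theorem onLine_ray_iff {u v w : H} (hu : u ≠ 0) (hv : v ≠ 0) (hw : w ≠ 0) :
    OnLine (ray u) (ray v) (ray w) ↔ w ∈ Submodule.span ℂ {u, v} := by
  obtain ⟨a, ha, hau⟩ := exists_rep_smul hu
  obtain ⟨b, hb, hbv⟩ := exists_rep_smul hv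
  obtain ⟨d, hd, hdw⟩ := exists_rep_smul hw
  unfold OnLine
  rw [hau, hbv, hdw, Submodule.smul_mem_iff _ hd, Submodule.span_insert, Submodule.span_insert,
    Submodule.span_singleton_smul_eq (IsUnit.mk0 a ha), Submodule.span_singleton_smul_eq
    (IsUnit.mk0 b hb)]

theorem linearIndependent_of_ray_ne {u v : H} (hu : ‖u‖ = 1) (hv : ‖v‖ = 1)
    (h : ray u ≠ ray v) : LinearIndependent ℂ ![u, v] := by
  rw [LinearIndependent.pair_iff' (ne_zero_of_norm_one hu)]
  intro a ha
  exact h ((ray_eq_ray_iff (ne_zero_of_norm_one hv) (ne_zero_of_norm_one hu)).mpr ⟨a, ha⟩).symm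

theorem finrank_span_pair {u v : H} (h : LinearIndependent ℂ ![u, v]) :
    Module.finrank ℂ (Submodule.span ℂ {u, v}) = 2 := by
  have := finrank_span_eq_card h
  rwa [Matrix.range_cons, Matrix.range_cons, Matrix.range_empty, Set.union_empty,
    Set.singleton_union] at this

theorem span_pair_eq_of_mem {u v x y : H} (h : LinearIndependent ℂ ![x, y])
    (hx : x ∈ Submodule.span ℂ {u, v}) (hy : y ∈ Submodule.span ℂ {u, v}) :
    Submodule.span ℂ {x, y} = Submodule.span ℂ {u, v} := by
  have hle : Submodule.span ℂ {x, y} ≤ Submodule.span ℂ {u, v} := by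
    rw [Submodule.span_le]
    rintro z (rfl | rfl)
    exacts [hx, hy]
  have : FiniteDimensional ℂ (Submodule.span ℂ {u, v}) :=
    FiniteDimensional.span_of_finite ℂ (Set.toFinite _)
  refine Submodule.eq_of_le_of_finrank_le hle ?_
  rw [finrank_span_pair h]
  have := finrank_range_le_card (R := ℂ) ![u, v]
  rwa [Matrix.range_cons, Matrix.range_cons, Matrix.range_empty, Set.union_empty,
    Set.singleton_union, Fintype.card_fin] at this

theorem OnLine.exchange {p q x y z : ℙ ℂ H} (hx : OnLine p q x) (hy : OnLine p q y)
    (hz : OnLine p q z) (hxy : x ≠ y) : OnLine x y z := by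
  unfold OnLine at *
  rw [span_pair_eq_of_mem _ hx hy]
  · exact hz
  · rw [LinearIndependent.pair_iff' x.rep_nonzero]
    intro a ha
    apply hxy
    rw [← x.mk_rep, ← y.mk_rep, Eq.comm, Projectivization.mk_eq_mk_iff']
    exact ⟨a, ha⟩

theorem onLine_left (p q : ℙ ℂ H) : OnLine p q p := Submodule.subset_span (by simp)

theorem onLine_right (p q : ℙ ℂ H) : OnLine p q q := Submodule.subset_span (by simp)

theorem eq_of_mem_span_orthonormal {e₁ e₂ x : H} (h₁ : ‖e₁‖ = 1) (h₂ : ‖e₂‖ = 1)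
    (h : inner ℂ e₁ e₂ = 0) (hx : x ∈ Submodule.span ℂ {e₁, e₂}) :
    x = inner ℂ e₁ x • e₁ + inner ℂ e₂ x • e₂ := by
  obtain ⟨a, b, rfl⟩ := Submodule.mem_span_pair.mp hx
  simp only [inner_add_right, inner_smul_right, h, inner_self_of_norm_one h₁,
    inner_self_of_norm_one h₂, inner_eq_zero_comm' h, mul_zero, mul_one, add_zero, zero_add]

theorem norm_sq_smul_add_smul {e₁ e₂ : H} (h₁ : ‖e₁‖ = 1) (h₂ : ‖e₂‖ = 1)
    (h : inner ℂ e₁ e₂ = 0) (a b : ℂ) : ‖a • e₁ + b • e₂‖ ^ 2 = ‖a‖ ^ 2 + ‖b‖ ^ 2 := by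
  have := norm_add_sq_eq_norm_sq_add_norm_sq_of_inner_eq_zero (𝕜 := ℂ) (a • e₁) (b • e₂)
    (by rw [inner_smul_left, inner_smul_right, h]; simp)
  rw [norm_smul, norm_smul, h₁, h₂] at this
  simpa [sq] using this

theorem norm_sq_of_mem_span_orthonormal {e₁ e₂ x : H} (h₁ : ‖e₁‖ = 1) (h₂ : ‖e₂‖ = 1)
    (h : inner ℂ e₁ e₂ = 0) (hx : x ∈ Submodule.span ℂ {e₁, e₂}) :
    ‖x‖ ^ 2 = ‖inner ℂ e₁ x‖ ^ 2 + ‖inner ℂ e₂ x‖ ^ 2 := by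
  conv_lhs => rw [eq_of_mem_span_orthonormal h₁ h₂ h hx]
  exact norm_sq_smul_add_smul h₁ h₂ h _ _

theorem inner_of_mem_span_orthonormal {e₁ e₂ x : H} (h₁ : ‖e₁‖ = 1) (h₂ : ‖e₂‖ = 1)
    (h : inner ℂ e₁ e₂ = 0) (hx : x ∈ Submodule.span ℂ {e₁, e₂}) (w : H) :
    inner ℂ x w = star (inner ℂ e₁ x) * inner ℂ e₁ w + star (inner ℂ e₂ x) * inner ℂ e₂ w := by
  conv_lhs => rw [eq_of_mem_span_orthonormal h₁ h₂ h hx]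
  rw [inner_add_left, inner_smul_left, inner_smul_left]
  rfl

theorem linearIndependent_of_orthonormal {e₁ e₂ : H} (h₁ : ‖e₁‖ = 1) (h₂ : ‖e₂‖ = 1)
    (h : inner ℂ e₁ e₂ = 0) : LinearIndependent ℂ ![e₁, e₂] := by
  rw [LinearIndependent.pair_iff' (ne_zero_of_norm_one h₁)]
  rintro a rfl
  rw [inner_smul_right, inner_self_of_norm_one h₁, mul_one] at h
  rw [h, zero_smul, norm_zero] at h₂
  exact zero_ne_one h₂

theorem ray_ne_of_orthonormal {e₁ e₂ : H} (h₁ : ‖e₁‖ = 1) (h₂ : ‖e₂‖ = 1)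
    (h : inner ℂ e₁ e₂ = 0) : ray e₁ ≠ ray e₂ := by
  intro he
  have := overlap_ray h₁ h₂
  rw [← he, overlap_ray h₁ h₁, h, inner_self_of_norm_one h₁] at this
  norm_num at this

theorem exists_orthonormal_basis_of_mem {u v e : H} (hu : ‖u‖ = 1) (hv : ‖v‖ = 1)
    (huv : ray u ≠ ray v) (he : ‖e‖ = 1) (hmem : e ∈ Submodule.span ℂ {u, v}) :
    ∃ f : H, ‖f‖ = 1 ∧ inner ℂ e f = 0 ∧ Submodule.span ℂ {e, f} = Submodule.span ℂ {u, v} := by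
  obtain ⟨x, hx, hxe⟩ : ∃ x ∈ Submodule.span ℂ {u, v}, x - inner ℂ e x • e ≠ 0 := by
    by_contra! hc
    have h1 := hc u (Submodule.subset_span (by simp))
    have h2 := hc v (Submodule.subset_span (by simp))
    have e1 := (ray_eq_ray_iff (ne_zero_of_norm_one hu) (ne_zero_of_norm_one he)).mpr
      ⟨_, (sub_eq_zero.mp h1).symm⟩
    have e2 := (ray_eq_ray_iff (ne_zero_of_norm_one hv) (ne_zero_of_norm_one he)).mpr
      ⟨_, (sub_eq_zero.mp h2).symm⟩
    exact huv (e1.trans e2.symm)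
  obtain ⟨f, hf, hfe⟩ := exists_normalization hxe
  have hn : (‖x - inner ℂ e x • e‖ : ℂ) ≠ 0 := by exact_mod_cast norm_ne_zero_iff.mpr hxe
  have hef : inner ℂ e f = 0 := by
    have : inner ℂ e (x - inner ℂ e x • e) = 0 := by
      rw [inner_sub_right, inner_smul_right, inner_self_of_norm_one he, mul_one, sub_self]
    rw [hfe, inner_smul_right] at this
    exact (mul_eq_zero.mp this).resolve_left hn
  refine ⟨f, hf, hef, span_pair_eq_of_mem (linearIndependent_of_orthonormal he hf hef) hmem ?_⟩
  rw [← Submodule.smul_mem_iff _ hn, ← hfe]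
  exact Submodule.sub_mem _ hx (Submodule.smul_mem _ _ hmem)

theorem exists_decomposition (L : Submodule ℂ H) [FiniteDimensional ℂ L] (w : H) :
    ∃ w₁ ∈ L, ∃ w₂ ∈ Lᗮ, w = w₁ + w₂ :=
  L.exists_add_mem_mem_orthogonal w

instance finiteDimensional_span_pair (u v : H) :
    FiniteDimensional ℂ (Submodule.span ℂ ({u, v} : Set H)) :=
  FiniteDimensional.span_of_finite ℂ (Set.toFinite _)

instance finiteDimensional_span_triple (u v w : H) :
    FiniteDimensional ℂ (Submodule.span ℂ ({u, v, w} : Set H)) :=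
  FiniteDimensional.span_of_finite ℂ (Set.toFinite _)

/-- Three points of a circle of latitude determine its two poles. -/
theorem inner_eq_zero_or_of_norm_inner_eq {e₁ e₂ s₁ s₂ s₃ w : H} {k t : ℝ} (h₁ : ‖e₁‖ = 1)
    (h₂ : ‖e₂‖ = 1) (h : inner ℂ e₁ e₂ = 0) (hk : 0 < k)
    (n₁ : ‖s₁‖ = 1) (n₂ : ‖s₂‖ = 1) (n₃ : ‖s₃‖ = 1)
    (h12 : ray s₁ ≠ ray s₂) (h13 : ray s₁ ≠ ray s₃) (h23 : ray s₂ ≠ ray s₃)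
    (m₁ : s₁ ∈ Submodule.span ℂ {e₁, e₂}) (m₂ : s₂ ∈ Submodule.span ℂ {e₁, e₂})
    (m₃ : s₃ ∈ Submodule.span ℂ {e₁, e₂})
    (k₁ : ‖inner ℂ e₁ s₁‖ = k) (k₂ : ‖inner ℂ e₁ s₂‖ = k) (k₃ : ‖inner ℂ e₁ s₃‖ = k)
    (t₁ : ‖inner ℂ s₁ w‖ = t) (t₂ : ‖inner ℂ s₂ w‖ = t) (t₃ : ‖inner ℂ s₃ w‖ = t) :
    inner ℂ e₁ w = 0 ∨ inner ℂ e₂ w = 0 := by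
  have hσ : ∀ s : H, ‖inner ℂ e₁ s‖ = k → inner ℂ e₁ s ≠ 0 := by
    intro s hs h0
    rw [h0, norm_zero] at hs
    exact hk.ne hs
  -- The conjugated ratio of the two coordinates of s determines its ray. On a circle of latitude
  -- all these ratios have one modulus, so the three-point lemma for a + z · b applies.
  have hr : ∀ s : H, ‖s‖ = 1 → s ∈ Submodule.span ℂ {e₁, e₂} → ‖inner ℂ e₁ s‖ = k →
      ‖star (inner ℂ e₂ s / inner ℂ e₁ s)‖ = Real.sqrt (1 - k ^ 2) / k := by
    intro s hs hm hks
    have := norm_sq_of_mem_span_orthonormal h₁ h₂ h hm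
    rw [hs, hks] at this
    rw [norm_star, norm_div, hks, ← Real.sqrt_sq (norm_nonneg (inner ℂ e₂ s))]
    congr 2
    linarith
  have hne : ∀ s s' : H, ‖s‖ = 1 → ‖s'‖ = 1 → s ∈ Submodule.span ℂ {e₁, e₂} →
      s' ∈ Submodule.span ℂ {e₁, e₂} → ‖inner ℂ e₁ s‖ = k → ‖inner ℂ e₁ s'‖ = k →
      ray s ≠ ray s' → star (inner ℂ e₂ s / inner ℂ e₁ s) ≠
        star (inner ℂ e₂ s' / inner ℂ e₁ s') := by
    intro s s' hs hs' hm hm' hks hks' hss hc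
    apply hss
    rw [ray_eq_ray_iff (ne_zero_of_norm_one hs) (ne_zero_of_norm_one hs')]
    refine ⟨inner ℂ e₁ s / inner ℂ e₁ s', ?_⟩
    have hc' := star_injective hc
    have ha := hσ s hks
    have ha' := hσ s' hks'
    have hd := eq_of_mem_span_orthonormal h₁ h₂ h hm
    have hd' := eq_of_mem_span_orthonormal h₁ h₂ h hm'
    generalize inner ℂ e₁ s = a at *
    generalize inner ℂ e₂ s = b at *
    generalize inner ℂ e₁ s' = a' at *
    generalize inner ℂ e₂ s' = b' at *
    rw [hd, hd', smul_add, smul_smul, smul_smul, div_mul_cancel₀ _ ha']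
    congr 2
    field_simp at hc' ⊢
    linear_combination -hc'
  have hv : ∀ s : H, s ∈ Submodule.span ℂ {e₁, e₂} → ‖inner ℂ e₁ s‖ = k → ‖inner ℂ s w‖ = t →
      ‖inner ℂ e₁ w + star (inner ℂ e₂ s / inner ℂ e₁ s) * inner ℂ e₂ w‖ = t / k := by
    intro s hm hks hts
    have h0 := hσ s hks
    have h0' : star (inner ℂ e₁ s) ≠ 0 := star_ne_zero.mpr h0
    rw [eq_div_iff hk.ne', ← hts, inner_of_mem_span_orthonormal h₁ h₂ h hm, ← hks,
      ← norm_star (inner ℂ e₁ s), ← norm_mul, star_div₀]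
    congr 1
    field_simp
  exact eq_zero_or_eq_zero_of_norm_add_mul_of_norm_eq (hr _ n₁ m₁ k₁) (hr _ n₂ m₂ k₂)
    (hr _ n₃ m₃ k₃) (hne _ _ n₁ n₂ m₁ m₂ k₁ k₂ h12) (hne _ _ n₁ n₃ m₁ m₃ k₁ k₃ h13)
    (hne _ _ n₂ n₃ m₂ m₃ k₂ k₃ h23) (hv _ m₁ k₁ t₁) (hv _ m₂ k₂ t₂) (hv _ m₃ k₃ t₃)

/-- The component of w₀ in the line is nonzero because c > 0, and its direction is e₁. For s in the
line, the overlap with w₀ is a fixed multiple of |⟪e₁, s⟫|, so the three points share a latitude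
about e₁. -/
theorem exists_poles {s₁ s₂ s₃ w₀ : H} {c : ℝ} (hc : 0 < c)
    (n₁ : ‖s₁‖ = 1) (n₂ : ‖s₂‖ = 1) (n₃ : ‖s₃‖ = 1)
    (h12 : ray s₁ ≠ ray s₂) (h13 : ray s₁ ≠ ray s₃) (h23 : ray s₂ ≠ ray s₃)
    (m₃ : s₃ ∈ Submodule.span ℂ {s₁, s₂})
    (c₁ : ‖inner ℂ s₁ w₀‖ = c) (c₂ : ‖inner ℂ s₂ w₀‖ = c) (c₃ : ‖inner ℂ s₃ w₀‖ = c) :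
    ∃ e₁ e₂ : H, ‖e₁‖ = 1 ∧ ‖e₂‖ = 1 ∧ inner ℂ e₁ e₂ = 0 ∧
      Submodule.span ℂ {e₁, e₂} = Submodule.span ℂ {s₁, s₂} ∧ inner ℂ e₂ w₀ = 0 ∧
      (∃ k, 0 < k ∧ ‖inner ℂ e₁ s₁‖ = k ∧ ‖inner ℂ e₁ s₂‖ = k ∧ ‖inner ℂ e₁ s₃‖ = k) ∧
      ∀ w : H, ‖inner ℂ s₁ w‖ = c → ‖inner ℂ s₂ w‖ = c → ‖inner ℂ s₃ w‖ = c →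
        inner ℂ e₁ w = 0 ∨ inner ℂ e₂ w = 0 := by
  have m₁ : s₁ ∈ Submodule.span ℂ {s₁, s₂} := Submodule.subset_span (by simp)
  have m₂ : s₂ ∈ Submodule.span ℂ {s₁, s₂} := Submodule.subset_span (by simp)
  obtain ⟨x, hx, y, hy, rfl⟩ := exists_decomposition (Submodule.span ℂ {s₁, s₂}) w₀
  have hxy : ∀ s ∈ Submodule.span ℂ {s₁, s₂}, inner ℂ s (x + y) = inner ℂ s x := by
    intro s hs
    rw [inner_add_right, (Submodule.mem_orthogonal _ _).mp hy s hs, add_zero]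
  rw [hxy _ m₁] at c₁
  rw [hxy _ m₂] at c₂
  rw [hxy _ m₃] at c₃
  have hx0 : x ≠ 0 := by
    rintro rfl
    rw [inner_zero_right, norm_zero] at c₁
    exact hc.ne c₁
  obtain ⟨e₁, he₁, hxe⟩ := exists_normalization hx0
  have hn0 : 0 < ‖x‖ := norm_pos_iff.mpr hx0
  have hn : (‖x‖ : ℂ) ≠ 0 := by exact_mod_cast hn0.ne'
  have me₁ : e₁ ∈ Submodule.span ℂ {s₁, s₂} := by
    rw [← Submodule.smul_mem_iff _ hn, ← hxe]
    exact hx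
  obtain ⟨e₂, he₂, h, hs⟩ := exists_orthonormal_basis_of_mem n₁ n₂ h12 he₁ me₁
  have hk : ∀ s : H, ‖inner ℂ s x‖ = c → ‖inner ℂ e₁ s‖ = c / ‖x‖ := by
    intro s hsc
    rw [eq_div_iff hn0.ne', ← hsc, norm_inner_symm]
    conv_rhs => rw [hxe]
    rw [inner_smul_right, norm_mul, Complex.norm_real, norm_norm, mul_comm]
  have hkpos : 0 < c / ‖x‖ := by positivity
  refine ⟨e₁, e₂, he₁, he₂, h, hs, ?_, ⟨_, hkpos, hk _ c₁, hk _ c₂, hk _ c₃⟩, ?_⟩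
  · rw [hxy e₂ (by rw [← hs]; exact Submodule.subset_span (by simp)), hxe, inner_smul_right,
      inner_eq_zero_comm' h, mul_zero]
  · intro w w₁ w₂ w₃
    rw [← hs] at m₁ m₂ m₃
    exact inner_eq_zero_or_of_norm_inner_eq he₁ he₂ h hkpos n₁ n₂ n₃ h12 h13 h23 m₁ m₂ m₃
      (hk _ c₁) (hk _ c₂) (hk _ c₃) w₁ w₂ w₃

/-- In a three-dimensional space, a plane section contains no three independent vectors. -/
theorem not_linearIndependent_of_inner_eq_zero {p₁ p₂ p₃ v w₁ w₂ w₃ : H}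
    (hv : v ∈ Submodule.span ℂ {p₁, p₂, p₃}) (hv0 : v ≠ 0)
    (m₁ : w₁ ∈ Submodule.span ℂ {p₁, p₂, p₃}) (m₂ : w₂ ∈ Submodule.span ℂ {p₁, p₂, p₃})
    (m₃ : w₃ ∈ Submodule.span ℂ {p₁, p₂, p₃})
    (h₁ : inner ℂ v w₁ = 0) (h₂ : inner ℂ v w₂ = 0) (h₃ : inner ℂ v w₃ = 0) :
    ¬ LinearIndependent ℂ ![w₁, w₂, w₃] := by
  intro hli
  have h4 : LinearIndependent ℂ (Fin.cons v ![w₁, w₂, w₃] : Fin 4 → H) := by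
    rw [linearIndependent_finCons]
    refine ⟨hli, fun hm => hv0 ?_⟩
    have hle : Submodule.span ℂ (Set.range ![w₁, w₂, w₃]) ≤ (Submodule.span ℂ {v})ᗮ := by
      rw [Submodule.span_le]
      rintro _ ⟨i, rfl⟩
      rw [SetLike.mem_coe, Submodule.mem_orthogonal_singleton_iff_inner_right]
      fin_cases i
      exacts [h₁, h₂, h₃]
    have := Submodule.mem_orthogonal_singleton_iff_inner_right.mp (hle hm)
    exact inner_self_eq_zero.mp this
  have hle : Submodule.span ℂ (Set.range (Fin.cons v ![w₁, w₂, w₃] : Fin 4 → H)) ≤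
      Submodule.span ℂ {p₁, p₂, p₃} := by
    rw [Submodule.span_le]
    rintro _ ⟨i, rfl⟩
    fin_cases i
    exacts [hv, m₁, m₂, m₃]
  have h5 := Submodule.finrank_mono hle
  rw [finrank_span_eq_card h4, Fintype.card_fin] at h5
  have h6 := finrank_range_le_card (R := ℂ) ![p₁, p₂, p₃]
  rw [Matrix.range_cons, Matrix.range_cons, Matrix.range_cons, Matrix.range_empty, Set.union_empty,
    Set.singleton_union, Set.singleton_union, Fintype.card_fin] at h6
  change Module.finrank ℂ _ ≤ 3 at h6
  omega

theorem mem_span_of_not_linearIndependent {w₁ w₂ w₃ : H} (n₁ : ‖w₁‖ = 1) (n₂ : ‖w₂‖ = 1)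
    (h12 : ray w₁ ≠ ray w₂) (h : ¬ LinearIndependent ℂ ![w₁, w₂, w₃]) :
    w₃ ∈ Submodule.span ℂ {w₁, w₂} := by
  by_contra hm
  apply h
  have h3 : LinearIndependent ℂ (Fin.snoc ![w₁, w₂] w₃ : Fin 3 → H) := by
    rw [linearIndependent_finSnoc]
    refine ⟨linearIndependent_of_ray_ne n₁ n₂ h12, ?_⟩
    rwa [Matrix.range_cons, Matrix.range_cons, Matrix.range_empty, Set.union_empty,
      Set.singleton_union]
  convert h3 using 1
  ext i
  fin_cases i <;> rfl

end Rays

/-! ### Varying the phases of inner products with three vectors -/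

section Phases

set_option linter.unusedSectionVars false

variable {H : Type*} [NormedAddCommGroup H] [InnerProductSpace ℂ H]

/-- Rescaling the component of `p k` orthogonal to the other two vectors gives a dual vector. Adding
multiples of it changes one inner product and leaves the other two alone. -/
theorem exists_mem_span_inner_eq_one {p : Fin 3 → H} (hp : LinearIndependent ℂ p) (k : Fin 3) :
    ∃ q ∈ Submodule.span ℂ (Set.range p), inner ℂ (p k) q = 1 ∧ ∀ j, j ≠ k → inner ℂ (p j) q = 0 := by
  set K := Submodule.span ℂ (p '' {k}ᶜ) with hK
  have hk : p k ∉ K := hp.notMem_span_image (by simp)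
  have : FiniteDimensional ℂ K := FiniteDimensional.span_of_finite ℂ (Set.toFinite _)
  obtain ⟨x, hx, y, hy, hxy⟩ := K.exists_add_mem_mem_orthogonal (p k)
  have hy0 : y ≠ 0 := by
    rintro rfl
    rw [add_zero] at hxy
    exact hk (hxy ▸ hx)
  have hyy : inner ℂ y y ≠ 0 := inner_self_ne_zero.mpr hy0
  have hKle : K ≤ Submodule.span ℂ (Set.range p) :=
    Submodule.span_mono (Set.image_subset_range _ _)
  have hymem : y ∈ Submodule.span ℂ (Set.range p) := by
    have : y = p k - x := by rw [hxy]; abel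
    rw [this]
    exact Submodule.sub_mem _ (Submodule.subset_span ⟨k, rfl⟩) (hKle hx)
  refine ⟨(inner ℂ y y)⁻¹ • y, Submodule.smul_mem _ _ hymem, ?_, ?_⟩
  · rw [inner_smul_right, hxy, inner_add_left, (Submodule.mem_orthogonal _ _).mp hy x hx, zero_add,
      inv_mul_cancel₀ hyy]
  · intro j hj
    rw [inner_smul_right, (Submodule.mem_orthogonal _ _).mp hy (p j)
      (Submodule.subset_span ⟨j, hj, rfl⟩), mul_zero]

theorem norm_sq_add_of_mem_orthogonal {E : Submodule ℂ H} {v y : H} (hv : v ∈ E) (hy : y ∈ Eᗮ) :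
    ‖v + y‖ ^ 2 = ‖v‖ ^ 2 + ‖y‖ ^ 2 := by
  have := norm_add_sq_eq_norm_sq_add_norm_sq_of_inner_eq_zero (𝕜 := ℂ) v y
    ((Submodule.mem_orthogonal _ _).mp hy v hv)
  simpa [sq] using this

theorem inner_add_of_mem_orthogonal {E : Submodule ℂ H} {x₁ x₂ v y : H} (hx₁ : x₁ ∈ E)
    (hx₂ : x₂ ∈ Eᗮ) (hv : v ∈ E) (hy : y ∈ Eᗮ) :
    inner ℂ (x₁ + x₂) (v + y) = inner ℂ x₁ v + inner ℂ x₂ y := by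
  rw [inner_add_left, inner_add_right, inner_add_right, (Submodule.mem_orthogonal _ _).mp hy x₁ hx₁,
    (Submodule.mem_orthogonal' _ _).mp hx₂ v hv, add_zero, zero_add]

theorem exists_smul_norm_eq {y : H} (hy : y ≠ 0) {ρ : ℝ} (hρ : 0 ≤ ρ) :
    ∃ t : ℂ, ‖t • y‖ = ρ ∧ inner ℂ y (t • y) = (ρ * ‖y‖ : ℝ) := by
  have h0 : (‖y‖ : ℂ) ≠ 0 := by exact_mod_cast norm_ne_zero_iff.mpr hy
  refine ⟨(ρ / ‖y‖ : ℝ), ?_, ?_⟩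
  · rw [norm_smul, Complex.norm_real, Real.norm_of_nonneg (by positivity),
      div_mul_cancel₀ _ (norm_ne_zero_iff.mpr hy)]
  · rw [inner_smul_right, inner_self_eq_norm_sq_to_K]
    push_cast
    simp only [Complex.coe_algebraMap]
    field_simp

variable [Nontrivial H]

/-- If w left the span E, its component in E would be shorter than 1. That slack allows independent
small changes of the three phases and free rotations in Eᗮ, and these are incompatible with a
constant overlap against x and x'. -/
theorem mem_span_range_of_forall_norm_inner_eq {c : ℝ} (hc : 0 < c) {p : Fin 3 → H}
    (hp : LinearIndependent ℂ p) {w : H} (hw : ‖w‖ = 1) (hpw : ∀ j, ‖inner ℂ (p j) w‖ = c)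
    {x x' : H} (hx : ‖x‖ = 1) (hx' : ‖x'‖ = 1) (hxx' : ray x ≠ ray x')
    (hxp : ∀ k, x ∉ Submodule.span ℂ (p '' {k}ᶜ)) (hxp' : ∀ k, x' ∉ Submodule.span ℂ (p '' {k}ᶜ))
    (h : ∀ v : H, ‖v‖ = 1 → (∀ j, ‖inner ℂ (p j) v‖ = c) →
      ‖inner ℂ x v‖ = c ∧ ‖inner ℂ x' v‖ = c) :
    w ∈ Submodule.span ℂ (Set.range p) := by
  by_contra hwE
  set E := Submodule.span ℂ (Set.range p) with hE
  have hpE : ∀ j, p j ∈ E := fun j => Submodule.subset_span ⟨j, rfl⟩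
  have : FiniteDimensional ℂ E := FiniteDimensional.span_of_finite ℂ (Set.toFinite _)
  obtain ⟨w₁, hw₁, w₂, hw₂, rfl⟩ := E.exists_add_mem_mem_orthogonal w
  have hw₂0 : w₂ ≠ 0 := by
    rintro rfl
    rw [add_zero] at hwE
    exact hwE hw₁
  have hpv : ∀ j, ∀ v y : H, y ∈ Eᗮ → inner ℂ (p j) (v + y) = inner ℂ (p j) v := by
    intro j v y hy
    rw [inner_add_right, (Submodule.mem_orthogonal _ _).mp hy _ (hpE j), add_zero]
  simp only [hpv _ _ _ hw₂] at hpw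
  have hw₁n : ‖w₁‖ < 1 := by
    have h1 := norm_sq_add_of_mem_orthogonal hw₁ hw₂
    rw [hw] at h1
    have := norm_pos_iff.mpr hw₂0
    nlinarith [norm_nonneg w₁]
  have unitv : ∀ v ∈ E, ‖v‖ < 1 → ∀ y ∈ Eᗮ, ‖y‖ = Real.sqrt (1 - ‖v‖ ^ 2) → ‖v + y‖ = 1 := by
    intro v hv hv1 y hy hyn
    have h1 := norm_sq_add_of_mem_orthogonal hv hy
    rw [hyn, Real.sq_sqrt (by nlinarith [norm_nonneg v])] at h1
    have : ‖v + y‖ ^ 2 = 1 ^ 2 := by linarith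
    exact (pow_left_inj₀ (norm_nonneg _) zero_le_one two_ne_zero).mp this
  choose q hqE hqk hqj using exists_mem_span_inner_eq_one hp
  -- Multiply the k-th inner product by ζ near 1: all moduli are unchanged, and the norm stays below
  -- 1, so a vector of Eᗮ can restore unit length.
  have hpert : ∀ k, ∃ ε > 0, ∀ ζ : ℂ, ‖ζ‖ = 1 → ‖ζ - 1‖ < ε →
      ‖w₁ + ((ζ - 1) * inner ℂ (p k) w₁) • q k‖ < 1 ∧
      ∀ j, ‖inner ℂ (p j) (w₁ + ((ζ - 1) * inner ℂ (p k) w₁) • q k)‖ = c := by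
    intro k
    have hd : 0 < c * ‖q k‖ + 1 := by positivity
    refine ⟨(1 - ‖w₁‖) / (c * ‖q k‖ + 1), div_pos (by linarith) hd, ?_⟩
    intro ζ hζ hζ1
    constructor
    · rw [lt_div_iff₀ hd] at hζ1
      have h1 := norm_add_le w₁ (((ζ - 1) * inner ℂ (p k) w₁) • q k)
      rw [norm_smul, norm_mul, hpw] at h1
      nlinarith [norm_nonneg (ζ - 1)]
    · intro j
      rw [inner_add_right, inner_smul_right]
      by_cases hjk : j = k
      · subst hjk
        rw [hqk, mul_one, show inner ℂ (p j) w₁ + (ζ - 1) * inner ℂ (p j) w₁ =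
          ζ * inner ℂ (p j) w₁ by ring, norm_mul, hζ, one_mul, hpw]
      · rw [hqj k j hjk, mul_zero, add_zero, hpw]
  have hpertE : ∀ k, ∀ t : ℂ, w₁ + t • q k ∈ E := fun k t =>
    Submodule.add_mem _ hw₁ (Submodule.smul_mem _ _ (hqE k))
  have inner_ne : ∀ k, inner ℂ (p k) w₁ ≠ 0 := by
    intro k h0
    have := hpw k
    rw [h0, norm_zero] at this
    exact hc.ne this
  have claim : ∀ u : H, (∀ k, u ∉ Submodule.span ℂ (p '' {k}ᶜ)) →
      (∀ v : H, ‖v‖ = 1 → (∀ j, ‖inner ℂ (p j) v‖ = c) → ‖inner ℂ u v‖ = c) → u ∈ Eᗮ := by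
    intro u hup hu
    obtain ⟨u₁, hu₁, u₂, hu₂, rfl⟩ := E.exists_add_mem_mem_orthogonal u
    obtain ⟨α, hα⟩ := (Submodule.mem_span_range_iff_exists_fun ℂ).mp hu₁
    have huq : ∀ k, inner ℂ u₁ (q k) = star (α k) := by
      intro k
      rw [← hα, sum_inner, Finset.sum_eq_single k]
      · rw [inner_smul_left, hqk, mul_one]; rfl
      · intro j _ hj
        rw [inner_smul_left, hqj k j hj, mul_zero]
      · simp
    by_cases hu₂0 : u₂ = 0
    · exfalso
      subst hu₂0
      rw [add_zero] at hup hu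
      have hαk : ∀ k, α k ≠ 0 := by
        intro k h0
        apply hup k
        rw [← hα]
        refine Submodule.sum_mem _ fun j _ => ?_
        by_cases hjk : j = k
        · subst hjk
          rw [h0, zero_smul]
          exact Submodule.zero_mem _
        · exact Submodule.smul_mem _ _ (Submodule.subset_span ⟨j, hjk, rfl⟩)
      have hval : ∀ v ∈ E, ‖v‖ < 1 → (∀ j, ‖inner ℂ (p j) v‖ = c) → ‖inner ℂ u₁ v‖ = c := by
        intro v hv hv1 hvp
        obtain ⟨t, ht, _⟩ := exists_smul_norm_eq hw₂0 (Real.sqrt_nonneg (1 - ‖v‖ ^ 2))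
        have hty : t • w₂ ∈ Eᗮ := Submodule.smul_mem _ _ hw₂
        have := hu (v + t • w₂) (unitv v hv hv1 _ hty ht) (fun j => by rw [hpv _ _ _ hty, hvp])
        rwa [inner_add_right, (Submodule.mem_orthogonal _ _).mp hty _ hu₁, add_zero] at this
      -- Turning one phase through three values kills the sum of the other terms, so each of the
      -- three terms equals the whole sum. The sum is then three times itself, hence zero, against c
      -- > 0.
      have hk : ∀ k, inner ℂ u₁ w₁ = star (α k) * inner ℂ (p k) w₁ := by
        intro k
        obtain ⟨ε, hε, hζ⟩ := hpert k
        obtain ⟨z₁, z₂, h1, h2, h3, h4, h5, h6, h7⟩ := exists_two_unimodular_near_one hε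
        have hval' : ∀ ζ : ℂ, ‖ζ‖ = 1 → ‖ζ - 1‖ < ε →
            ‖(inner ℂ u₁ w₁ - star (α k) * inner ℂ (p k) w₁) +
              ζ * (star (α k) * inner ℂ (p k) w₁)‖ = c := by
          intro ζ hn hl
          obtain ⟨ha, hb⟩ := hζ ζ hn hl
          rw [← hval _ (hpertE k _) ha hb, inner_add_right, inner_smul_right, huq]
          congr 1
          ring
        rcases eq_zero_or_eq_zero_of_norm_add_mul h1 h2 norm_one h5 h3 h4 (hval' _ h1 h6)
          (hval' _ h2 h7) (hval' 1 norm_one (by simpa using hε)) with h0 | h0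
        · exact sub_eq_zero.mp h0
        · exact absurd h0 (mul_ne_zero (star_ne_zero.mpr (hαk k)) (inner_ne k))
      have hsum : inner ℂ u₁ w₁ = ∑ k, star (α k) * inner ℂ (p k) w₁ := by
        conv_lhs => rw [← hα]
        rw [sum_inner]
        exact Finset.sum_congr rfl fun k _ => inner_smul_left _ _ _
      rw [Finset.sum_congr rfl fun k _ => (hk k).symm, Finset.sum_const, Finset.card_univ,
        Fintype.card_fin, nsmul_eq_mul] at hsum
      have h0 : inner ℂ u₁ w₁ = 0 := by
        push_cast at hsum
        linear_combination (-1 / 2) * hsum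
      have := hval w₁ hw₁ hw₁n hpw
      rw [h0, norm_zero] at this
      exact hc.ne this
    -- Here the component in Eᗮ can be rotated along u₂ through the whole unit circle, which forces
    -- the contribution from E to vanish.
    · have hval : ∀ v ∈ E, ‖v‖ < 1 → (∀ j, ‖inner ℂ (p j) v‖ = c) → inner ℂ u₁ v = 0 := by
        intro v hv hv1 hvp
        have hs : 0 < 1 - ‖v‖ ^ 2 := by nlinarith [norm_nonneg v]
        obtain ⟨t, ht, hti⟩ := exists_smul_norm_eq hu₂0 (Real.sqrt_nonneg (1 - ‖v‖ ^ 2))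
        have h1 : ∀ z : ℂ, ‖z‖ = 1 →
            ‖inner ℂ u₁ v + z * ((Real.sqrt (1 - ‖v‖ ^ 2) * ‖u₂‖ : ℝ) : ℂ)‖ = c := by
          intro z hz
          have hty : z • t • u₂ ∈ Eᗮ := Submodule.smul_mem _ _ (Submodule.smul_mem _ _ hu₂)
          have := hu (v + z • t • u₂)
            (unitv v hv hv1 _ hty (by rw [norm_smul, hz, one_mul, ht]))
            (fun j => by rw [hpv _ _ _ hty, hvp])
          rwa [inner_add_of_mem_orthogonal hu₁ hu₂ hv hty, inner_smul_right, hti] at this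
        refine (eq_zero_or_eq_zero_of_forall_norm_add_mul h1).resolve_right ?_
        have := Real.sqrt_pos.mpr hs
        have := norm_pos_iff.mpr hu₂0
        exact_mod_cast (by positivity : Real.sqrt (1 - ‖v‖ ^ 2) * ‖u₂‖ ≠ 0)
      have hα0 : ∀ k, α k = 0 := by
        intro k
        obtain ⟨ε, hε, hζ⟩ := hpert k
        obtain ⟨z₁, -, h1, -, h3, -, -, h6, -⟩ := exists_two_unimodular_near_one hε
        obtain ⟨ha, hb⟩ := hζ z₁ h1 h6
        have := hval _ (hpertE k _) ha hb
        rw [inner_add_right, hval w₁ hw₁ hw₁n hpw, zero_add, inner_smul_right, huq] at this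
        exact star_eq_zero.mp ((mul_eq_zero.mp this).resolve_left
          (mul_ne_zero (sub_ne_zero.mpr h3) (inner_ne k)))
      rw [← hα, Finset.sum_eq_zero fun k _ => by rw [hα0, zero_smul], zero_add]
      exact hu₂
  have hxE := claim x hxp fun v hv hvp => (h v hv hvp).1
  have hxE' := claim x' hxp' fun v hv hvp => (h v hv hvp).2
  -- The second point supplies a direction in Eᗮ orthogonal to x; completing w₁ along it yields an
  -- admissible vector orthogonal to x.
  have hy0 : x' - inner ℂ x x' • x ≠ 0 := by
    intro h0
    exact hxx' ((ray_eq_ray_iff (ne_zero_of_norm_one hx') (ne_zero_of_norm_one hx)).mpr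
      ⟨_, (sub_eq_zero.mp h0).symm⟩).symm
  obtain ⟨t, ht, -⟩ := exists_smul_norm_eq hy0 (Real.sqrt_nonneg (1 - ‖w₁‖ ^ 2))
  have hty : t • (x' - inner ℂ x x' • x) ∈ Eᗮ :=
    Submodule.smul_mem _ _ (Submodule.sub_mem _ hxE' (Submodule.smul_mem _ _ hxE))
  have := (h _ (unitv w₁ hw₁ hw₁n _ hty ht) (fun j => by rw [hpv _ _ _ hty, hpw])).1
  rw [inner_add_right, (Submodule.mem_orthogonal' _ _).mp hxE _ hw₁, inner_smul_right,
    inner_sub_right, inner_smul_right, inner_self_of_norm_one hx, mul_one, sub_self, mul_zero,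
    add_zero, norm_zero] at this
  exact hc.ne this

/-- Expand s and s' in p₁, p₂, p₃ and divide by ⟪p₁, w⟫: the conditions become two unimodular
equations in a = ⟪p₂, w⟫ / ⟪p₁, w⟫ and b = ⟪p₃, w⟫ / ⟪p₁, w⟫. Each span exclusion gives a
nonvanishing coefficient or minor. -/
theorem finite_setOf_inner_ratio {c : ℝ} (hc : 0 < c) {p₁ p₂ p₃ s s' : H}
    (hs : s ∈ Submodule.span ℂ {p₁, p₂, p₃}) (hs' : s' ∈ Submodule.span ℂ {p₁, p₂, p₃})
    (h12 : s ∉ Submodule.span ℂ {p₁, p₂}) (h13 : s ∉ Submodule.span ℂ {p₁, p₃})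
    (h23 : s ∉ Submodule.span ℂ {p₂, p₃}) (h13' : s' ∉ Submodule.span ℂ {p₁, p₃})
    (h23' : s' ∉ Submodule.span ℂ {p₂, p₃}) (h1 : s' ∉ Submodule.span ℂ {s, p₁})
    (h2 : s' ∉ Submodule.span ℂ {s, p₂}) :
    {a : ℂ | ∃ w : H, ‖inner ℂ p₁ w‖ = c ∧ ‖inner ℂ p₂ w‖ = c ∧ ‖inner ℂ p₃ w‖ = c ∧
      ‖inner ℂ s w‖ = c ∧ ‖inner ℂ s' w‖ = c ∧ inner ℂ p₂ w = a * inner ℂ p₁ w}.Finite := by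
  obtain ⟨x, y, z, rfl⟩ := Submodule.mem_span_triple.mp hs
  obtain ⟨x', y', z', rfl⟩ := Submodule.mem_span_triple.mp hs'
  have hx : x ≠ 0 := by
    rintro rfl
    exact h23 (Submodule.mem_span_pair.mpr ⟨y, z, by module⟩)
  have hy : y ≠ 0 := by
    rintro rfl
    exact h13 (Submodule.mem_span_pair.mpr ⟨x, z, by module⟩)
  have hz : z ≠ 0 := by
    rintro rfl
    exact h12 (Submodule.mem_span_pair.mpr ⟨x, y, by module⟩)
  have hx' : x' ≠ 0 := by
    rintro rfl
    exact h23' (Submodule.mem_span_pair.mpr ⟨y', z', by module⟩)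
  have hy' : y' ≠ 0 := by
    rintro rfl
    exact h13' (Submodule.mem_span_pair.mpr ⟨x', z', by module⟩)
  have hxz : x * z' - x' * z ≠ 0 := by
    intro h0
    have e : x' = z' / z * x := by field_simp; linear_combination -h0
    refine h2 (Submodule.mem_span_pair.mpr ⟨z' / z, y' - z' / z * y, ?_⟩)
    rw [e]
    match_scalars <;> field_simp
    ring
  have hyz : y * z' - y' * z ≠ 0 := by
    intro h0
    have e : y' = z' / z * y := by field_simp; linear_combination -h0
    refine h1 (Submodule.mem_span_pair.mpr ⟨z' / z, x' - z' / z * x, ?_⟩)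
    rw [e]
    match_scalars <;> field_simp
    ring
  have hst : ∀ u v u' v' : ℂ, u * v' - u' * v ≠ 0 → star u * star v' - star u' * star v ≠ 0 := by
    intro u v u' v' h h0
    apply h
    apply star_injective
    rw [star_zero, star_sub, star_mul, star_mul]
    linear_combination h0
  refine (finite_setOf_two_unimodular_equations (star_ne_zero.mpr hx) (star_ne_zero.mpr hy)
    (star_ne_zero.mpr hx') (star_ne_zero.mpr hy') (hst _ _ _ _ hxz) (hst _ _ _ _ hyz)).subset ?_
  rintro a ⟨w, w1, w2, w3, ws, ws', ha⟩
  have h0 : inner ℂ p₁ w ≠ 0 := by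
    intro h0
    rw [h0, norm_zero] at w1
    exact hc.ne w1
  have hdiv : ∀ u : ℂ, ‖u * inner ℂ p₁ w‖ = c → ‖u‖ = 1 := by
    intro u hu
    rw [norm_mul, w1] at hu
    exact mul_right_cancel₀ hc.ne' (by rw [hu, one_mul])
  have hb : inner ℂ p₃ w = inner ℂ p₃ w / inner ℂ p₁ w * inner ℂ p₁ w := by
    rw [div_mul_cancel₀ _ h0]
  refine ⟨hdiv a (by rw [← ha, w2]), inner ℂ p₃ w / inner ℂ p₁ w, hdiv _ (by rw [← hb, w3]),
    hdiv _ ?_, hdiv _ ?_⟩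
  · rw [← ws, inner_add_left, inner_add_left, inner_smul_left, inner_smul_left, inner_smul_left, ha]
    conv_rhs => rw [hb]
    simp only [Complex.star_def]
    ring_nf
  · rw [← ws', inner_add_left, inner_add_left, inner_smul_left, inner_smul_left, inner_smul_left, ha]
    conv_rhs => rw [hb]
    simp only [Complex.star_def]
    ring_nf

end Phases

/-! ### Circle-like sets contain three collinear points -/

section CircleLike

set_option linter.unusedSectionVars false

variable {H : Type*} [NormedAddCommGroup H] [InnerProductSpace ℂ H]

/-- The set of all points whose overlap with each point of `S` is `c`. -/
def equiangular (c : ℝ) (S : Set (ℙ ℂ H)) : Set (ℙ ℂ H) := {w | ∀ p ∈ S, overlap p w = c}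

/-- The properties of a great circle on a projective line, in terms of the relation
`overlap p q = c` alone, that force a set of points to be contained in a projective line. -/
structure CircleLike (c : ℝ) (F : Set (ℙ ℂ H)) : Prop where
  infinite : F.Infinite
  infinite_equiangular : (equiangular c F).Infinite
  mem_equiangular : ∀ p ∈ F, ∀ q ∈ F, ∀ r ∈ F, p ≠ q → p ≠ r → q ≠ r → ∀ w, overlap p w = c →
    overlap q w = c → overlap r w = c → w ∈ equiangular c F
  finite_diff : (equiangular c (equiangular c F) \ F).Finite

theorem Set.Infinite.exists_three {α : Type*} {s : Set α} (hs : s.Infinite) :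
    ∃ x ∈ s, ∃ y ∈ s, ∃ z ∈ s, x ≠ y ∧ x ≠ z ∧ y ≠ z := by
  obtain ⟨x, hx⟩ := hs.nonempty
  obtain ⟨y, hy, hyx⟩ := hs.exists_notMem_finite (Set.toFinite {x})
  obtain ⟨z, hz, hzxy⟩ := hs.exists_notMem_finite (Set.toFinite {x, y})
  simp only [Set.mem_singleton_iff, Set.mem_insert_iff, not_or] at hyx hzxy
  exact ⟨x, hx, y, hy, z, hz, Ne.symm hyx, Ne.symm hzxy.1, Ne.symm hzxy.2⟩

variable [Nontrivial H]

theorem mem_span_pair_of_mem {a b x y z : H} (hx1 : ‖x‖ = 1) (hy1 : ‖y‖ = 1)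
    (hxy : ray x ≠ ray y) (hx : x ∈ Submodule.span ℂ {a, b}) (hy : y ∈ Submodule.span ℂ {a, b})
    (hz : z ∈ Submodule.span ℂ {a, b}) : z ∈ Submodule.span ℂ {x, y} := by
  rwa [span_pair_eq_of_mem (linearIndependent_of_ray_ne hx1 hy1 hxy) hx hy]

/-- Suppose no three points are collinear. Every equiangular point then lies in the span of any
three points of F. Either these points are not all on the line p₁p₂, and F is squeezed into a
3-space and shown to be finite, or they are, and the double equiangular set contains a circle of
collinear points. -/
theorem CircleLike.exists_onLine {c : ℝ} (hc : 0 < c) {F : Set (ℙ ℂ H)} (hF : CircleLike c F) :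
    ∃ p ∈ F, ∃ q ∈ F, ∃ r ∈ F, p ≠ q ∧ p ≠ r ∧ q ≠ r ∧ OnLine p q r := by
  choose u hu hru using exists_ray (H := H)
  have hov : ∀ p q, overlap p q = ‖inner ℂ (u p) (u q)‖ := fun p q => by
    conv_lhs => rw [← hru p, ← hru q, overlap_ray (hu p) (hu q)]
  have hne : ∀ p q, p ≠ q → ray (u p) ≠ ray (u q) := fun p q h => by rwa [hru, hru]
  have hline : ∀ p q r, u r ∈ Submodule.span ℂ {u p, u q} → OnLine p q r := fun p q r h => by
    rw [← hru p, ← hru q, ← hru r]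
    exact (onLine_ray_iff (ne_zero_of_norm_one (hu p)) (ne_zero_of_norm_one (hu q))
      (ne_zero_of_norm_one (hu r))).mpr h
  by_contra! hcon
  have hnc : ∀ p ∈ F, ∀ q ∈ F, ∀ r ∈ F, p ≠ q → p ≠ r → q ≠ r →
      u r ∉ Submodule.span ℂ {u p, u q} := fun p hp q hq r hr h1 h2 h3 h =>
    hcon p hp q hq r hr h1 h2 h3 (hline _ _ _ h)
  have himg : ∀ (a b d : H) (k : Fin 3), (![a, b, d] '' {k}ᶜ = {b, d}) ∨
      (![a, b, d] '' {k}ᶜ = {a, d}) ∨ (![a, b, d] '' {k}ᶜ = {a, b}) := by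
    intro a b d k
    have h0 : ({0}ᶜ : Set (Fin 3)) = {1, 2} := by ext i; fin_cases i <;> simp
    have h1 : ({1}ᶜ : Set (Fin 3)) = {0, 2} := by ext i; fin_cases i <;> simp
    have h2 : ({2}ᶜ : Set (Fin 3)) = {0, 1} := by ext i; fin_cases i <;> simp
    fin_cases k
    · left
      change _ '' ({0}ᶜ : Set (Fin 3)) = _
      rw [h0, Set.image_pair]; rfl
    · right; left
      change _ '' ({1}ᶜ : Set (Fin 3)) = _
      rw [h1, Set.image_pair]; rfl
    · right; right
      change _ '' ({2}ᶜ : Set (Fin 3)) = _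
      rw [h2, Set.image_pair]; rfl
  have hBspan : ∀ p ∈ F, ∀ q ∈ F, ∀ r ∈ F, p ≠ q → p ≠ r → q ≠ r → ∀ w ∈ equiangular c F,
      u w ∈ Submodule.span ℂ {u p, u q, u r} := by
    intro p hp q hq r hr hpq hpr hqr w hw
    obtain ⟨x, hx, hxn⟩ := hF.infinite.exists_notMem_finite (Set.toFinite {p, q, r})
    obtain ⟨x', hx', hxn'⟩ := hF.infinite.exists_notMem_finite (Set.toFinite {p, q, r, x})
    simp only [Set.mem_singleton_iff, Set.mem_insert_iff, not_or] at hxn hxn'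
    have hli : LinearIndependent ℂ ![u p, u q, u r] := by
      by_contra h
      exact hnc p hp q hq r hr hpq hpr hqr
        (mem_span_of_not_linearIndependent (hu p) (hu q) (hne _ _ hpq) h)
    have hspan : ∀ y ∈ F, y ≠ p → y ≠ q → y ≠ r → ∀ k,
        u y ∉ Submodule.span ℂ (![u p, u q, u r] '' {k}ᶜ) := by
      intro y hy hyp hyq hyr k
      rcases himg (u p) (u q) (u r) k with h | h | h <;> rw [h]
      exacts [hnc q hq r hr y hy hqr hyq.symm hyr.symm, hnc p hp r hr y hy hpr hyp.symm hyr.symm,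
        hnc p hp q hq y hy hpq hyp.symm hyq.symm]
    have := mem_span_range_of_forall_norm_inner_eq hc hli (hu w) (fun j => by
      fin_cases j
      exacts [(hov p w).symm.trans (hw p hp), (hov q w).symm.trans (hw q hq),
        (hov r w).symm.trans (hw r hr)]) (hu x) (hu x') (hne _ _ (Ne.symm hxn'.2.2.2))
      (hspan x hx hxn.1 hxn.2.1 hxn.2.2) (hspan x' hx' hxn'.1 hxn'.2.1 hxn'.2.2.1)
      (fun v hv hvp => by
        have hvF := hF.mem_equiangular p hp q hq r hr hpq hpr hqr (ray v)
          (by rw [← hru p, overlap_ray (hu p) hv]; exact hvp 0)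
          (by rw [← hru q, overlap_ray (hu q) hv]; exact hvp 1)
          (by rw [← hru r, overlap_ray (hu r) hv]; exact hvp 2)
        have h1 := hvF x hx
        have h2 := hvF x' hx'
        rw [← hru x, overlap_ray (hu x) hv] at h1
        rw [← hru x', overlap_ray (hu x') hv] at h2
        exact ⟨h1, h2⟩)
    rwa [Matrix.range_cons, Matrix.range_cons, Matrix.range_cons, Matrix.range_empty,
      Set.union_empty, Set.singleton_union, Set.singleton_union] at this
  obtain ⟨p₁, hp₁, p₂, hp₂, p₃, hp₃, h12, h13, h23⟩ := hF.infinite.exists_three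
  by_cases hB : ∃ b ∈ equiangular c F, u b ∉ Submodule.span ℂ {u p₁, u p₂}
  · obtain ⟨b₀, hb₀, hb₀n⟩ := hB
    -- Since b₀ is off the line p₁p₂ but in the span of p₁, p₂ and x, the relation can be solved for
    -- x.
    have hFE : ∀ x ∈ F, u x ∈ Submodule.span ℂ {u p₁, u p₂, u p₃} := by
      intro x hx
      by_cases hx1 : p₁ = x
      · rw [← hx1]; exact Submodule.subset_span (by simp)
      by_cases hx2 : p₂ = x
      · rw [← hx2]; exact Submodule.subset_span (by simp)
      obtain ⟨α, β, γ, he⟩ := Submodule.mem_span_triple.mp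
        (hBspan p₁ hp₁ p₂ hp₂ x hx h12 hx1 hx2 b₀ hb₀)
      have hγ : γ ≠ 0 := by
        rintro rfl
        exact hb₀n (Submodule.mem_span_pair.mpr ⟨α, β, by rw [← he]; module⟩)
      rw [← Submodule.smul_mem_iff _ hγ, show γ • u x = u b₀ - α • u p₁ - β • u p₂ by
        rw [← he]; abel]
      exact Submodule.sub_mem _ (Submodule.sub_mem _
        (hBspan p₁ hp₁ p₂ hp₂ p₃ hp₃ h12 h13 h23 b₀ hb₀)
        (Submodule.smul_mem _ _ (Submodule.subset_span (by simp))))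
        (Submodule.smul_mem _ _ (Submodule.subset_span (by simp)))
    obtain ⟨s, hs, hsn⟩ := hF.infinite.exists_notMem_finite (Set.toFinite {p₁, p₂, p₃})
    obtain ⟨s', hs', hsn'⟩ := hF.infinite.exists_notMem_finite (Set.toFinite {p₁, p₂, p₃, s})
    simp only [Set.mem_singleton_iff, Set.mem_insert_iff, not_or] at hsn hsn'
    obtain ⟨hs1, hs2, hs3⟩ := hsn
    obtain ⟨hs1', hs2', hs3', hss'⟩ := hsn'
    have hfin := finite_setOf_inner_ratio hc (hFE s hs) (hFE s' hs')
      (hnc p₁ hp₁ p₂ hp₂ s hs h12 (Ne.symm hs1) (Ne.symm hs2))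
      (hnc p₁ hp₁ p₃ hp₃ s hs h13 (Ne.symm hs1) (Ne.symm hs3))
      (hnc p₂ hp₂ p₃ hp₃ s hs h23 (Ne.symm hs2) (Ne.symm hs3))
      (hnc p₁ hp₁ p₃ hp₃ s' hs' h13 (Ne.symm hs1') (Ne.symm hs3'))
      (hnc p₂ hp₂ p₃ hp₃ s' hs' h23 (Ne.symm hs2') (Ne.symm hs3'))
      (hnc s hs p₁ hp₁ s' hs' hs1 (Ne.symm hss') (Ne.symm hs1'))
      (hnc s hs p₂ hp₂ s' hs' hs2 (Ne.symm hss') (Ne.symm hs2'))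
    have hinn : ∀ p ∈ F, ∀ b ∈ equiangular c F, ‖inner ℂ (u p) (u b)‖ = c := fun p hp b hb =>
      (hov p b).symm.trans (hb p hp)
    have hinn0 : ∀ p ∈ F, ∀ b ∈ equiangular c F, inner ℂ (u p) (u b) ≠ 0 := by
      intro p hp b hb h0
      have := hinn p hp b hb
      rw [h0, norm_zero] at this
      exact hc.ne this
    set f : ℙ ℂ H → ℂ := fun b => inner ℂ (u p₂) (u b) / inner ℂ (u p₁) (u b) with hf
    have hfa : ∀ b ∈ equiangular c F, inner ℂ (u p₂) (u b) = f b * inner ℂ (u p₁) (u b) :=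
      fun b hb => by rw [hf, div_mul_cancel₀ _ (hinn0 p₁ hp₁ b hb)]
    -- Finitely many phase ratios and infinitely many equiangular points: some ratio a occurs
    -- infinitely often. Its points are orthogonal to p₂ - star a • p₁ inside a 3-space, hence
    -- collinear.
    obtain ⟨a, ha⟩ : ∃ a, (equiangular c F ∩ f ⁻¹' {a}).Infinite := by
      by_contra! hcon'
      refine hF.infinite_equiangular (Set.Finite.of_finite_fibers f (hfin.subset ?_)
        fun a _ => hcon' a)
      rintro _ ⟨b, hb, rfl⟩
      exact ⟨u b, hinn _ hp₁ b hb, hinn _ hp₂ b hb, hinn _ hp₃ b hb, hinn _ hs b hb,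
        hinn _ hs' b hb, hfa b hb⟩
    obtain ⟨b₁, ⟨hb₁, ha₁⟩, b₂, ⟨hb₂, ha₂⟩, b₃, ⟨hb₃, ha₃⟩, hb12, hb13, hb23⟩ := ha.exists_three
    have hv0 : u p₂ - star a • u p₁ ≠ 0 := by
      intro h0
      exact hne _ _ h12 ((ray_eq_ray_iff (ne_zero_of_norm_one (hu p₂))
        (ne_zero_of_norm_one (hu p₁))).mpr ⟨_, (sub_eq_zero.mp h0).symm⟩).symm
    have hvE : u p₂ - star a • u p₁ ∈ Submodule.span ℂ {u p₁, u p₂, u p₃} :=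
      Submodule.sub_mem _ (Submodule.subset_span (by simp))
        (Submodule.smul_mem _ _ (Submodule.subset_span (by simp)))
    have hv : ∀ b ∈ equiangular c F, f b = a → inner ℂ (u p₂ - star a • u p₁) (u b) = 0 := by
      intro b hb hfb
      rw [inner_sub_left, inner_smul_left, hfa b hb, hfb, Complex.star_def, Complex.conj_conj,
        sub_self]
    have hBE : ∀ b ∈ equiangular c F, u b ∈ Submodule.span ℂ {u p₁, u p₂, u p₃} :=
      hBspan p₁ hp₁ p₂ hp₂ p₃ hp₃ h12 h13 h23
    have hb3 := mem_span_of_not_linearIndependent (hu b₁) (hu b₂) (hne _ _ hb12)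
      (not_linearIndependent_of_inner_eq_zero hvE hv0 (hBE _ hb₁) (hBE _ hb₂) (hBE _ hb₃)
        (hv _ hb₁ ha₁) (hv _ hb₂ ha₂) (hv _ hb₃ ha₃))
    have hinn' : ∀ p ∈ F, ∀ b ∈ equiangular c F, ‖inner ℂ (u b) (u p)‖ = c := fun p hp b hb => by
      rw [norm_inner_symm, hinn p hp b hb]
    obtain ⟨e₁, e₂, he₁, he₂, -, hspan, -, -, hpole⟩ := exists_poles hc (hu b₁) (hu b₂) (hu b₃)
      (hne _ _ hb12) (hne _ _ hb13) (hne _ _ hb23) hb3 (hinn' _ hp₁ _ hb₁) (hinn' _ hp₁ _ hb₂)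
      (hinn' _ hp₁ _ hb₃)
    have hle : Submodule.span ℂ {u b₁, u b₂} ≤ Submodule.span ℂ {u p₁, u p₂, u p₃} := by
      rw [Submodule.span_le]
      rintro w (rfl | rfl)
      exacts [hBE _ hb₁, hBE _ hb₂]
    -- Three points of F orthogonal to e would be dependent within the 3-space, hence collinear. By
    -- the pole property of b₁, b₂, b₃, F is covered by two such finite sets.
    have hfinal : ∀ e : H, ‖e‖ = 1 → e ∈ Submodule.span ℂ {u b₁, u b₂} →
        {x ∈ F | inner ℂ e (u x) = 0}.Finite := by
      intro e he hem
      by_contra hinf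
      obtain ⟨x, ⟨hx, hex⟩, y, ⟨hy, hey⟩, z, ⟨hz, hez⟩, hxy, hxz, hyz⟩ :=
        Set.Infinite.exists_three hinf
      exact hnc x hx y hy z hz hxy hxz hyz (mem_span_of_not_linearIndependent (hu x) (hu y)
        (hne _ _ hxy) (not_linearIndependent_of_inner_eq_zero (hle hem) (ne_zero_of_norm_one he)
          (hFE x hx) (hFE y hy) (hFE z hz) hex hey hez))
    refine hF.infinite (((hfinal e₁ he₁ ?_).union (hfinal e₂ he₂ ?_)).subset ?_)
    · rw [← hspan]; exact Submodule.subset_span (by simp)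
    · rw [← hspan]; exact Submodule.subset_span (by simp)
    · intro x hx
      rcases hpole (u x) (hinn' _ hx _ hb₁) (hinn' _ hx _ hb₂) (hinn' _ hx _ hb₃) with h | h
      exacts [Or.inl ⟨hx, h⟩, Or.inr ⟨hx, h⟩]
  · push Not at hB
    obtain ⟨x, hx, y, hy, hxy⟩ := exists_decomposition (Submodule.span ℂ {u p₁, u p₂}) (u p₃)
    have hy0 : y ≠ 0 := by
      rintro rfl
      rw [add_zero] at hxy
      exact hnc p₁ hp₁ p₂ hp₂ p₃ hp₃ h12 h13 h23 (hxy ▸ hx)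
    obtain ⟨b, hb⟩ := hF.infinite_equiangular.nonempty
    -- Equiangular points lie in the line p₁p₂ and do not see y, so the component y of p₃ can be
    -- multiplied by any scalar.
    have hinner : ∀ (z : ℂ), ∀ b ∈ equiangular c F, ‖inner ℂ (x + z • y) (u b)‖ = c := by
      intro z b hb
      have h1 := (hov p₃ b).symm.trans (hb p₃ hp₃)
      rw [hxy, inner_add_left, (Submodule.mem_orthogonal' _ _).mp hy _ (hB b hb), add_zero] at h1
      rw [inner_add_left, inner_smul_left, (Submodule.mem_orthogonal' _ _).mp hy _ (hB b hb),
        mul_zero, add_zero, h1]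
    have hx0 : x ≠ 0 := by
      rintro rfl
      have := hinner 0 b hb
      rw [zero_smul, add_zero, inner_zero_left, norm_zero] at this
      exact hc.ne this
    have hunit : ∀ z : ℂ, ‖z‖ = 1 → ‖x + z • y‖ = 1 := by
      intro z hz
      have h1 := norm_sq_add_of_mem_orthogonal hx (Submodule.smul_mem _ z hy)
      have h2 := norm_sq_add_of_mem_orthogonal hx hy
      rw [← hxy, hu] at h2
      rw [norm_smul, hz, one_mul, ← h2] at h1
      exact (pow_left_inj₀ (norm_nonneg _) zero_le_one two_ne_zero).mp h1
    have hinj : Set.InjOn (fun z : ℂ => ray (x + z • y)) {z | ‖z‖ = 1} := by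
      intro z hz z' hz' h
      obtain ⟨t, ht⟩ := (ray_eq_ray_iff (ne_zero_of_norm_one (hunit z hz))
        (ne_zero_of_norm_one (hunit z' hz'))).mp h
      have h3 : ∀ v : H, inner ℂ v (t • (x + z' • y)) = inner ℂ v (x + z • y) := fun v => by rw [ht]
      have hxy0 := (Submodule.mem_orthogonal _ _).mp hy x hx
      have e1 := h3 x
      have e2 := h3 y
      simp only [inner_smul_right, inner_add_right, hxy0, inner_eq_zero_comm' hxy0, mul_zero,
        add_zero, zero_add] at e1 e2
      have ht1 : t = 1 := mul_right_cancel₀ (inner_self_ne_zero.mpr hx0) (e1.trans (one_mul _).symm)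
      rw [ht1, one_mul] at e2
      exact (mul_right_cancel₀ (inner_self_ne_zero.mpr hy0) e2).symm
    -- The points x + z • y lie in the double equiangular set, so all but finitely many belong to F,
    -- and they are collinear.
    have hinf : ({z : ℂ | ‖z‖ = 1} \ {z : ℂ | ‖z‖ = 1 ∧ ray (x + z • y) ∈
        equiangular c (equiangular c F) \ F}).Infinite := by
      refine infinite_unimodular.sdiff (Set.Finite.of_finite_image (f := fun z : ℂ => ray (x + z • y))
        (hF.finite_diff.subset ?_) (hinj.mono fun z hz => hz.1))
      rintro _ ⟨z, hz, rfl⟩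
      exact hz.2
    have hmem : ∀ z : ℂ, ‖z‖ = 1 → ¬ (‖z‖ = 1 ∧ ray (x + z • y) ∈
        equiangular c (equiangular c F) \ F) → ray (x + z • y) ∈ F := by
      intro z hz hn
      by_contra hnF
      refine hn ⟨hz, fun b hb => ?_, hnF⟩
      rw [← hru b, overlap_ray (hu b) (hunit z hz), norm_inner_symm, hinner z b hb]
    obtain ⟨z₁, ⟨hz₁, hn₁⟩, z₂, ⟨hz₂, hn₂⟩, z₃, ⟨hz₃, hn₃⟩, g12, g13, g23⟩ := hinf.exists_three
    refine hcon _ (hmem _ hz₁ hn₁) _ (hmem _ hz₂ hn₂) _ (hmem _ hz₃ hn₃)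
      (fun h => g12 (hinj hz₁ hz₂ h)) (fun h => g13 (hinj hz₁ hz₃ h))
      (fun h => g23 (hinj hz₂ hz₃ h)) ?_
    rw [onLine_ray_iff (ne_zero_of_norm_one (hunit _ hz₁)) (ne_zero_of_norm_one (hunit _ hz₂))
      (ne_zero_of_norm_one (hunit _ hz₃))]
    have hm : ∀ z : ℂ, x + z • y ∈ Submodule.span ℂ {x, y} := fun z =>
      Submodule.mem_span_pair.mpr ⟨1, z, by rw [one_smul]⟩
    exact mem_span_pair_of_mem (hunit _ hz₁) (hunit _ hz₂) (fun h => g12 (hinj hz₁ hz₂ h))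
      (hm _) (hm _) (hm _)

end CircleLike

/-! ### Circle-like sets lie on a projective line -/

section CircleLikeOnLine

set_option linter.unusedSectionVars false

variable {H : Type*} [NormedAddCommGroup H] [InnerProductSpace ℂ H] [Nontrivial H]

/-- A parametrization of a circle of latitude with poles `e₁` and `e₂`. -/
noncomputable def latitude (k τ : ℝ) (e₁ e₂ : H) (z : ℂ) : H := (k : ℂ) • e₁ + (τ * z) • e₂

theorem latitude_mem_span (k τ : ℝ) (e₁ e₂ : H) (z : ℂ) :
    latitude k τ e₁ e₂ z ∈ Submodule.span ℂ {e₁, e₂} :=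
  Submodule.mem_span_pair.mpr ⟨_, _, rfl⟩

theorem norm_latitude {k τ : ℝ} (hkτ : k ^ 2 + τ ^ 2 = 1) {e₁ e₂ : H} (he₁ : ‖e₁‖ = 1)
    (he₂ : ‖e₂‖ = 1) (he : inner ℂ e₁ e₂ = 0) {z : ℂ} (hz : ‖z‖ = 1) :
    ‖latitude k τ e₁ e₂ z‖ = 1 := by
  have := norm_sq_smul_add_smul he₁ he₂ he (k : ℂ) (τ * z)
  rw [norm_mul, hz, Complex.norm_real, Complex.norm_real, Real.norm_eq_abs, Real.norm_eq_abs,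
    mul_one, sq_abs, sq_abs, hkτ] at this
  exact (pow_left_inj₀ (norm_nonneg _) zero_le_one two_ne_zero).mp (by rw [latitude, this, one_pow])

theorem inner_latitude_left (k τ : ℝ) (e₁ e₂ : H) (z : ℂ) (v : H) :
    inner ℂ (latitude k τ e₁ e₂ z) v = k * inner ℂ e₁ v + τ * star z * inner ℂ e₂ v := by
  simp only [latitude, inner_add_left, inner_smul_left, map_mul, Complex.conj_ofReal]
  rfl

theorem inner_latitude_right (k τ : ℝ) (e₁ e₂ : H) (z : ℂ) (v : H) :
    inner ℂ v (latitude k τ e₁ e₂ z) = k * inner ℂ v e₁ + τ * z * inner ℂ v e₂ := by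
  simp only [latitude, inner_add_right, inner_smul_right]

theorem injOn_ray_latitude {k τ : ℝ} (hk : k ≠ 0) (hτ : τ ≠ 0) (hkτ : k ^ 2 + τ ^ 2 = 1)
    {e₁ e₂ : H} (he₁ : ‖e₁‖ = 1) (he₂ : ‖e₂‖ = 1) (he : inner ℂ e₁ e₂ = 0) :
    Set.InjOn (fun z : ℂ => ray (latitude k τ e₁ e₂ z)) {z | ‖z‖ = 1} := by
  intro z hz z' hz' heq
  obtain ⟨a, ha⟩ := (ray_eq_ray_iff (ne_zero_of_norm_one (norm_latitude hkτ he₁ he₂ he hz))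
    (ne_zero_of_norm_one (norm_latitude hkτ he₁ he₂ he hz'))).mp heq
  have f1 : inner ℂ e₁ (a • latitude k τ e₁ e₂ z') = inner ℂ e₁ (latitude k τ e₁ e₂ z) := by rw [ha]
  have f2 : inner ℂ e₂ (a • latitude k τ e₁ e₂ z') = inner ℂ e₂ (latitude k τ e₁ e₂ z) := by rw [ha]
  simp only [inner_smul_right, inner_latitude_right, he, inner_eq_zero_comm' he,
    inner_self_of_norm_one he₁, inner_self_of_norm_one he₂, mul_zero, mul_one, add_zero,
    zero_add] at f1 f2
  have ha1 : a = 1 := mul_right_cancel₀ (show (k : ℂ) ≠ 0 by exact_mod_cast hk)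
    (by rw [f1, one_mul])
  rw [ha1, one_mul] at f2
  exact (mul_left_cancel₀ (show (τ : ℂ) ≠ 0 by exact_mod_cast hτ) f2).symm

/-- Moving a point equiangular to a circle of latitude so that it remains equiangular to exactly
two points of the circle and to a further point `x`. -/
theorem exists_equiangular_perturbation {c k τ r ρ : ℝ} (hc : 0 < c) (hk0 : 0 < k) (hτ0 : 0 < τ)
    (hr0 : 0 < r) (hρ0 : 0 < ρ) (hkτ : k ^ 2 + τ ^ 2 = 1) (hrρ : r ^ 2 + ρ ^ 2 = 1)
    (hkr : k * r = c) {e₁ e₂ e₃ x : H} (he₁ : ‖e₁‖ = 1) (he₂ : ‖e₂‖ = 1) (he₃ : ‖e₃‖ = 1)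
    (h12 : inner ℂ e₁ e₂ = 0) (h13 : inner ℂ e₁ e₃ = 0) (h23 : inner ℂ e₂ e₃ = 0)
    (hx : ‖x‖ = 1) (hx₁ : inner ℂ x e₁ = 0) (hx₃ : ρ * ‖inner ℂ x e₃‖ = c)
    {bad : Set ℂ} (hbad : bad.Finite) :
    ∃ z₁ z₂ w, ‖z₁‖ = 1 ∧ ‖z₂‖ = 1 ∧ z₁ ≠ z₂ ∧ z₁ ∉ bad ∧ z₂ ∉ bad ∧ ‖w‖ = 1 ∧
      ‖inner ℂ (latitude k τ e₁ e₂ z₁) w‖ = c ∧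
      ‖inner ℂ (latitude k τ e₁ e₂ z₂) w‖ = c ∧ ‖inner ℂ x w‖ = c ∧
      inner ℂ e₁ w ≠ 0 ∧ inner ℂ e₂ w ≠ 0 := by
  have hr1 : r < 1 := by nlinarith
  have hk1 : k < 1 := by nlinarith
  have hc1 : c < 1 := by nlinarith
  have hkτ2 : k * τ ≤ 1 / 2 := by linarith [sq_nonneg (k - τ), sub_sq k τ]
  have hcr : c < r := by nlinarith
  -- The e₂-component of the new vector w: nonzero, but below c and below k · τ · R, as the
  -- equations for η and for ζ₁, ζ₂ require.
  obtain ⟨ε, hε⟩ : ∃ ε, ε = k * τ * c / 2 := ⟨_, rfl⟩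
  have hkτ0 : 0 < k * τ := by positivity
  have hε0 : 0 < ε := by rw [hε]; positivity
  have hεr : ε < r / 2 := by
    have : k * τ * c ≤ 1 / 2 * c := mul_le_mul_of_nonneg_right hkτ2 hc.le
    linarith
  have hεc : ε < c := by
    have : k * τ * c ≤ 1 / 2 * c := mul_le_mul_of_nonneg_right hkτ2 hc.le
    linarith
  have hεr2 : ε ^ 2 < (r / 2) ^ 2 := pow_lt_pow_left₀ hεr hε0.le two_ne_zero
  obtain ⟨R, hR⟩ : ∃ R, R = Real.sqrt (r ^ 2 - ε ^ 2) := ⟨_, rfl⟩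
  have hR2 : R ^ 2 = r ^ 2 - ε ^ 2 := by
    rw [hR]
    exact Real.sq_sqrt (by linarith [div_pow r 2 2, sq_nonneg r])
  have hRr : r / 2 < R := by
    rw [hR]
    exact Real.lt_sqrt_of_sq_lt (by linarith [div_pow r 2 2, sq_nonneg r])
  have hR0 : 0 < R := by linarith
  have hεR : ε < k * τ * R := by
    have h1 : k * τ * (r / 2) < k * τ * R := mul_lt_mul_of_pos_left hRr hkτ0
    have h2 : k * τ * c < k * τ * r := mul_lt_mul_of_pos_left hcr hkτ0
    linarith
  have hτ2 : 0 ≤ τ ^ 2 * ε ^ 2 := by positivity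
  have hk2 : 0 ≤ k ^ 2 * ε ^ 2 := by positivity
  have hεε : ε ^ 2 < τ * ε * (k * R) := by
    have := mul_lt_mul_of_pos_left hεR hε0
    linarith
  have hkτε : k ^ 2 * ε ^ 2 + τ ^ 2 * ε ^ 2 = ε ^ 2 := by rw [← add_mul, hkτ, one_mul]
  -- The prescribed real part is |k · R + τ · ε · ζ|² = c², rewritten with R² = r² - ε² and k · r =
  -- c.
  obtain ⟨ζ₁, ζ₂, hζ₁, hζ₂, hζ, hζe₁, hζe₂⟩ := exists_two_unimodular_re_mul_eq
    (μ := ((τ * ε * (k * R) : ℝ) : ℂ)) (t := (k ^ 2 - τ ^ 2) * ε ^ 2 / 2) (by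
      rw [Complex.norm_real, Real.norm_of_nonneg (by positivity), abs_lt]
      constructor <;> linarith)
  -- A common phase shift moves both points of the circle off the finite bad set.
  obtain ⟨ψ, hψ, hψ₁, hψ₂⟩ : ∃ ψ : ℂ, ‖ψ‖ = 1 ∧ ψ * star ζ₁ ∉ bad ∧ ψ * star ζ₂ ∉ bad := by
    have hpre : ∀ ζ : ℂ, ‖ζ‖ = 1 → {ψ : ℂ | ψ * star ζ ∈ bad}.Finite := by
      intro ζ hζn
      have hζ0 : star ζ ≠ 0 := star_ne_zero.mpr (by rintro rfl; simp at hζn)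
      exact hbad.preimage (mul_left_injective₀ hζ0).injOn
    obtain ⟨ψ, hψ, hn⟩ := infinite_unimodular.exists_notMem_finite
      ((hpre ζ₁ hζ₁).union (hpre ζ₂ hζ₂))
    exact ⟨ψ, hψ, fun h0 => hn (Or.inl h0), fun h0 => hn (Or.inr h0)⟩
  obtain ⟨a, ha⟩ : ∃ a, a = inner ℂ x e₂ * (ψ * ε) := ⟨_, rfl⟩
  obtain ⟨d, hd⟩ : ∃ d, d = inner ℂ x e₃ * ρ := ⟨_, rfl⟩
  have hdc : ‖d‖ = c := by
    rw [hd, norm_mul, Complex.norm_real, Real.norm_of_nonneg hρ0.le, mul_comm, hx₃]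
  -- The phase of the e₃-component repairs the overlap with x: the e₂-term a has modulus at most ε <
  -- c, while |d| = c.
  obtain ⟨η, hη, hηa⟩ : ∃ η : ℂ, ‖η‖ = 1 ∧ ‖a + η * d‖ = c := by
    by_cases ha0 : a = 0
    · refine ⟨1, norm_one, ?_⟩
      rw [ha0, zero_add, one_mul, hdc]
    · have ha0' := norm_pos_iff.mpr ha0
      have han : ‖a‖ ≤ ε := by
        rw [ha, norm_mul, norm_mul, hψ, one_mul, Complex.norm_real, Real.norm_of_nonneg hε0.le]
        have := norm_inner_le_norm (𝕜 := ℂ) x e₂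
        rw [he₂, hx, mul_one] at this
        exact mul_le_of_le_one_left hε0.le this
      have hac : ‖a‖ * ‖a‖ < c * ‖a‖ := mul_lt_mul_of_pos_right (han.trans_lt hεc) ha0'
      obtain ⟨η, -, hη, -, -, hηe, -⟩ := exists_two_unimodular_re_mul_eq
        (μ := d * star a) (t := -‖a‖ ^ 2 / 2) (by
          rw [norm_mul, norm_star, hdc, abs_lt]
          constructor <;> nlinarith)
      refine ⟨η, hη, ?_⟩
      have h1 := norm_add_mul_sq a d η hη
      rw [hηe, hdc] at h1
      exact (pow_left_inj₀ (norm_nonneg _) hc.le two_ne_zero).mp (by linarith)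
  have hψ0 : ψ ≠ 0 := by rintro rfl; simp at hψ
  obtain ⟨w, hw⟩ : ∃ w, w = ((R : ℂ) • e₁ + (ψ * ε) • e₂) + (η * ρ) • e₃ := ⟨_, rfl⟩
  have hw₁ : inner ℂ e₁ w = R := by
    rw [hw, inner_add_right, inner_add_right, inner_smul_right, inner_smul_right, inner_smul_right,
      h12, h13, inner_self_of_norm_one he₁]
    ring
  have hw₂ : inner ℂ e₂ w = ψ * ε := by
    rw [hw, inner_add_right, inner_add_right, inner_smul_right, inner_smul_right, inner_smul_right,
      inner_eq_zero_comm' h12, h23, inner_self_of_norm_one he₂]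
    ring
  have hwn : ‖w‖ = 1 := by
    have h1 := norm_add_sq_eq_norm_sq_add_norm_sq_of_inner_eq_zero (𝕜 := ℂ)
      ((R : ℂ) • e₁ + (ψ * ε) • e₂) ((η * ρ) • e₃) (by
        rw [inner_smul_right, inner_add_left, inner_smul_left, inner_smul_left, h13, h23]
        ring)
    have h2 := norm_sq_smul_add_smul he₁ he₂ h12 (R : ℂ) (ψ * ε)
    rw [← hw, norm_smul (η * (ρ : ℂ)), norm_mul η, hη, he₃, Complex.norm_real,
      Real.norm_of_nonneg hρ0.le] at h1
    rw [norm_mul, hψ, Complex.norm_real, Complex.norm_real, Real.norm_of_nonneg hR0.le,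
      Real.norm_of_nonneg hε0.le] at h2
    refine (pow_left_inj₀ (norm_nonneg _) zero_le_one two_ne_zero).mp ?_
    linarith
  have hwS : ∀ ζ : ℂ, ‖ζ‖ = 1 →
      (ζ * ((τ * ε * (k * R) : ℝ) : ℂ)).re = (k ^ 2 - τ ^ 2) * ε ^ 2 / 2 →
      ‖inner ℂ (latitude k τ e₁ e₂ (ψ * star ζ)) w‖ = c := by
    intro ζ hζn hζe
    have hψψ : star ψ * ψ = 1 := by
      rw [Complex.star_def, Complex.conj_mul', hψ]
      norm_num
    have e : inner ℂ (latitude k τ e₁ e₂ (ψ * star ζ)) w =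
        ((k * R : ℝ) : ℂ) + ζ * ((τ * ε : ℝ) : ℂ) := by
      rw [inner_latitude_left, hw₁, hw₂, star_mul, star_star]
      push_cast
      linear_combination (τ * ε * ζ : ℂ) * hψψ
    have h1 := norm_add_mul_sq ((k * R : ℝ) : ℂ) ((τ * ε : ℝ) : ℂ) ζ hζn
    have e2 : ((τ * ε : ℝ) : ℂ) * star ((k * R : ℝ) : ℂ) = ((τ * ε * (k * R) : ℝ) : ℂ) := by
      rw [Complex.star_def, Complex.conj_ofReal]
      push_cast
      ring
    rw [e2, hζe, Complex.norm_real, Complex.norm_real, Real.norm_of_nonneg (by positivity),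
      Real.norm_of_nonneg (by positivity)] at h1
    rw [e]
    refine (pow_left_inj₀ (norm_nonneg _) hc.le two_ne_zero).mp ?_
    rw [h1, ← hkr]
    linear_combination k ^ 2 * hR2
  have hwx : inner ℂ x w = a + η * d := by
    rw [hw, inner_add_right, inner_add_right, inner_smul_right, inner_smul_right, inner_smul_right,
      hx₁, ha, hd]
    ring
  refine ⟨ψ * star ζ₁, ψ * star ζ₂, w, by rw [norm_mul, norm_star, hψ, hζ₁, one_mul],
    by rw [norm_mul, norm_star, hψ, hζ₂, one_mul],
    fun h0 => hζ (star_injective (mul_left_cancel₀ hψ0 h0)), hψ₁, hψ₂, hwn, hwS _ hζ₁ hζe₁,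
    hwS _ hζ₂ hζe₂, by rw [hwx, hηa], ?_, ?_⟩
  · rw [hw₁]
    exact_mod_cast hR0.ne'
  · rw [hw₂]
    exact mul_ne_zero hψ0 (by exact_mod_cast hε0.ne')

/-- A point x off the line would let an equiangular vector be perturbed while keeping overlap c with
x and with two points of F on the circle of latitude. The perturbed vector is equiangular to F by
the three-point property, yet orthogonal to neither pole. -/
theorem onLine_of_three_onLine {c : ℝ} (hc : 0 < c) {F : Set (ℙ ℂ H)} (hF : CircleLike c F)
    {p₁ p₂ p₃ x : ℙ ℂ H} (hp₁ : p₁ ∈ F) (hp₂ : p₂ ∈ F) (hp₃ : p₃ ∈ F) (h12 : p₁ ≠ p₂)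
    (h13 : p₁ ≠ p₃) (h23 : p₂ ≠ p₃) (h : OnLine p₁ p₂ p₃) (hx : x ∈ F) : OnLine p₁ p₂ x := by
  choose u hu hru using exists_ray (H := H)
  have hov : ∀ p q, overlap p q = ‖inner ℂ (u p) (u q)‖ := fun p q => by
    conv_lhs => rw [← hru p, ← hru q, overlap_ray (hu p) (hu q)]
  have hne : ∀ p q, p ≠ q → ray (u p) ≠ ray (u q) := fun p q h => by rwa [hru, hru]
  have hline : ∀ p q r, OnLine p q r ↔ u r ∈ Submodule.span ℂ {u p, u q} := fun p q r => by
    rw [← onLine_ray_iff (ne_zero_of_norm_one (hu p)) (ne_zero_of_norm_one (hu q))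
      (ne_zero_of_norm_one (hu r)), hru, hru, hru]
  have hinn : ∀ p ∈ F, ∀ b ∈ equiangular c F, ‖inner ℂ (u p) (u b)‖ = c := fun p hp b hb =>
    (hov p b).symm.trans (hb p hp)
  rw [hline] at h ⊢
  by_contra hX
  -- Equiangular points are orthogonal to a pole, and within the line only the two poles are; an
  -- infinite set must leave the line.
  obtain ⟨w, hw, hwL⟩ : ∃ w ∈ equiangular c F, u w ∉ Submodule.span ℂ {u p₁, u p₂} := by
    by_contra! hB
    obtain ⟨b, hb⟩ := hF.infinite_equiangular.nonempty
    obtain ⟨e₁, e₂, he₁, he₂, he, hspan, -, -, hpole⟩ := exists_poles hc (hu p₁) (hu p₂) (hu p₃)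
      (hne _ _ h12) (hne _ _ h13) (hne _ _ h23) h (hinn _ hp₁ _ hb) (hinn _ hp₂ _ hb)
      (hinn _ hp₃ _ hb)
    refine hF.infinite_equiangular ((Set.toFinite {ray e₁, ray e₂}).subset fun w hw => ?_)
    have hd := eq_of_mem_span_orthonormal he₁ he₂ he (hspan ▸ hB w hw)
    rcases hpole (u w) (hinn _ hp₁ _ hw) (hinn _ hp₂ _ hw) (hinn _ hp₃ _ hw) with h0 | h0
    · right
      rw [h0, zero_smul, zero_add] at hd
      rw [Set.mem_singleton_iff, ← hru w]
      exact (ray_eq_ray_iff (ne_zero_of_norm_one (hu w)) (ne_zero_of_norm_one he₂)).mpr ⟨_, hd.symm⟩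
    · left
      rw [h0, zero_smul, add_zero] at hd
      rw [← hru w]
      exact (ray_eq_ray_iff (ne_zero_of_norm_one (hu w)) (ne_zero_of_norm_one he₁)).mpr ⟨_, hd.symm⟩
  obtain ⟨e₁, e₂, he₁, he₂, he, hspan, hew, ⟨k, hk0, hk₁, hk₂, hk₃⟩, hpole⟩ :=
    exists_poles hc (hu p₁) (hu p₂) (hu p₃) (hne _ _ h12) (hne _ _ h13) (hne _ _ h23) h
      (hinn _ hp₁ _ hw) (hinn _ hp₂ _ hw) (hinn _ hp₃ _ hw)
  set L := Submodule.span ℂ {u p₁, u p₂} with hL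
  have m₁ : u p₁ ∈ L := Submodule.subset_span (by simp)
  have m₂ : u p₂ ∈ L := Submodule.subset_span (by simp)
  have me₁ : e₁ ∈ L := by rw [← hspan]; exact Submodule.subset_span (by simp)
  have me₂ : e₂ ∈ L := by rw [← hspan]; exact Submodule.subset_span (by simp)
  obtain ⟨w₁, hw₁, w₂, hw₂, hww⟩ := exists_decomposition L (u w)
  obtain ⟨x₁, hx₁, x₂, hx₂, hxx⟩ := exists_decomposition L (u x)
  have hx₂0 : x₂ ≠ 0 := by
    rintro rfl
    rw [add_zero] at hxx
    exact hX (hxx ▸ hx₁)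
  have hw₂0 : w₂ ≠ 0 := by
    rintro rfl
    rw [add_zero] at hww
    exact hwL (hww ▸ hw₁)
  have horth : ∀ v ∈ L, ∀ a y : H, y ∈ Lᗮ → inner ℂ v (a + y) = inner ℂ v a := by
    intro v hv a y hy
    rw [inner_add_right, (Submodule.mem_orthogonal _ _).mp hy v hv, add_zero]
  have hw₁e : w₁ = inner ℂ e₁ w₁ • e₁ := by
    have h1 := eq_of_mem_span_orthonormal he₁ he₂ he (hspan ▸ hw₁)
    rw [hww, horth e₂ me₂ _ _ hw₂] at hew
    rwa [hew, zero_smul, add_zero] at h1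
  set ω := inner ℂ e₁ w₁ with hω
  set r := ‖ω‖ with hr
  set ρ := ‖w₂‖ with hρ
  have hρ0 : 0 < ρ := norm_pos_iff.mpr hw₂0
  have hw₁n : ‖w₁‖ = r := by rw [hw₁e, norm_smul, he₁, mul_one]
  have hrρ : r ^ 2 + ρ ^ 2 = 1 := by
    have := norm_sq_add_of_mem_orthogonal hw₁ hw₂
    rw [← hww, hu, hw₁n] at this
    linarith
  have hs : ∀ p, u p ∈ L → ∀ v : H, inner ℂ (u p) v =
      star (inner ℂ e₁ (u p)) * inner ℂ e₁ v + star (inner ℂ e₂ (u p)) * inner ℂ e₂ v := fun p hp v =>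
    inner_of_mem_span_orthonormal he₁ he₂ he (hspan ▸ hp) v
  have hkr : k * r = c := by
    have h1 := hinn _ hp₁ _ hw
    rw [hww, horth _ m₁ _ _ hw₂, hw₁e, inner_smul_right, norm_mul, norm_inner_symm (u p₁), hk₁] at h1
    rw [← h1, mul_comm]
  have hr0 : 0 < r := by
    rcases (norm_nonneg ω).eq_or_lt with h0 | h0
    · rw [← hr] at h0
      rw [← h0, mul_zero] at hkr
      exact absurd hkr hc.ne
    · exact h0
  -- rotating the component of `w` orthogonal to the line
  have hrot : ∀ y ∈ Lᗮ, ‖y‖ = ρ → ‖inner ℂ (u x) (w₁ + y)‖ = c := by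
    intro y hy hyρ
    have hn : ‖w₁ + y‖ = 1 := by
      have := norm_sq_add_of_mem_orthogonal hw₁ hy
      rw [hw₁n, hyρ, hrρ] at this
      exact (pow_left_inj₀ (norm_nonneg _) zero_le_one two_ne_zero).mp (by rw [this, one_pow])
    have hmem := hF.mem_equiangular p₁ hp₁ p₂ hp₂ p₃ hp₃ h12 h13 h23 (ray (w₁ + y))
    have hp : ∀ p ∈ F, u p ∈ L → overlap p (ray (w₁ + y)) = c := by
      intro p hp hpL
      rw [← hru p, overlap_ray (hu p) hn, horth _ hpL _ _ hy, ← horth _ hpL _ _ hw₂, ← hww,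
        hinn p hp w hw]
    have := hmem (hp _ hp₁ m₁) (hp _ hp₂ m₂) (hp _ hp₃ h) x hx
    rwa [← hru x, overlap_ray (hu x) hn] at this
  obtain ⟨t, ht, hti⟩ := exists_smul_norm_eq hx₂0 hρ0.le
  have hx₂n : 0 < ‖x₂‖ := norm_pos_iff.mpr hx₂0
  have hrot' : ∀ z : ℂ, ‖z‖ = 1 → ‖inner ℂ x₁ w₁ + z * ((ρ * ‖x₂‖ : ℝ) : ℂ)‖ = c := by
    intro z hz
    have hty : z • t • x₂ ∈ Lᗮ := Submodule.smul_mem _ _ (Submodule.smul_mem _ _ hx₂)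
    have := hrot _ hty (by rw [norm_smul, hz, one_mul, ht])
    rwa [hxx, inner_add_of_mem_orthogonal hx₁ hx₂ hw₁ hty, inner_smul_right, hti] at this
  have hx₁w : inner ℂ x₁ w₁ = 0 := by
    refine (eq_zero_or_eq_zero_of_forall_norm_add_mul hrot').resolve_right ?_
    exact_mod_cast (by positivity : ρ * ‖x₂‖ ≠ 0)
  have hρx : ρ * ‖x₂‖ = c := by
    have := hrot' 1 norm_one
    rwa [hx₁w, zero_add, one_mul, Complex.norm_real, Real.norm_of_nonneg (by positivity)] at this
  have hx₁e : inner ℂ x₁ e₁ = 0 := by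
    rw [hw₁e, inner_smul_right] at hx₁w
    exact (mul_eq_zero.mp hx₁w).resolve_left (norm_pos_iff.mp hr0)
  obtain ⟨e₃, he₃, hxe₃⟩ := exists_normalization hx₂0
  have he₃L : e₃ ∈ Lᗮ := by
    rw [← Submodule.smul_mem_iff _ (show (‖x₂‖ : ℂ) ≠ 0 by exact_mod_cast hx₂n.ne'), ← hxe₃]
    exact hx₂
  set τ := Real.sqrt (1 - k ^ 2) with hτ
  have hτs : ∀ p, u p ∈ L → ‖inner ℂ e₁ (u p)‖ = k → ‖inner ℂ e₂ (u p)‖ = τ := by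
    intro p hp hpk
    have := norm_sq_of_mem_span_orthonormal he₁ he₂ he (hspan ▸ hp)
    rw [hu, hpk] at this
    rw [hτ, ← Real.sqrt_sq (norm_nonneg (inner ℂ e₂ (u p)))]
    congr 1
    linarith
  have hkτ : k ^ 2 + τ ^ 2 = 1 := by
    have := norm_sq_of_mem_span_orthonormal he₁ he₂ he (hspan ▸ m₁)
    rw [hu, hk₁, hτs _ m₁ hk₁] at this
    linarith
  have hτ0 : 0 < τ := by
    refine lt_of_le_of_ne (Real.sqrt_nonneg _) fun h0 => hne _ _ h12 ?_
    have hz : ∀ p, u p ∈ L → ‖inner ℂ e₁ (u p)‖ = k → ray (u p) = ray e₁ := by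
      intro p hp hpk
      have h1 := hτs p hp hpk
      rw [← h0, norm_eq_zero] at h1
      have h2 := eq_of_mem_span_orthonormal he₁ he₂ he (hspan ▸ hp)
      rw [h1, zero_smul, add_zero] at h2
      exact (ray_eq_ray_iff (ne_zero_of_norm_one (hu p)) (ne_zero_of_norm_one he₁)).mpr
        ⟨_, h2.symm⟩
    rw [hz _ m₁ hk₁, hz _ m₂ hk₂]
  -- the circle of latitude
  set S : ℂ → H := latitude k τ e₁ e₂ with hS
  have hSn : ∀ z : ℂ, ‖z‖ = 1 → ‖S z‖ = 1 := fun z hz => norm_latitude hkτ he₁ he₂ he hz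
  have hSL : ∀ z, S z ∈ L := fun z => hspan ▸ latitude_mem_span k τ e₁ e₂ z
  have hSi : ∀ z v, inner ℂ (S z) v = k * inner ℂ e₁ v + τ * star z * inner ℂ e₂ v :=
    inner_latitude_left k τ e₁ e₂
  have hSinj : Set.InjOn (fun z : ℂ => ray (S z)) {z | ‖z‖ = 1} :=
    injOn_ray_latitude hk0.ne' hτ0.ne' hkτ he₁ he₂ he
  -- An equiangular point is orthogonal to a pole, so its overlap with a point of the circle depends
  -- only on the latitude. The circle therefore lies in F up to finitely many points.
  have hSB : ∀ z : ℂ, ‖z‖ = 1 → ray (S z) ∈ equiangular c (equiangular c F) := by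
    intro z hz b hb
    rw [overlap_comm, ← hru b, overlap_ray (hSn z hz) (hu b), hSi]
    have h1 := hinn _ hp₁ _ hb
    rw [hs _ m₁] at h1
    rcases hpole (u b) (hinn _ hp₁ _ hb) (hinn _ hp₂ _ hb) (hinn _ hp₃ _ hb) with h0 | h0
    · rw [h0, mul_zero, zero_add, norm_mul, norm_star, hτs _ m₁ hk₁] at h1
      rw [h0, mul_zero, zero_add, norm_mul, norm_mul, norm_star, hz, Complex.norm_real,
        Real.norm_of_nonneg hτ0.le, mul_one, h1]
    · rw [h0, mul_zero, add_zero, norm_mul, norm_star, hk₁] at h1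
      rw [h0, mul_zero, add_zero, norm_mul, Complex.norm_real, Real.norm_of_nonneg hk0.le, h1]
  have hbad : {z : ℂ | ‖z‖ = 1 ∧ ray (S z) ∉ F}.Finite := by
    refine Set.Finite.of_finite_image (f := fun z : ℂ => ray (S z)) (hF.finite_diff.subset ?_)
      (hSinj.mono fun z hz => hz.1)
    rintro _ ⟨z, hz, rfl⟩
    exact ⟨hSB z hz.1, hz.2⟩
  have hinL : ∀ z : ℂ, ‖z‖ = 1 → ray (S z) ≠ x := by
    intro z hz heq
    apply hX
    obtain ⟨d, hd⟩ := (ray_eq_ray_iff (ne_zero_of_norm_one (hu x))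
      (ne_zero_of_norm_one (hSn z hz))).mp ((hru x).trans heq.symm)
    rw [← hd]
    exact Submodule.smul_mem _ _ (hSL z)
  obtain ⟨z₁, z₂, v, hz₁, hz₂, hz, hb₁, hb₂, hv, hv₁, hv₂, hvx, hve₁, hve₂⟩ :=
    exists_equiangular_perturbation hc hk0 hτ0 hr0 hρ0 hkτ hrρ hkr he₁ he₂ he₃ he
      ((Submodule.mem_orthogonal _ _).mp he₃L e₁ me₁) ((Submodule.mem_orthogonal _ _).mp he₃L e₂ me₂)
      (hu x) (by rw [hxx, inner_add_left, hx₁e, zero_add, (Submodule.mem_orthogonal' _ _).mp hx₂ _ me₁])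
      (by rw [hxx, inner_add_left, (Submodule.mem_orthogonal _ _).mp he₃L _ hx₁, zero_add, ← hρx]
          conv_lhs => rw [hxe₃]
          rw [inner_smul_left, inner_self_of_norm_one he₃, mul_one, Complex.conj_ofReal,
            Complex.norm_real, norm_norm]) hbad
  have hF₁ : ray (S z₁) ∈ F := by
    by_contra h0
    exact hb₁ ⟨hz₁, h0⟩
  have hF₂ : ray (S z₂) ∈ F := by
    by_contra h0
    exact hb₂ ⟨hz₂, h0⟩
  have hW := hF.mem_equiangular _ hF₁ _ hF₂ x hx (fun h0 => hz (hSinj hz₁ hz₂ h0)) (hinL _ hz₁)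
    (hinL _ hz₂) (ray v) (by rw [overlap_ray (hSn _ hz₁) hv]; exact hv₁)
    (by rw [overlap_ray (hSn _ hz₂) hv]; exact hv₂) (by rw [← hru x, overlap_ray (hu x) hv, hvx])
  have hWp : ∀ p ∈ F, ‖inner ℂ (u p) v‖ = c := by
    intro p hp
    have := hW p hp
    rwa [← hru p, overlap_ray (hu p) hv] at this
  rcases hpole _ (hWp _ hp₁) (hWp _ hp₂) (hWp _ hp₃) with h0 | h0
  exacts [hve₁ h0, hve₂ h0]

/-- A circle-like set is contained in a projective line. -/
theorem CircleLike.onLine {c : ℝ} (hc : 0 < c) {F : Set (ℙ ℂ H)} (hF : CircleLike c F)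
    {p q r : ℙ ℂ H} (hp : p ∈ F) (hq : q ∈ F) (hr : r ∈ F) (hpq : p ≠ q) : OnLine p q r := by
  obtain ⟨p₁, hp₁, p₂, hp₂, p₃, hp₃, h12, h13, h23, h⟩ := hF.exists_onLine hc
  have hx := fun {x} => onLine_of_three_onLine (x := x) hc hF hp₁ hp₂ hp₃ h12 h13 h23 h
  exact (hx hp).exchange (hx hq) (hx hr) hpq

end CircleLikeOnLine

/-! ### Great circles are circle-like; collinearity is preserved -/

section GreatCircle

set_option linter.unusedSectionVars false

variable {H : Type*} [NormedAddCommGroup H] [InnerProductSpace ℂ H] [Nontrivial H]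

theorem two_inv_sqrt_sq : (√2)⁻¹ ^ 2 + (√2)⁻¹ ^ 2 = 1 := by
  rw [inv_pow, Real.sq_sqrt (by norm_num)]
  norm_num

/-- The great circle with poles `e₁` and `e₂` on the projective line through them. -/
noncomputable def greatCircle (e₁ e₂ : H) : Set (ℙ ℂ H) :=
  (fun z : ℂ => ray (latitude (√2)⁻¹ (√2)⁻¹ e₁ e₂ z)) '' {z | ‖z‖ = 1}

theorem norm_sqrt_mul_sq {c : ℝ} (hc2 : 2 * c ^ 2 < 1) : (√2 * c) ^ 2 + √(1 - 2 * c ^ 2) ^ 2 = 1 := by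
  rw [mul_pow, Real.sq_sqrt (by norm_num), Real.sq_sqrt (by linarith)]
  ring

/-- Only the common pole contributes to the inner product, and (√2)⁻¹ · (√2 · c) = c. The condition
2c² < 1 leaves a nonzero component along e₃ whose phase z is free. -/
theorem ray_latitude_mem_equiangular {c : ℝ} (hc : 0 < c) (hc2 : 2 * c ^ 2 < 1) {e₁ e₂ e₃ : H}
    (he₁ : ‖e₁‖ = 1) (he₂ : ‖e₂‖ = 1) (he₃ : ‖e₃‖ = 1) (h12 : inner ℂ e₁ e₂ = 0)
    (h13 : inner ℂ e₁ e₃ = 0) (h23 : inner ℂ e₂ e₃ = 0) {z : ℂ} (hz : ‖z‖ = 1) :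
    ray (latitude (√2 * c) √(1 - 2 * c ^ 2) e₁ e₃ z) ∈ equiangular c (greatCircle e₁ e₂) ∧
    ray (latitude (√2 * c) √(1 - 2 * c ^ 2) e₂ e₃ z) ∈ equiangular c (greatCircle e₁ e₂) := by
  have hab := norm_sqrt_mul_sq hc2
  have hs : (√2 : ℝ) ≠ 0 := by positivity
  constructor
  · rintro _ ⟨z', hz', rfl⟩
    rw [overlap_ray (norm_latitude two_inv_sqrt_sq he₁ he₂ h12 hz')
      (norm_latitude hab he₁ he₃ h13 hz), inner_latitude_left, inner_latitude_right,
      inner_latitude_right, h13, h23, inner_eq_zero_comm' h12, inner_self_of_norm_one he₁]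
    simp only [mul_zero, add_zero, mul_one]
    rw [← Complex.ofReal_mul, Complex.norm_real, inv_mul_cancel_left₀ hs,
      Real.norm_of_nonneg hc.le]
  · rintro _ ⟨z', hz', rfl⟩
    have hz'' : ‖z'‖ = 1 := hz'
    rw [overlap_ray (norm_latitude two_inv_sqrt_sq he₁ he₂ h12 hz')
      (norm_latitude hab he₂ he₃ h23 hz), inner_latitude_left, inner_latitude_right,
      inner_latitude_right, h13, h23, h12, inner_self_of_norm_one he₂]
    simp only [mul_zero, add_zero, mul_one, zero_add]
    rw [mul_right_comm, ← Complex.ofReal_mul, norm_mul, norm_star, hz'', mul_one,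
      Complex.norm_real, inv_mul_cancel_left₀ hs, Real.norm_of_nonneg hc.le]

theorem circleLike_greatCircle {c : ℝ} (hc : 0 < c) (hc2 : 2 * c ^ 2 < 1) {e₁ e₂ e₃ : H}
    (he₁ : ‖e₁‖ = 1) (he₂ : ‖e₂‖ = 1) (he₃ : ‖e₃‖ = 1) (h12 : inner ℂ e₁ e₂ = 0)
    (h13 : inner ℂ e₁ e₃ = 0) (h23 : inner ℂ e₂ e₃ = 0) : CircleLike c (greatCircle e₁ e₂) := by
  have hκ : (0 : ℝ) < (√2)⁻¹ := by positivity
  have ha : 0 < √2 * c := by positivity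
  have hb : 0 < √(1 - 2 * c ^ 2) := Real.sqrt_pos.mpr (by linarith)
  have hab := norm_sqrt_mul_sq hc2
  have hκa : (√2)⁻¹ * (√2 * c) = c := inv_mul_cancel_left₀ (by positivity) c
  have hn := fun {z : ℂ} (hz : ‖z‖ = 1) => norm_latitude two_inv_sqrt_sq he₁ he₂ h12 hz
  refine ⟨infinite_unimodular.image (injOn_ray_latitude hκ.ne' hκ.ne' two_inv_sqrt_sq he₁ he₂ h12),
    ?_, ?_, ?_⟩
  · refine (infinite_unimodular.image
      (injOn_ray_latitude ha.ne' hb.ne' hab he₁ he₃ h13)).mono ?_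
    rintro _ ⟨z, hz, rfl⟩
    exact (ray_latitude_mem_equiangular hc hc2 he₁ he₂ he₃ h12 h13 h23 hz).1
  · rintro _ ⟨z₁, hz₁, rfl⟩ _ ⟨z₂, hz₂, rfl⟩ _ ⟨z₃, hz₃, rfl⟩ g12 g13 g23 w w₁ w₂ w₃
    obtain ⟨w, hw, rfl⟩ := exists_ray w
    rw [overlap_ray (hn hz₁) hw] at w₁
    rw [overlap_ray (hn hz₂) hw] at w₂
    rw [overlap_ray (hn hz₃) hw] at w₃
    have hk : ∀ z : ℂ, ‖inner ℂ e₁ (latitude (√2)⁻¹ (√2)⁻¹ e₁ e₂ z)‖ = (√2)⁻¹ := by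
      intro z
      rw [inner_latitude_right, h12, inner_self_of_norm_one he₁, mul_zero, add_zero, mul_one,
        Complex.norm_real, Real.norm_of_nonneg hκ.le]
    rintro _ ⟨z, hz, rfl⟩
    have hz' : ‖z‖ = 1 := hz
    have hz₁' : ‖z₁‖ = 1 := hz₁
    rw [overlap_ray (hn hz) hw]
    rw [inner_latitude_left] at w₁ ⊢
    rw [inner_latitude_left] at w₂ w₃
    rcases inner_eq_zero_or_of_norm_inner_eq (w := w) (t := c) he₁ he₂ h12 hκ (hn hz₁) (hn hz₂)
      (hn hz₃) g12 g13 g23 (latitude_mem_span _ _ _ _ _) (latitude_mem_span _ _ _ _ _)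
      (latitude_mem_span _ _ _ _ _) (hk _) (hk _) (hk _) (by rw [inner_latitude_left, w₁])
      (by rw [inner_latitude_left, w₂]) (by rw [inner_latitude_left, w₃]) with h0 | h0
    · rw [h0, mul_zero, zero_add, norm_mul, norm_mul, norm_star] at w₁ ⊢
      rw [hz', ← hz₁', w₁]
    · rw [h0, mul_zero, add_zero] at w₁ ⊢
      exact w₁
  -- An extra point can occur: in dimension 3 with 3c² = 1 the ray of e₃ is in the double
  -- equiangular set. Hence a finite difference and not equality.
  · refine Set.Subsingleton.finite fun p hp q hq => ?_
    set L := Submodule.span ℂ {e₁, e₂} with hL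
    have me₁ : e₁ ∈ L := Submodule.subset_span (by simp)
    have me₂ : e₂ ∈ L := Submodule.subset_span (by simp)
    -- Rotate the equiangular points about the line: if x has a component off L, its component in L
    -- must vanish; if it has none, its coordinates have equal modulus and it is on the circle. The
    -- exceptional x has no orthogonal partner in Lᗮ, so there is at most one.
    have key : ∀ x : H, ‖x‖ = 1 → ray x ∈ equiangular c (equiangular c (greatCircle e₁ e₂)) →
        ray x ∉ greatCircle e₁ e₂ → x ∈ Lᗮ ∧ ∀ y ∈ Lᗮ, ‖y‖ = 1 → inner ℂ x y ≠ 0 := by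
      intro x hx hxN hxC
      obtain ⟨x₁, hx₁, x₂, hx₂, rfl⟩ := exists_decomposition L x
      have hrot : ∀ y ∈ Lᗮ, ‖y‖ = 1 → ∀ z : ℂ, ‖z‖ = 1 →
          ‖√2 * c * inner ℂ x₁ e₁ + z * (√(1 - 2 * c ^ 2) * inner ℂ x₂ y)‖ = c ∧
          ‖√2 * c * inner ℂ x₁ e₂ + z * (√(1 - 2 * c ^ 2) * inner ℂ x₂ y)‖ = c := by
        intro y hy hy1 z hz
        have o₁ := (Submodule.mem_orthogonal _ _).mp hy e₁ me₁
        have o₂ := (Submodule.mem_orthogonal _ _).mp hy e₂ me₂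
        obtain ⟨h1, h2⟩ := ray_latitude_mem_equiangular hc hc2 he₁ he₂ hy1 h12 o₁ o₂ hz
        have h3 := hxN _ h1
        have h4 := hxN _ h2
        have p₁ : inner ℂ (x₁ + x₂) e₁ = inner ℂ x₁ e₁ := by
          rw [inner_add_left, (Submodule.mem_orthogonal' _ _).mp hx₂ _ me₁, add_zero]
        have p₂ : inner ℂ (x₁ + x₂) e₂ = inner ℂ x₁ e₂ := by
          rw [inner_add_left, (Submodule.mem_orthogonal' _ _).mp hx₂ _ me₂, add_zero]
        have p₃ : inner ℂ (x₁ + x₂) y = inner ℂ x₂ y := by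
          rw [inner_add_left, (Submodule.mem_orthogonal _ _).mp hy _ hx₁, zero_add]
        rw [overlap_comm, overlap_ray hx (norm_latitude hab he₁ hy1 o₁ hz), inner_latitude_right,
          p₁, p₃] at h3
        rw [overlap_comm, overlap_ray hx (norm_latitude hab he₂ hy1 o₂ hz), inner_latitude_right,
          p₂, p₃] at h4
        push_cast at h3 h4
        rw [show ∀ u v : ℂ, z * (u * v) = u * z * v by intros; ring]
        exact ⟨h3, h4⟩
      have ha' : (√2 * c : ℂ) ≠ 0 := by exact_mod_cast ha.ne'
      have hb' : (√(1 - 2 * c ^ 2) : ℂ) ≠ 0 := by exact_mod_cast hb.ne'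
      have hx₂0 : x₂ ≠ 0 := by
        rintro rfl
        apply hxC
        rw [add_zero] at hx ⊢
        have hκ' : ∀ t : ℂ, ‖√2 * c * t‖ = c → ‖t‖ = (√2)⁻¹ := by
          intro t ht
          rw [← Complex.ofReal_mul, norm_mul, Complex.norm_real, Real.norm_of_nonneg ha.le] at ht
          have : √2 * c * ‖t‖ = √2 * c * (√2)⁻¹ := by rw [ht, mul_comm, hκa]
          exact mul_left_cancel₀ ha.ne' this
        obtain ⟨h1, h2⟩ := hrot e₃ ((Submodule.mem_orthogonal _ _).mpr fun v hv => by
          obtain ⟨s, t, rfl⟩ := Submodule.mem_span_pair.mp hv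
          rw [inner_add_left, inner_smul_left, inner_smul_left, h13, h23]
          simp) he₃ 1 norm_one
        rw [inner_zero_left, mul_zero, mul_zero, add_zero] at h1 h2
        have n₁ := hκ' _ h1
        have n₂ := hκ' _ h2
        rw [norm_inner_symm] at n₁ n₂
        have hn0 : inner ℂ e₁ x₁ ≠ 0 := norm_pos_iff.mp (by rw [n₁]; exact hκ)
        refine ⟨inner ℂ e₂ x₁ / inner ℂ e₁ x₁, ?_, ?_⟩
        · rw [Set.mem_ofPred_eq, norm_div, n₁, n₂, div_self hκ.ne']
        · have hd := eq_of_mem_span_orthonormal he₁ he₂ h12 hx₁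
          have hz : ‖inner ℂ e₂ x₁ / inner ℂ e₁ x₁‖ = 1 := by
            rw [norm_div, n₁, n₂, div_self hκ.ne']
          refine (ray_eq_ray_iff (ne_zero_of_norm_one (hn hz)) (ne_zero_of_norm_one hx)).mpr
            ⟨((√2)⁻¹ : ℝ) / inner ℂ e₁ x₁, ?_⟩
          refine (congrArg (_ • ·) hd).trans ?_
          rw [latitude]
          match_scalars <;> field_simp
      have hzero : x₁ = 0 := by
        obtain ⟨y, hy, hxy⟩ := exists_normalization hx₂0
        have hyL : y ∈ Lᗮ := by
          rw [← Submodule.smul_mem_iff _ (show (‖x₂‖ : ℂ) ≠ 0 by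
            exact_mod_cast norm_ne_zero_iff.mpr hx₂0), ← hxy]
          exact hx₂
        have hxy0 : (√(1 - 2 * c ^ 2) : ℂ) * inner ℂ x₂ y ≠ 0 := by
          refine mul_ne_zero hb' ?_
          conv_lhs => rw [hxy]
          rw [inner_smul_left, inner_self_of_norm_one hy, mul_one, Complex.conj_ofReal]
          exact_mod_cast norm_ne_zero_iff.mpr hx₂0
        have z₁ := (eq_zero_or_eq_zero_of_forall_norm_add_mul
          fun z hz => (hrot y hyL hy z hz).1).resolve_right hxy0
        have z₂ := (eq_zero_or_eq_zero_of_forall_norm_add_mul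
          fun z hz => (hrot y hyL hy z hz).2).resolve_right hxy0
        rw [eq_of_mem_span_orthonormal he₁ he₂ h12 hx₁,
          inner_eq_zero_comm' ((mul_eq_zero.mp z₁).resolve_left ha'),
          inner_eq_zero_comm' ((mul_eq_zero.mp z₂).resolve_left ha'), zero_smul, zero_smul, add_zero]
      subst hzero
      rw [zero_add]
      refine ⟨hx₂, fun y hy hy1 h0 => ?_⟩
      have := (hrot y hy hy1 1 norm_one).1
      rw [inner_zero_left, h0, mul_zero, mul_zero, mul_zero, add_zero, norm_zero] at this
      exact hc.ne this
    obtain ⟨x, hx, rfl⟩ := exists_ray p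
    obtain ⟨y, hy, rfl⟩ := exists_ray q
    obtain ⟨hxL, hxn⟩ := key x hx hp.1 hp.2
    obtain ⟨hyL, -⟩ := key y hy hq.1 hq.2
    by_contra hxy
    have hv0 : y - inner ℂ x y • x ≠ 0 := fun h0 => hxy ((ray_eq_ray_iff (ne_zero_of_norm_one hy)
      (ne_zero_of_norm_one hx)).mpr ⟨_, (sub_eq_zero.mp h0).symm⟩).symm
    obtain ⟨v, hv, hvv⟩ := exists_normalization hv0
    have hvn : (‖y - inner ℂ x y • x‖ : ℂ) ≠ 0 := by exact_mod_cast norm_ne_zero_iff.mpr hv0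
    refine hxn v ?_ hv ?_
    · rw [← Submodule.smul_mem_iff _ hvn, ← hvv]
      exact Submodule.sub_mem _ hyL (Submodule.smul_mem _ _ hxL)
    · have : inner ℂ x (y - inner ℂ x y • x) = 0 := by
        rw [inner_sub_right, inner_smul_right, inner_self_of_norm_one hx, mul_one, sub_self]
      rw [hvv, inner_smul_right] at this
      exact (mul_eq_zero.mp this).resolve_left hvn

theorem image_equiangular {c : ℝ} {e : ℙ ℂ H ≃ ℙ ℂ H}
    (he : ∀ p q, overlap p q = c ↔ overlap (e p) (e q) = c) (F : Set (ℙ ℂ H)) :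
    equiangular c (e '' F) = e '' equiangular c F := by
  ext w
  rw [Equiv.image_eq_preimage_symm e (equiangular c F)]
  constructor
  · intro hw p hp
    rw [he, e.apply_symm_apply]
    exact hw _ ⟨p, hp, rfl⟩
  · rintro hw _ ⟨p, hp, rfl⟩
    have := (he _ _).mp (hw p hp)
    rwa [e.apply_symm_apply] at this

theorem CircleLike.image {c : ℝ} {e : ℙ ℂ H ≃ ℙ ℂ H}
    (he : ∀ p q, overlap p q = c ↔ overlap (e p) (e q) = c) {F : Set (ℙ ℂ H)}
    (hF : CircleLike c F) : CircleLike c (e '' F) := by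
  refine ⟨hF.infinite.image e.injective.injOn, ?_, ?_, ?_⟩
  · rw [image_equiangular he]
    exact hF.infinite_equiangular.image e.injective.injOn
  · rintro _ ⟨p, hp, rfl⟩ _ ⟨q, hq, rfl⟩ _ ⟨r, hr, rfl⟩ hpq hpr hqr w h1 h2 h3
    obtain ⟨w, rfl⟩ := e.surjective w
    rw [image_equiangular he]
    exact ⟨w, hF.mem_equiangular p hp q hq r hr (fun h => hpq (h ▸ rfl)) (fun h => hpr (h ▸ rfl))
      (fun h => hqr (h ▸ rfl)) w ((he _ _).mpr h1) ((he _ _).mpr h2) ((he _ _).mpr h3), rfl⟩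
  · rw [image_equiangular he, image_equiangular he, ← Set.image_sdiff e.injective]
    exact hF.finite_diff.image _

/-- Antipodal points and any third point of the sphere share a great circle, whose image is
circle-like and therefore collinear. -/
theorem onLine_map_of_orthonormal {c : ℝ} (hc : 0 < c) (hc2 : 2 * c ^ 2 < 1) {e : ℙ ℂ H ≃ ℙ ℂ H}
    (he : ∀ p q, overlap p q = c ↔ overlap (e p) (e q) = c)
    (hdim : ∀ u v : H, ∃ w : H, ‖w‖ = 1 ∧ inner ℂ u w = 0 ∧ inner ℂ v w = 0)
    {f₁ f₂ : H} (hf₁ : ‖f₁‖ = 1) (hf₂ : ‖f₂‖ = 1) (hf : inner ℂ f₁ f₂ = 0) {r : ℙ ℂ H}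
    (hr : OnLine (ray f₁) (ray f₂) r) : OnLine (e (ray f₁)) (e (ray f₂)) (e r) := by
  obtain ⟨x, hx, rfl⟩ := exists_ray r
  have hx0 := ne_zero_of_norm_one hx
  rw [onLine_ray_iff (ne_zero_of_norm_one hf₁) (ne_zero_of_norm_one hf₂) hx0] at hr
  obtain ⟨α, β, hαβ⟩ := Submodule.mem_span_pair.mp hr
  by_cases hα : α = 0
  · rw [hα, zero_smul, zero_add] at hαβ
    rw [(ray_eq_ray_iff hx0 (ne_zero_of_norm_one hf₂)).mpr ⟨β, hαβ⟩]
    exact onLine_right _ _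
  by_cases hβ : β = 0
  · rw [hβ, zero_smul, add_zero] at hαβ
    rw [(ray_eq_ray_iff hx0 (ne_zero_of_norm_one hf₁)).mpr ⟨α, hαβ⟩]
    exact onLine_left _ _
  obtain ⟨t, ht⟩ : ∃ t : ℝ, t = ‖β / α‖ := ⟨_, rfl⟩
  have ht0 : 0 < t := by rw [ht]; exact norm_pos_iff.mpr (div_ne_zero hβ hα)
  have htc : (t : ℂ) ≠ 0 := by exact_mod_cast ht0.ne'
  obtain ⟨ω, hω⟩ : ∃ ω : ℂ, ω = β / α / t := ⟨_, rfl⟩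
  have hωn : ‖ω‖ = 1 := by
    rw [hω, norm_div, ← ht, Complex.norm_real, Real.norm_of_nonneg ht0.le, div_self ht0.ne']
  have hω0 : ω ≠ 0 := by rintro h0; rw [h0, norm_zero] at hωn; exact zero_ne_one hωn
  have hκ0 : ((√2)⁻¹ : ℝ) ≠ 0 := by positivity
  have hκκ : (((√2)⁻¹ : ℝ) : ℂ) * ((√2)⁻¹ : ℝ) = 1 / 2 := by
    rw [← Complex.ofReal_mul, ← mul_inv, Real.mul_self_sqrt (by norm_num)]
    push_cast
    norm_num
  obtain ⟨κ, hκ⟩ : ∃ κ : ℂ, κ = (((√2)⁻¹ : ℝ) : ℂ) := ⟨_, rfl⟩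
  have hiω : ‖Complex.I * ω‖ = 1 := by rw [norm_mul, Complex.norm_I, hωn, one_mul]
  have hiω' : ‖-Complex.I * ω‖ = 1 := by rw [norm_mul, norm_neg, Complex.norm_I, hωn, one_mul]
  -- The poles of the meridian through f₁, f₂ and x; ω is the relative phase of the coordinates of
  -- x.
  set e₁ := latitude (√2)⁻¹ (√2)⁻¹ f₁ f₂ (Complex.I * ω) with he₁
  set e₂ := latitude (√2)⁻¹ (√2)⁻¹ f₁ f₂ (-Complex.I * ω) with he₂
  have n₁ : ‖e₁‖ = 1 := norm_latitude two_inv_sqrt_sq hf₁ hf₂ hf hiω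
  have n₂ : ‖e₂‖ = 1 := norm_latitude two_inv_sqrt_sq hf₁ hf₂ hf hiω'
  have hωω : star ω * ω = 1 := by
    rw [Complex.star_def, Complex.conj_mul', hωn]
    norm_num
  have h12 : inner ℂ e₁ e₂ = 0 := by
    rw [he₁, he₂, inner_latitude_left, inner_latitude_right, inner_latitude_right, hf,
      inner_eq_zero_comm' hf, inner_self_of_norm_one hf₁, inner_self_of_norm_one hf₂, star_mul,
      Complex.star_def, Complex.conj_I, ← Complex.star_def]
    linear_combination (1 + Complex.I ^ 2 * (star ω * ω)) * hκκ + 1 / 2 * Complex.I ^ 2 * hωω +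
      1 / 2 * Complex.I_sq
  obtain ⟨e₃, n₃, h13, h23⟩ := hdim e₁ e₂
  have hC := (circleLike_greatCircle hc hc2 n₁ n₂ n₃ h12 h13 h23).image he
  have hmem : ∀ z : ℂ, ‖z‖ = 1 → ∀ v : H, v ≠ 0 → (∃ s : ℂ, s • v = latitude (√2)⁻¹ (√2)⁻¹ e₁ e₂ z) →
      e (ray v) ∈ e '' greatCircle e₁ e₂ := by
    intro z hz v hv hs
    refine ⟨_, ⟨z, hz, rfl⟩, congrArg e ?_⟩
    exact (ray_eq_ray_iff (ne_zero_of_norm_one (norm_latitude two_inv_sqrt_sq n₁ n₂ h12 hz)) hv).mpr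
      hs
  rw [← hκ] at hκκ
  -- Parameters 1 and -1 give f₁ and f₂. The Cayley transform of t makes e₁ + z • e₂ proportional to
  -- f₁ + (t · ω) • f₂.
  refine hC.onLine hc (hmem 1 norm_one f₁ (ne_zero_of_norm_one hf₁) ⟨1, ?_⟩)
    (hmem (-1) (by rw [norm_neg, norm_one]) f₂ (ne_zero_of_norm_one hf₂) ⟨Complex.I * ω, ?_⟩)
    (hmem ((1 + t * Complex.I) / (1 - t * Complex.I)) ?_ x hx0
      ⟨1 / (α * (1 - t * Complex.I)), ?_⟩)
    (e.injective.ne (ray_ne_of_orthonormal hf₁ hf₂ hf))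
  · simp only [latitude, he₁, he₂, ← hκ]
    match_scalars
    · linear_combination -2 * hκκ
    · ring
  · simp only [latitude, he₁, he₂, ← hκ]
    match_scalars
    · linear_combination (-2 * Complex.I * ω) * hκκ
    · ring
  · rw [norm_div]
    have : ‖(1 : ℂ) - t * Complex.I‖ = ‖(1 : ℂ) + t * Complex.I‖ := by
      rw [← Complex.norm_conj]
      simp
    rw [this]
    refine div_self (norm_ne_zero_iff.mpr fun h0 => ?_)
    have := congrArg Complex.re h0
    simp at this
  · have hd : (1 : ℂ) - t * Complex.I ≠ 0 := by
      intro h0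
      have := congrArg Complex.re h0
      simp at this
    have hβ' : β = α * t * ω := by rw [hω]; field_simp
    rw [← hαβ, hβ']
    simp only [latitude, he₁, he₂, ← hκ]
    match_scalars
    · field_simp
      linear_combination -2 * hκκ
    · field_simp
      linear_combination (2 * t * Complex.I ^ 2) * hκκ + t * Complex.I_sq

theorem OnLine.map {c : ℝ} (hc : 0 < c) (hc2 : 2 * c ^ 2 < 1) {e : ℙ ℂ H ≃ ℙ ℂ H}
    (he : ∀ p q, overlap p q = c ↔ overlap (e p) (e q) = c)
    (hdim : ∀ u v : H, ∃ w : H, ‖w‖ = 1 ∧ inner ℂ u w = 0 ∧ inner ℂ v w = 0)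
    {p q r : ℙ ℂ H} (hpq : p ≠ q) (h : OnLine p q r) : OnLine (e p) (e q) (e r) := by
  obtain ⟨x, hx, rfl⟩ := exists_ray p
  obtain ⟨y, hy, rfl⟩ := exists_ray q
  obtain ⟨z, hz, rfl⟩ := exists_ray r
  have mx : x ∈ Submodule.span ℂ {x, y} := Submodule.subset_span (by simp)
  have my : y ∈ Submodule.span ℂ {x, y} := Submodule.subset_span (by simp)
  obtain ⟨f, hf, hxf, hspan⟩ := exists_orthonormal_basis_of_mem hx hy hpq hx mx
  have key : ∀ v : H, ‖v‖ = 1 → v ∈ Submodule.span ℂ {x, y} →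
      OnLine (e (ray x)) (e (ray f)) (e (ray v)) := fun v hv hm =>
    onLine_map_of_orthonormal hc hc2 he hdim hx hf hxf
      ((onLine_ray_iff (ne_zero_of_norm_one hx) (ne_zero_of_norm_one hf)
        (ne_zero_of_norm_one hv)).mpr (hspan ▸ hm))
  exact (key x hx mx).exchange (key y hy my) (key z hz ((onLine_ray_iff (ne_zero_of_norm_one hx)
    (ne_zero_of_norm_one hy) (ne_zero_of_norm_one hz)).mp h)) (e.injective.ne hpq)

end GreatCircle

/-! ### Orthogonality is preserved -/

section Orthogonality

variable {H : Type*} [NormedAddCommGroup H] [InnerProductSpace ℂ H]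

theorem inner_eq_zero_of_mem_span_pair {e x y z : H} (hx : inner ℂ e x = 0) (hy : inner ℂ e y = 0)
    (hz : z ∈ Submodule.span ℂ {x, y}) : inner ℂ e z = 0 := by
  obtain ⟨a, b, rfl⟩ := Submodule.mem_span_pair.mp hz
  rw [inner_add_right, inner_smul_right, inner_smul_right, hx, hy, mul_zero, mul_zero, add_zero]

/-- Pigeonhole: two of the three vectors are orthogonal to the same pole, and x lies in their span.
-/
theorem inner_eq_zero_or_of_mem_span_pairs {e₁ e₂ x w₁ w₂ w₃ : H}
    (h₁ : inner ℂ e₁ w₁ = 0 ∨ inner ℂ e₂ w₁ = 0) (h₂ : inner ℂ e₁ w₂ = 0 ∨ inner ℂ e₂ w₂ = 0)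
    (h₃ : inner ℂ e₁ w₃ = 0 ∨ inner ℂ e₂ w₃ = 0) (h12 : x ∈ Submodule.span ℂ {w₁, w₂})
    (h13 : x ∈ Submodule.span ℂ {w₁, w₃}) (h23 : x ∈ Submodule.span ℂ {w₂, w₃}) :
    inner ℂ e₁ x = 0 ∨ inner ℂ e₂ x = 0 := by
  rcases h₁ with h₁ | h₁ <;> rcases h₂ with h₂ | h₂
  · exact .inl (inner_eq_zero_of_mem_span_pair h₁ h₂ h12)
  · rcases h₃ with h₃ | h₃
    · exact .inl (inner_eq_zero_of_mem_span_pair h₁ h₃ h13)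
    · exact .inr (inner_eq_zero_of_mem_span_pair h₂ h₃ h23)
  · rcases h₃ with h₃ | h₃
    · exact .inl (inner_eq_zero_of_mem_span_pair h₂ h₃ h23)
    · exact .inr (inner_eq_zero_of_mem_span_pair h₁ h₃ h13)
  · exact .inr (inner_eq_zero_of_mem_span_pair h₁ h₂ h12)

variable [Nontrivial H]

/-- The s-points determine two poles of the line pq. The pigeonhole argument makes each of p and q
orthogonal to a pole, so each is a pole; being distinct, they are opposite. -/
theorem inner_eq_zero_of_equiangular {c : ℝ} (hc : 0 < c) {p q s₁ s₂ s₃ w₁ w₂ w₃ v₁ v₂ v₃ : H}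
    (np : ‖p‖ = 1) (nq : ‖q‖ = 1) (hpq : ray p ≠ ray q)
    (n₁ : ‖s₁‖ = 1) (n₂ : ‖s₂‖ = 1) (n₃ : ‖s₃‖ = 1)
    (h12 : ray s₁ ≠ ray s₂) (h13 : ray s₁ ≠ ray s₃) (h23 : ray s₂ ≠ ray s₃)
    (m₁ : s₁ ∈ Submodule.span ℂ {p, q}) (m₂ : s₂ ∈ Submodule.span ℂ {p, q})
    (m₃ : s₃ ∈ Submodule.span ℂ {p, q})
    (hw : ∀ w ∈ ({w₁, w₂, w₃, v₁, v₂, v₃} : Set H),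
      ‖inner ℂ s₁ w‖ = c ∧ ‖inner ℂ s₂ w‖ = c ∧ ‖inner ℂ s₃ w‖ = c)
    (p12 : p ∈ Submodule.span ℂ {w₁, w₂}) (p13 : p ∈ Submodule.span ℂ {w₁, w₃})
    (p23 : p ∈ Submodule.span ℂ {w₂, w₃}) (q12 : q ∈ Submodule.span ℂ {v₁, v₂})
    (q13 : q ∈ Submodule.span ℂ {v₁, v₃}) (q23 : q ∈ Submodule.span ℂ {v₂, v₃}) :
    inner ℂ p q = 0 := by
  have hs := span_pair_eq_of_mem (linearIndependent_of_ray_ne n₁ n₂ h12) m₁ m₂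
  obtain ⟨c₁, c₂, c₃⟩ := hw w₁ (by simp)
  obtain ⟨e₁, e₂, k₁, k₂, he, hspan, -, -, hpole⟩ :=
    exists_poles hc n₁ n₂ n₃ h12 h13 h23 (hs ▸ m₃) c₁ c₂ c₃
  have hpole' : ∀ w ∈ ({w₁, w₂, w₃, v₁, v₂, v₃} : Set H), inner ℂ e₁ w = 0 ∨ inner ℂ e₂ w = 0 :=
    fun w h => hpole w (hw w h).1 (hw w h).2.1 (hw w h).2.2
  have hp := inner_eq_zero_or_of_mem_span_pairs (hpole' w₁ (by simp)) (hpole' w₂ (by simp))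
    (hpole' w₃ (by simp)) p12 p13 p23
  have hq := inner_eq_zero_or_of_mem_span_pairs (hpole' v₁ (by simp)) (hpole' v₂ (by simp))
    (hpole' v₃ (by simp)) q12 q13 q23
  have mp : p ∈ Submodule.span ℂ {e₁, e₂} := by rw [hspan, hs]; exact Submodule.subset_span (by simp)
  have mq : q ∈ Submodule.span ℂ {e₁, e₂} := by rw [hspan, hs]; exact Submodule.subset_span (by simp)
  have ep := eq_of_mem_span_orthonormal k₁ k₂ he mp
  have eq := eq_of_mem_span_orthonormal k₁ k₂ he mq
  have same : ∀ {e : H} {a b : ℂ}, ‖e‖ = 1 → p = a • e → q = b • e → False := by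
    rintro e a b ne rfl rfl
    have ha : a ≠ 0 := by rintro rfl; simp at np
    have hb : b ≠ 0 := by rintro rfl; simp at nq
    rw [ray_smul ha (ne_zero_of_norm_one ne), ray_smul hb (ne_zero_of_norm_one ne)] at hpq
    exact hpq rfl
  rcases hp with hp | hp <;> rcases hq with hq | hq <;>
    rw [hp, zero_smul] at ep <;> rw [hq, zero_smul] at eq
  · rw [zero_add] at ep eq
    exact (same k₂ ep eq).elim
  · rw [zero_add] at ep
    rw [add_zero] at eq
    rw [ep, eq, inner_smul_left, inner_smul_right, inner_eq_zero_comm' he, mul_zero, mul_zero]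
  · rw [add_zero] at ep
    rw [zero_add] at eq
    rw [ep, eq, inner_smul_left, inner_smul_right, he, mul_zero, mul_zero]
  · rw [add_zero] at ep eq
    exact (same k₁ ep eq).elim

theorem overlap_eq_zero_of_equiangular {c : ℝ} (hc : 0 < c) {P Q : ℙ ℂ H} {S W V : Fin 3 → ℙ ℂ H}
    (hPQ : P ≠ Q) (hS : Function.Injective S) (hSl : ∀ i, OnLine P Q (S i))
    (hW : ∀ i j, overlap (S i) (W j) = c) (hV : ∀ i j, overlap (S i) (V j) = c)
    (hWl : ∀ i j, i ≠ j → OnLine (W i) (W j) P) (hVl : ∀ i j, i ≠ j → OnLine (V i) (V j) Q) :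
    overlap P Q = 0 := by
  obtain ⟨p, np, rfl⟩ := exists_ray P
  obtain ⟨q, nq, rfl⟩ := exists_ray Q
  choose s ns hs using fun i => exists_ray (S i)
  choose w nw hw using fun i => exists_ray (W i)
  choose v nv hv using fun i => exists_ray (V i)
  obtain rfl : (fun i => ray (s i)) = S := funext hs
  obtain rfl : (fun i => ray (w i)) = W := funext hw
  obtain rfl : (fun i => ray (v i)) = V := funext hv
  have cw : ∀ i j, ‖inner ℂ (s i) (w j)‖ = c := fun i j => by
    rw [← overlap_ray (ns i) (nw j)]
    exact hW i j
  have cv : ∀ i j, ‖inner ℂ (s i) (v j)‖ = c := fun i j => by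
    rw [← overlap_ray (ns i) (nv j)]
    exact hV i j
  have ml : ∀ i, s i ∈ Submodule.span ℂ {p, q} := fun i =>
    (onLine_ray_iff (ne_zero_of_norm_one np) (ne_zero_of_norm_one nq)
      (ne_zero_of_norm_one (ns i))).mp (hSl i)
  have mw : ∀ i j, i ≠ j → p ∈ Submodule.span ℂ {w i, w j} := fun i j hij =>
    (onLine_ray_iff (ne_zero_of_norm_one (nw i)) (ne_zero_of_norm_one (nw j))
      (ne_zero_of_norm_one np)).mp (hWl i j hij)
  have mv : ∀ i j, i ≠ j → q ∈ Submodule.span ℂ {v i, v j} := fun i j hij =>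
    (onLine_ray_iff (ne_zero_of_norm_one (nv i)) (ne_zero_of_norm_one (nv j))
      (ne_zero_of_norm_one nq)).mp (hVl i j hij)
  have ne : ∀ i j, i ≠ j → ray (s i) ≠ ray (s j) := fun i j hij h => hij (hS h)
  rw [overlap_ray np nq, inner_eq_zero_of_equiangular hc np nq hPQ (ns 0) (ns 1) (ns 2)
    (ne 0 1 (by decide)) (ne 0 2 (by decide)) (ne 1 2 (by decide)) (ml 0) (ml 1) (ml 2) ?_
    (mw 0 1 (by decide)) (mw 0 2 (by decide)) (mw 1 2 (by decide))
    (mv 0 1 (by decide)) (mv 0 2 (by decide)) (mv 1 2 (by decide)), norm_zero]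
  rintro x (rfl | rfl | rfl | rfl | rfl | rfl)
  exacts [⟨cw _ _, cw _ _, cw _ _⟩, ⟨cw _ _, cw _ _, cw _ _⟩, ⟨cw _ _, cw _ _, cw _ _⟩,
    ⟨cv _ _, cv _ _, cv _ _⟩, ⟨cv _ _, cv _ _, cv _ _⟩, ⟨cv _ _, cv _ _, cv _ _⟩]

theorem onLine_latitude {k τ : ℝ} (hk : k ≠ 0) (hτ : τ ≠ 0) (hkτ : k ^ 2 + τ ^ 2 = 1)
    {e₁ e₂ : H} (he₁ : ‖e₁‖ = 1) (he₂ : ‖e₂‖ = 1) (he : inner ℂ e₁ e₂ = 0) {z z' : ℂ}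
    (hz : ‖z‖ = 1) (hz' : ‖z'‖ = 1) (hne : z ≠ z') :
    OnLine (ray (latitude k τ e₁ e₂ z)) (ray (latitude k τ e₁ e₂ z')) (ray e₁) := by
  have n := norm_latitude hkτ he₁ he₂ he hz
  have n' := norm_latitude hkτ he₁ he₂ he hz'
  rw [onLine_ray_iff (ne_zero_of_norm_one n) (ne_zero_of_norm_one n') (ne_zero_of_norm_one he₁),
    span_pair_eq_of_mem (linearIndependent_of_ray_ne n n'
      ((injOn_ray_latitude hk hτ hkτ he₁ he₂ he).ne hz hz' hne)) (latitude_mem_span _ _ _ _ _)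
      (latitude_mem_span _ _ _ _ _)]
  exact Submodule.subset_span (by simp)

/-- Take three points on the great circle with poles p and q, and three equiangular points on each
of the lines e₁e₃ and e₂e₃. Only collinearity and overlap c enter this configuration, so its image
again certifies orthogonality. -/
theorem overlap_map_eq_zero {c : ℝ} (hc : 0 < c) (hc2 : 2 * c ^ 2 < 1) {e : ℙ ℂ H ≃ ℙ ℂ H}
    (he : ∀ p q, overlap p q = c ↔ overlap (e p) (e q) = c)
    (hdim : ∀ u v : H, ∃ w : H, ‖w‖ = 1 ∧ inner ℂ u w = 0 ∧ inner ℂ v w = 0)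
    {p q : ℙ ℂ H} (h : overlap p q = 0) : overlap (e p) (e q) = 0 := by
  obtain ⟨e₁, n₁, rfl⟩ := exists_ray p
  obtain ⟨e₂, n₂, rfl⟩ := exists_ray q
  rw [overlap_ray n₁ n₂, norm_eq_zero] at h
  obtain ⟨e₃, n₃, h13, h23⟩ := hdim e₁ e₂
  have hκ : (√2)⁻¹ ≠ 0 := by positivity
  have ha : √2 * c ≠ 0 := by positivity
  have hb : √(1 - 2 * c ^ 2) ≠ 0 := (Real.sqrt_pos.mpr (by linarith)).ne'
  have hab := norm_sqrt_mul_sq hc2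
  obtain ⟨ζ, hζ, hζ1⟩ : ∃ ζ : Fin 3 → ℂ, Function.Injective ζ ∧ ∀ i, ‖ζ i‖ = 1 := by
    obtain ⟨t, ht, hc⟩ := infinite_unimodular.exists_subset_card_eq 3
    let f := t.equivFinOfCardEq hc
    exact ⟨fun i => (f.symm i : ℂ), Subtype.val_injective.comp f.symm.injective,
      fun i => ht (f.symm i).2⟩
  have hmem := fun j => ray_latitude_mem_equiangular hc hc2 n₁ n₂ n₃ h h13 h23 (hζ1 j)
  have hinj : ∀ {k τ : ℝ} {f₁ f₂ : H}, k ≠ 0 → τ ≠ 0 → k ^ 2 + τ ^ 2 = 1 → ‖f₁‖ = 1 → ‖f₂‖ = 1 →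
      inner ℂ f₁ f₂ = 0 → ∀ i j, i ≠ j →
      ray (latitude k τ f₁ f₂ (ζ i)) ≠ ray (latitude k τ f₁ f₂ (ζ j)) := fun hk hτ hkτ m₁ m₂ m i j hij =>
    (injOn_ray_latitude hk hτ hkτ m₁ m₂ m).ne (hζ1 i) (hζ1 j) (hζ.ne hij)
  refine overlap_eq_zero_of_equiangular hc
    (S := fun i => e (ray (latitude (√2)⁻¹ (√2)⁻¹ e₁ e₂ (ζ i))))
    (W := fun i => e (ray (latitude (√2 * c) √(1 - 2 * c ^ 2) e₁ e₃ (ζ i))))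
    (V := fun i => e (ray (latitude (√2 * c) √(1 - 2 * c ^ 2) e₂ e₃ (ζ i))))
    (e.injective.ne (ray_ne_of_orthonormal n₁ n₂ h)) ?_ ?_ ?_ ?_ ?_ ?_
  · intro i j hij
    by_contra hne
    exact hinj hκ hκ two_inv_sqrt_sq n₁ n₂ h i j hne (e.injective hij)
  · intro i
    refine OnLine.map hc hc2 he hdim (ray_ne_of_orthonormal n₁ n₂ h) ?_
    rw [onLine_ray_iff (ne_zero_of_norm_one n₁) (ne_zero_of_norm_one n₂)
      (ne_zero_of_norm_one (norm_latitude two_inv_sqrt_sq n₁ n₂ h (hζ1 i)))]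
    exact latitude_mem_span _ _ _ _ _
  · exact fun i j => (he _ _).mp ((hmem j).1 _ ⟨ζ i, hζ1 i, rfl⟩)
  · exact fun i j => (he _ _).mp ((hmem j).2 _ ⟨ζ i, hζ1 i, rfl⟩)
  · exact fun i j hij => OnLine.map hc hc2 he hdim (hinj ha hb hab n₁ n₃ h13 i j hij)
      (onLine_latitude ha hb hab n₁ n₃ h13 (hζ1 i) (hζ1 j) (hζ.ne hij))
  · exact fun i j hij => OnLine.map hc hc2 he hdim (hinj ha hb hab n₂ n₃ h23 i j hij)
      (onLine_latitude ha hb hab n₂ n₃ h23 (hζ1 i) (hζ1 j) (hζ.ne hij))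

end Orthogonality

/-- The error bound for g x - x halves repeatedly: doubling the argument doubles the error on [0,
1/2], and g (1/2) = 1/2 carries the improved bound to [1/2, 1]. -/
theorem eq_self_of_additive_of_bounded {g : ℝ → ℝ} (h1 : g 1 = 1)
    (hb : ∀ x, 0 ≤ x → x ≤ 1 → |g x - x| ≤ 1)
    (hadd : ∀ x y, 0 ≤ x → 0 ≤ y → x + y ≤ 1 → g (x + y) = g x + g y) {x : ℝ} (hx0 : 0 ≤ x)
    (hx1 : x ≤ 1) : g x = x := by
  have half : g (1 / 2) = 1 / 2 := by
    have := hadd (1 / 2) (1 / 2) (by norm_num) (by norm_num) (by norm_num)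
    rw [add_halves, h1] at this
    linarith
  have small : ∀ (n : ℕ) (x : ℝ), 0 ≤ x → x ≤ 1 → |g x - x| ≤ (1 / 2) ^ n := by
    intro n
    induction n with
    | zero => simpa using hb
    | succ n ih =>
      have low : ∀ x : ℝ, 0 ≤ x → x ≤ 1 / 2 → |g x - x| ≤ (1 / 2) ^ (n + 1) := by
        intro x h0 h2
        have h := ih (x + x) (by linarith) (by linarith)
        rw [hadd x x h0 h0 (by linarith), show g x + g x - (x + x) = 2 * (g x - x) by ring,
          abs_mul, abs_of_pos (two_pos : (0 : ℝ) < 2)] at h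
        rw [pow_succ]
        linarith
      intro x h0 h1
      rcases le_total x (1 / 2) with h2 | h2
      · exact low x h0 h2
      · have h := hadd (x - 1 / 2) (1 / 2) (by linarith) (by norm_num) (by linarith)
        rw [sub_add_cancel, half] at h
        rw [h, show g (x - 1 / 2) + 1 / 2 - x = g (x - 1 / 2) - (x - 1 / 2) by ring]
        exact low _ (by linarith) (by linarith)
  have hlim : Filter.Tendsto (fun n : ℕ => ((1 : ℝ) / 2) ^ n) Filter.atTop (nhds 0) :=
    tendsto_pow_atTop_nhds_zero_of_lt_one (by norm_num) (by norm_num)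
  have := ge_of_tendsto' hlim fun n => small n x hx0 hx1
  exact sub_eq_zero.mp (abs_nonpos_iff.mp this)

/-! ### All overlaps are preserved -/

section OverlapPreserving

variable {H : Type*} [NormedAddCommGroup H] [InnerProductSpace ℂ H]

theorem OnLine.symm {P Q R : ℙ ℂ H} (h : OnLine P Q R) : OnLine Q P R := by
  unfold OnLine at *
  rwa [Set.pair_comm]

variable [Nontrivial H]

theorem ne_of_overlap_eq_zero {P Q : ℙ ℂ H} (h : overlap P Q = 0) : P ≠ Q := by
  rintro rfl
  obtain ⟨p, np, rfl⟩ := exists_ray P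
  rw [overlap_ray np np, inner_self_of_norm_one np, norm_one] at h
  exact one_ne_zero h

theorem overlap_self (P : ℙ ℂ H) : overlap P P = 1 := by
  obtain ⟨p, np, rfl⟩ := exists_ray P
  rw [overlap_ray np np, inner_self_of_norm_one np, norm_one]

theorem OnLine.overlap_sq_add_overlap_sq {N N' P : ℙ ℂ H} (hN : overlap N N' = 0)
    (hP : OnLine N N' P) : overlap N P ^ 2 + overlap N' P ^ 2 = 1 := by
  obtain ⟨n, hn, rfl⟩ := exists_ray N
  obtain ⟨n', hn', rfl⟩ := exists_ray N'
  obtain ⟨p, hp, rfl⟩ := exists_ray P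
  rw [onLine_ray_iff (ne_zero_of_norm_one hn) (ne_zero_of_norm_one hn')
    (ne_zero_of_norm_one hp)] at hP
  rw [overlap_ray hn hn', norm_eq_zero] at hN
  rw [overlap_ray hn hp, overlap_ray hn' hp, ← norm_sq_of_mem_span_orthonormal hn hn' hN hP, hp,
    one_pow]

/-- The projection of W to the line NN' points along N, because W ⊥ N'. -/
theorem OnLine.overlap_eq_mul {N N' P W : ℙ ℂ H} (hN : overlap N N' = 0)
    (hP : OnLine N N' P) (hW : overlap N' W = 0) : overlap P W = overlap N P * overlap N W := by
  obtain ⟨n, hn, rfl⟩ := exists_ray N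
  obtain ⟨n', hn', rfl⟩ := exists_ray N'
  obtain ⟨p, hp, rfl⟩ := exists_ray P
  obtain ⟨w, hw, rfl⟩ := exists_ray W
  rw [onLine_ray_iff (ne_zero_of_norm_one hn) (ne_zero_of_norm_one hn')
    (ne_zero_of_norm_one hp)] at hP
  rw [overlap_ray hn hn', norm_eq_zero] at hN
  rw [overlap_ray hn' hw, norm_eq_zero] at hW
  rw [overlap_ray hn hp, overlap_ray hn hw, overlap_ray hp hw,
    inner_of_mem_span_orthonormal hn hn' hN hP, hW, mul_zero, add_zero, norm_mul, norm_star]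

theorem exists_onLine_overlap_eq {N N' : ℙ ℂ H} (hN : overlap N N' = 0) {a : ℝ} (ha0 : 0 ≤ a)
    (ha1 : a ≤ 1) : ∃ P, OnLine N N' P ∧ overlap N P = a := by
  obtain ⟨n, hn, rfl⟩ := exists_ray N
  obtain ⟨n', hn', rfl⟩ := exists_ray N'
  rw [overlap_ray hn hn', norm_eq_zero] at hN
  have hsq : a ^ 2 + √(1 - a ^ 2) ^ 2 = 1 := by
    rw [Real.sq_sqrt (by nlinarith)]
    ring
  have h1 := norm_latitude hsq hn hn' hN (norm_one (α := ℂ))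
  refine ⟨ray (latitude a √(1 - a ^ 2) n n' 1), ?_, ?_⟩
  · rw [onLine_ray_iff (ne_zero_of_norm_one hn) (ne_zero_of_norm_one hn') (ne_zero_of_norm_one h1)]
    exact latitude_mem_span _ _ _ _ _
  · rw [overlap_ray hn h1, inner_latitude_right, hN, inner_self_of_norm_one hn, mul_zero, add_zero,
      mul_one, Complex.norm_real, Real.norm_of_nonneg ha0]

theorem exists_onLine_overlap_eq_zero {N N' P : ℙ ℂ H} (hN : overlap N N' = 0)
    (hP : OnLine N N' P) : ∃ Q, OnLine N N' Q ∧ overlap P Q = 0 := by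
  obtain ⟨n, hn, rfl⟩ := exists_ray N
  obtain ⟨n', hn', rfl⟩ := exists_ray N'
  obtain ⟨p, hp, rfl⟩ := exists_ray P
  rw [onLine_ray_iff (ne_zero_of_norm_one hn) (ne_zero_of_norm_one hn')
    (ne_zero_of_norm_one hp)] at hP
  obtain ⟨f, hf, hpf, hspan⟩ :=
    exists_orthonormal_basis_of_mem hn hn' (ne_of_overlap_eq_zero hN) hp hP
  refine ⟨ray f, ?_, by rw [overlap_ray hp hf, hpf, norm_zero]⟩
  rw [onLine_ray_iff (ne_zero_of_norm_one hn) (ne_zero_of_norm_one hn') (ne_zero_of_norm_one hf),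
    ← hspan]
  exact Submodule.subset_span (by simp)

theorem exists_overlap_eq_zero
    (hdim : ∀ u v : H, ∃ w : H, ‖w‖ = 1 ∧ inner ℂ u w = 0 ∧ inner ℂ v w = 0) (P Q : ℙ ℂ H) :
    ∃ R, overlap P R = 0 ∧ overlap Q R = 0 := by
  obtain ⟨p, hp, rfl⟩ := exists_ray P
  obtain ⟨q, hq, rfl⟩ := exists_ray Q
  obtain ⟨w, hw, h1, h2⟩ := hdim p q
  exact ⟨ray w, by rw [overlap_ray hp hw, h1, norm_zero], by rw [overlap_ray hq hw, h2, norm_zero]⟩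

/-- A line through two given points carries an orthogonal pair whose second member is orthogonal
to a given point. -/
theorem exists_adapted_pair {P Q : ℙ ℂ H} (hPQ : P ≠ Q) (M : ℙ ℂ H) :
    ∃ N N', overlap N N' = 0 ∧ overlap N' M = 0 ∧ OnLine N N' P ∧ OnLine N N' Q := by
  obtain ⟨p, hp, rfl⟩ := exists_ray P
  obtain ⟨q, hq, rfl⟩ := exists_ray Q
  obtain ⟨m, hm, rfl⟩ := exists_ray M
  obtain ⟨x, hx0, hx, hmx⟩ : ∃ x ≠ 0, x ∈ Submodule.span ℂ {p, q} ∧ inner ℂ m x = 0 := by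
    by_cases h0 : inner ℂ m p = 0
    · exact ⟨p, ne_zero_of_norm_one hp, Submodule.subset_span (by simp), h0⟩
    · refine ⟨inner ℂ m q • p + -inner ℂ m p • q, fun h => h0 ?_,
        Submodule.mem_span_pair.mpr ⟨_, _, rfl⟩, ?_⟩
      · exact neg_eq_zero.mp ((LinearIndependent.pair_iff.mp
          (linearIndependent_of_ray_ne hp hq hPQ)) _ _ h).2
      · rw [inner_add_right, inner_smul_right, inner_smul_right]
        ring
  obtain ⟨u, hu, hxu⟩ := exists_normalization hx0
  have hxn : (‖x‖ : ℂ) ≠ 0 := by exact_mod_cast norm_ne_zero_iff.mpr hx0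
  rw [hxu, Submodule.smul_mem_iff _ hxn] at hx
  rw [hxu, inner_smul_right, mul_eq_zero_iff_left hxn] at hmx
  obtain ⟨f, hf, huf, hspan⟩ := exists_orthonormal_basis_of_mem hp hq hPQ hu hx
  have key : ∀ y : H, ‖y‖ = 1 → y ∈ ({p, q} : Set H) → OnLine (ray f) (ray u) (ray y) := by
    intro y hy hmem
    rw [onLine_ray_iff (ne_zero_of_norm_one hf) (ne_zero_of_norm_one hu) (ne_zero_of_norm_one hy),
      Set.pair_comm, hspan]
    exact Submodule.subset_span hmem
  refine ⟨ray f, ray u, ?_, ?_, key p hp (by simp), key q hq (by simp)⟩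
  · rw [overlap_comm, overlap_ray hu hf, huf, norm_zero]
  · rw [overlap_comm, overlap_ray hm hu, hmx, norm_zero]

variable {c : ℝ} {e : ℙ ℂ H ≃ ℙ ℂ H}

/-- A point W orthogonal to N' with overlap c / overlap N P to N has overlap c with both P and Q.
The product rule for the images then gives two equal products with the same nonzero factor. -/
theorem overlap_map_eq_of_onLine_of_le (hc : 0 < c) (hc2 : 2 * c ^ 2 < 1)
    (he : ∀ p q, overlap p q = c ↔ overlap (e p) (e q) = c)
    (hdim : ∀ u v : H, ∃ w : H, ‖w‖ = 1 ∧ inner ℂ u w = 0 ∧ inner ℂ v w = 0)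
    {N N' P Q : ℙ ℂ H} (hN : overlap N N' = 0) (hP : OnLine N N' P) (hQ : OnLine N N' Q)
    (h : overlap N P = overlap N Q) (hle : c ≤ overlap N P) :
    overlap (e N) (e P) = overlap (e N) (e Q) := by
  have h0 : overlap N P ≠ 0 := (hc.trans_le hle).ne'
  obtain ⟨R, hR, hR'⟩ := exists_overlap_eq_zero hdim N N'
  obtain ⟨W, hW, hNW⟩ := exists_onLine_overlap_eq hR (a := c / overlap N P)
    (div_nonneg hc.le (overlap_nonneg _ _)) (div_le_one_of_le₀ hle (overlap_nonneg _ _))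
  have hN'W : overlap N' W = 0 := by
    rw [overlap_comm, hW.overlap_eq_mul hR (by rw [overlap_comm, hR']), hN, mul_zero]
  have hNe := overlap_map_eq_zero hc hc2 he hdim hN
  have hWe := overlap_map_eq_zero hc hc2 he hdim hN'W
  have hline : ∀ {X}, OnLine N N' X → overlap N X = overlap N P →
      c = overlap (e N) (e X) * overlap (e N) (e W) := by
    intro X hX hXP
    rw [← (hX.map hc hc2 he hdim (ne_of_overlap_eq_zero hN)).overlap_eq_mul hNe hWe]
    refine ((he _ _).mp ?_).symm
    rw [hX.overlap_eq_mul hN hN'W, hNW, hXP, mul_div_cancel₀ _ h0]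
  have e1 := hline hP rfl
  have e2 := hline hQ h.symm
  refine mul_right_cancel₀ (b := overlap (e N) (e W)) (fun h0 => ?_) (e1.symm.trans e2)
  rw [h0, mul_zero] at e1
  exact hc.ne' e1

/-- The squared overlaps with N and N' add up to 1 > 2c², so at least one overlap is no smaller than
c; Pythagoras transfers equality between N and N'. -/
theorem overlap_map_eq_of_onLine (hc : 0 < c) (hc2 : 2 * c ^ 2 < 1)
    (he : ∀ p q, overlap p q = c ↔ overlap (e p) (e q) = c)
    (hdim : ∀ u v : H, ∃ w : H, ‖w‖ = 1 ∧ inner ℂ u w = 0 ∧ inner ℂ v w = 0)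
    {N N' P Q : ℙ ℂ H} (hN : overlap N N' = 0) (hP : OnLine N N' P) (hQ : OnLine N N' Q)
    (h : overlap N P = overlap N Q) : overlap (e N) (e P) = overlap (e N) (e Q) := by
  rcases le_total c (overlap N P) with hle | hle
  · exact overlap_map_eq_of_onLine_of_le hc hc2 he hdim hN hP hQ h hle
  · have s1 := hP.overlap_sq_add_overlap_sq hN
    have s2 := hQ.overlap_sq_add_overlap_sq hN
    have hn0 := overlap_nonneg N P
    have hle' : c ≤ overlap N' P := by
      refine (pow_le_pow_iff_left₀ hc.le (overlap_nonneg _ _) two_ne_zero).mp ?_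
      have := pow_le_pow_left₀ hn0 hle 2
      linarith
    have h' : overlap N' P = overlap N' Q := by
      refine (pow_left_inj₀ (overlap_nonneg _ _) (overlap_nonneg _ _) two_ne_zero).mp ?_
      rw [h] at s1
      linarith
    have hN' : overlap N' N = 0 := by rw [overlap_comm, hN]
    have key := overlap_map_eq_of_onLine_of_le hc hc2 he hdim hN' hP.symm hQ.symm h' hle'
    have hNe := overlap_map_eq_zero hc hc2 he hdim hN
    have t1 := (hP.map hc hc2 he hdim (ne_of_overlap_eq_zero hN)).overlap_sq_add_overlap_sq hNe
    have t2 := (hQ.map hc hc2 he hdim (ne_of_overlap_eq_zero hN)).overlap_sq_add_overlap_sq hNe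
    refine (pow_left_inj₀ (overlap_nonneg _ _) (overlap_nonneg _ _) two_ne_zero).mp ?_
    rw [key] at t1
    linarith

/-- On the line PQ choose N' orthogonal to M. The product rule reduces overlaps with M to overlaps
with N. -/
theorem overlap_map_eq_of_overlap_eq (hc : 0 < c) (hc2 : 2 * c ^ 2 < 1)
    (he : ∀ p q, overlap p q = c ↔ overlap (e p) (e q) = c)
    (hdim : ∀ u v : H, ∃ w : H, ‖w‖ = 1 ∧ inner ℂ u w = 0 ∧ inner ℂ v w = 0)
    {M P Q : ℙ ℂ H} (h : overlap M P = overlap M Q) :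
    overlap (e M) (e P) = overlap (e M) (e Q) := by
  by_cases hPQ : P = Q
  · rw [hPQ]
  by_cases h0 : overlap M P = 0
  · rw [overlap_map_eq_zero hc hc2 he hdim h0, overlap_map_eq_zero hc hc2 he hdim (h ▸ h0)]
  obtain ⟨N, N', hN, hM, hP, hQ⟩ := exists_adapted_pair hPQ M
  have hNP : overlap N P = overlap N Q := by
    rw [overlap_comm M P, hP.overlap_eq_mul hN hM] at h h0
    rw [overlap_comm M Q, hQ.overlap_eq_mul hN hM] at h
    exact mul_right_cancel₀ (right_ne_zero_of_mul h0) h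
  have hNe := overlap_map_eq_zero hc hc2 he hdim hN
  have hMe := overlap_map_eq_zero hc hc2 he hdim hM
  have hne := ne_of_overlap_eq_zero hN
  rw [overlap_comm, (hP.map hc hc2 he hdim hne).overlap_eq_mul hNe hMe,
    overlap_map_eq_of_onLine hc hc2 he hdim hN hP hQ hNP, overlap_comm (e M),
    (hQ.map hc hc2 he hdim hne).overlap_eq_mul hNe hMe]

/-- Equal overlaps having equal images, the squared overlap transforms by a function g on [0, 1].
Splitting a point along an orthogonal pair makes g additive. -/
theorem overlap_map (hc : 0 < c) (hc2 : 2 * c ^ 2 < 1)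
    (he : ∀ p q, overlap p q = c ↔ overlap (e p) (e q) = c)
    (hdim : ∀ u v : H, ∃ w : H, ‖w‖ = 1 ∧ inner ℂ u w = 0 ∧ inner ℂ v w = 0)
    (P Q : ℙ ℂ H) : overlap (e P) (e Q) = overlap P Q := by
  -- `X s` is a point at squared overlap s from P; outside [0, 1] its value is irrelevant.
  have hex : ∀ s : ℝ, ∃ X, 0 ≤ s → s ≤ 1 → overlap P X ^ 2 = s := by
    intro s
    by_cases hs : 0 ≤ s ∧ s ≤ 1
    · obtain ⟨P', hP', -⟩ := exists_overlap_eq_zero hdim P P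
      obtain ⟨X, -, hX⟩ := exists_onLine_overlap_eq hP' (Real.sqrt_nonneg s)
        (Real.sqrt_le_one.mpr hs.2)
      exact ⟨X, fun _ _ => by rw [hX, Real.sq_sqrt hs.1]⟩
    · exact ⟨P, fun h0 h1 => (hs ⟨h0, h1⟩).elim⟩
  choose X hX using hex
  have hg : ∀ R, overlap (e P) (e (X (overlap P R ^ 2))) ^ 2 = overlap (e P) (e R) ^ 2 := by
    intro R
    congr 1
    refine overlap_map_eq_of_overlap_eq hc hc2 he hdim ?_
    exact (pow_left_inj₀ (overlap_nonneg _ _) (overlap_nonneg _ _) two_ne_zero).mp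
      (hX _ (by positivity) (pow_le_one₀ (overlap_nonneg _ _) (overlap_le_one _ _)))
  have hz : ∀ {A B : ℙ ℂ H}, overlap A B = 0 → overlap (e A) (e B) = 0 := fun h =>
    overlap_map_eq_zero hc hc2 he hdim h
  refine (pow_left_inj₀ (overlap_nonneg _ _) (overlap_nonneg _ _) two_ne_zero).mp ?_
  rw [← hg]
  refine eq_self_of_additive_of_bounded (g := fun s => overlap (e P) (e (X s)) ^ 2) ?_ ?_ ?_
    (by positivity) (pow_le_one₀ (overlap_nonneg _ _) (overlap_le_one _ _))
  · have := hg P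
    rwa [overlap_self, overlap_self, one_pow] at this
  · intro s h0 h1
    have := pow_le_one₀ (n := 2) (overlap_nonneg (e P) (e (X s))) (overlap_le_one _ _)
    have := sq_nonneg (overlap (e P) (e (X s)))
    rw [abs_le]
    constructor <;> linarith
  · intro x y hx hy hxy
    by_cases hs : x + y = 0
    · obtain rfl : x = 0 := by linarith
      obtain rfl : y = 0 := by linarith
      have h0 : overlap P (X 0) = 0 := pow_eq_zero_iff two_ne_zero |>.mp (hX 0 le_rfl zero_le_one)
      simp [hz h0]
    have hs0 : 0 < x + y := lt_of_le_of_ne (by linarith) (Ne.symm hs)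
    set Y := X (x + y) with hY
    have hPY : overlap P Y ^ 2 = x + y := hX _ hs0.le hxy
    -- With Y' ⊥ P, the product rule divides the squared overlap x + y of P and Y into x at N and y
    -- at N'. The same identities hold for the images.
    obtain ⟨Y', hYY', hPY'⟩ := exists_overlap_eq_zero hdim Y P
    rw [overlap_comm] at hPY'
    obtain ⟨N, hN, hYN⟩ := exists_onLine_overlap_eq hYY' (Real.sqrt_nonneg (x / (x + y)))
      (Real.sqrt_le_one.mpr (div_le_one_of_le₀ (by linarith) hs0.le))
    obtain ⟨N', hN', hNN'⟩ := exists_onLine_overlap_eq_zero hYY' hN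
    have hl : OnLine N N' Y := hN.exchange hN' (onLine_left _ _) (ne_of_overlap_eq_zero hNN')
    have hne := ne_of_overlap_eq_zero hYY'
    have i1 := (hl.map hc hc2 he hdim (ne_of_overlap_eq_zero hNN')).overlap_sq_add_overlap_sq
      (hz hNN')
    have i2 := (hN.map hc hc2 he hdim hne).overlap_eq_mul (hz hYY') (hz hPY')
    have i3 := (hN'.map hc hc2 he hdim hne).overlap_eq_mul (hz hYY') (hz hPY')
    have j1 := hl.overlap_sq_add_overlap_sq hNN'
    have j2 := hN.overlap_eq_mul hYY' hPY'
    have j3 := hN'.overlap_eq_mul hYY' hPY'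
    have hNx : overlap P N ^ 2 = x := by
      rw [overlap_comm, j2, mul_pow, hYN, Real.sq_sqrt (div_nonneg hx hs0.le), overlap_comm Y P,
        hPY, div_mul_cancel₀ _ hs]
    have hNy : overlap P N' ^ 2 = y := by
      rw [overlap_comm, j3, mul_pow, overlap_comm Y P, hPY, overlap_comm Y N']
      rw [overlap_comm N Y, hYN, Real.sq_sqrt (div_nonneg hx hs0.le)] at j1
      rw [eq_sub_iff_add_eq'.mpr j1]
      field_simp
      ring
    have gx := hg N
    have gy := hg N'
    rw [hNx] at gx
    rw [hNy] at gy
    change overlap (e P) (e Y) ^ 2 = _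
    rw [gx, gy, overlap_comm (e P) (e N), overlap_comm (e P) (e N'), i2, i3, overlap_comm (e P),
      overlap_comm (e Y) (e N), overlap_comm (e Y) (e N')]
    linear_combination -(overlap (e Y) (e P)) ^ 2 * i1

end OverlapPreserving

/-! ### Real-linear maps and semilinear lifts -/

section Wigner

variable {H : Type*} [NormedAddCommGroup H] [InnerProductSpace ℂ H]

/-- The difference d is itself a real combination of `V x`, `V y`, `V z`, so ⟪d, d⟫ has real part
zero. -/
theorem eq_zero_of_forall_re_inner_eq_zero {S : Set H} {V : H → H} {x y z : H} {a b : ℝ}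
    (hx : x ∈ S) (hy : y ∈ S) (hz : z ∈ S)
    (h : ∀ u ∈ S, (inner ℂ (V u) (V x - ((a : ℂ) • V y + (b : ℂ) • V z))).re = 0) :
    V x = (a : ℂ) • V y + (b : ℂ) • V z := by
  rw [← sub_eq_zero, ← inner_self_eq_zero (𝕜 := ℂ)]
  set d := V x - ((a : ℂ) • V y + (b : ℂ) • V z) with hd
  apply Complex.ext
  · have : inner ℂ d d = inner ℂ (V x) d - (a * inner ℂ (V y) d + b * inner ℂ (V z) d) := by
      conv_lhs => rw [hd]
      rw [← hd, inner_sub_left, inner_add_left, inner_smul_left, inner_smul_left,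
        Complex.conj_ofReal, Complex.conj_ofReal]
    rw [this, Complex.sub_re, Complex.add_re, Complex.re_ofReal_mul, Complex.re_ofReal_mul, h x hx,
      h y hy, h z hz]
    simp
  · exact inner_self_im (𝕜 := ℂ) d

/-- A map preserving real parts of inner products on a real subspace is real-linear there. -/
theorem map_real_combination {S : Set H} {V : H → H}
    (hV : ∀ u ∈ S, ∀ v ∈ S, (inner ℂ (V u) (V v)).re = (inner ℂ u v).re) {y z : H} (a b : ℝ)
    (hy : y ∈ S) (hz : z ∈ S) (hx : (a : ℂ) • y + (b : ℂ) • z ∈ S) :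
    V ((a : ℂ) • y + (b : ℂ) • z) = (a : ℂ) • V y + (b : ℂ) • V z := by
  refine eq_zero_of_forall_re_inner_eq_zero hx hy hz fun u hu => ?_
  rw [inner_sub_right, inner_add_right, inner_smul_right, inner_smul_right, Complex.sub_re,
    Complex.add_re, Complex.re_ofReal_mul, Complex.re_ofReal_mul, hV u hu _ hx, hV u hu _ hy,
    hV u hu _ hz, inner_add_right, inner_smul_right, inner_smul_right, Complex.add_re,
    Complex.re_ofReal_mul, Complex.re_ofReal_mul, sub_self]

/-- Equality in Cauchy–Schwarz makes the image of I • z a multiple r • V z; preservation of real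
parts and norms leaves r = ±I. -/
theorem map_I_smul_eq_or {S : Submodule ℂ H} {V : H → H}
    (hV : ∀ u ∈ S, ∀ v ∈ S, (inner ℂ (V u) (V v)).re = (inner ℂ u v).re)
    (hVn : ∀ u ∈ S, ∀ v ∈ S, ‖inner ℂ (V u) (V v)‖ = ‖inner ℂ u v‖) {z : H} (hz : z ∈ S) :
    V (Complex.I • z) = Complex.I • V z ∨ V (Complex.I • z) = -Complex.I • V z := by
  have hn : ∀ u ∈ S, ‖V u‖ = ‖u‖ := by
    intro u hu
    have := hVn u hu u hu
    rw [inner_self_eq_norm_sq_to_K, inner_self_eq_norm_sq_to_K, norm_pow, norm_pow] at this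
    simpa using this
  have hIz := S.smul_mem Complex.I hz
  have hnI : ‖V (Complex.I • z)‖ = ‖V z‖ := by
    rw [hn _ hIz, hn _ hz, norm_smul, Complex.norm_I, one_mul]
  by_cases h0 : V z = 0
  · left
    rw [h0, norm_zero, norm_eq_zero] at hnI
    rw [h0, hnI, smul_zero]
  have h0' : V (Complex.I • z) ≠ 0 := by rwa [← norm_ne_zero_iff, hnI, norm_ne_zero_iff]
  obtain ⟨r, -, hr⟩ := (norm_inner_eq_norm_iff (𝕜 := ℂ) h0 h0').mp (by
    rw [hVn _ hz _ hIz, hnI, hn _ hz, inner_smul_right, norm_mul, Complex.norm_I, one_mul,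
      inner_self_eq_norm_sq_to_K, norm_pow]
    simp [sq])
  have hre := hV _ hz _ hIz
  rw [hr, inner_smul_right, inner_smul_right, inner_self_eq_norm_sq_to_K,
    inner_self_eq_norm_sq_to_K] at hre
  have hpow : ∀ t : ℝ, ((t : ℂ) ^ 2).im = 0 := fun t => by rw [← Complex.ofReal_pow, Complex.ofReal_im]
  have hz0 : ‖V z‖ ≠ 0 := norm_ne_zero_iff.mpr h0
  have hre0 : r.re = 0 := by
    have : r.re * ‖V z‖ ^ 2 = 0 := by
      rw [← Complex.re_mul_ofReal, Complex.ofReal_pow]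
      simpa [hpow] using hre
    exact (mul_eq_zero.mp this).resolve_right (pow_ne_zero 2 hz0)
  have hr1 : ‖r‖ = 1 := by
    rw [hr, norm_smul] at hnI
    exact mul_right_cancel₀ hz0 (by rw [hnI, one_mul])
  have him : r.im = 1 ∨ r.im = -1 := by
    have := Complex.sq_norm r
    rw [hr1, Complex.normSq_apply, hre0] at this
    exact mul_self_eq_one_iff.mp (by linarith)
  rw [hr]
  rcases him with him | him
  · left
    rw [show r = Complex.I from Complex.ext (by simpa using hre0) (by simpa using him)]
  · right
    rw [show r = -Complex.I from Complex.ext (by simpa using hre0) (by simpa using him)]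

/-- If z and w had opposite signs, either sign for z + w would force V z or V w to vanish, and then
that vector satisfies both rules. -/
theorem map_I_smul_uniform {S : Submodule ℂ H} {V : H → H}
    (hV : ∀ u ∈ S, ∀ v ∈ S, (inner ℂ (V u) (V v)).re = (inner ℂ u v).re)
    (hVn : ∀ u ∈ S, ∀ v ∈ S, ‖inner ℂ (V u) (V v)‖ = ‖inner ℂ u v‖) :
    (∀ z ∈ S, V (Complex.I • z) = Complex.I • V z) ∨
      ∀ z ∈ S, V (Complex.I • z) = -Complex.I • V z := by
  by_contra! hcon
  obtain ⟨⟨z, hz, hzI⟩, w, hw, hwI⟩ := hcon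
  have hz' := (map_I_smul_eq_or hV hVn hz).resolve_left hzI
  have hw' := (map_I_smul_eq_or hV hVn hw).resolve_right hwI
  have hadd : ∀ x ∈ S, ∀ y ∈ S, V (x + y) = V x + V y := by
    intro x hx y hy
    have := map_real_combination (S := (S : Set H)) hV 1 1 hx hy (by simpa using S.add_mem hx hy)
    simpa using this
  have hs := map_I_smul_eq_or hV hVn (S.add_mem hz hw)
  rw [smul_add, hadd _ (S.smul_mem _ hz) _ (S.smul_mem _ hw), hadd _ hz _ hw, hz', hw'] at hs
  have h2I : (2 * Complex.I) ≠ 0 := by simp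
  rcases hs with hs | hs
  · have h0 : (2 * Complex.I) • V z = 0 := by
      calc (2 * Complex.I) • V z = Complex.I • (V z + V w) - (-Complex.I • V z + Complex.I • V w) := by
            module
        _ = 0 := by rw [hs, sub_self]
    have := (smul_eq_zero.mp h0).resolve_left h2I
    rw [this, smul_zero] at hz' hzI
    exact hzI hz'
  · have h0 : (2 * Complex.I) • V w = 0 := by
      calc (2 * Complex.I) • V w =
            (-Complex.I • V z + Complex.I • V w) - -Complex.I • (V z + V w) := by module
        _ = 0 := by rw [hs, sub_self]
    have := (smul_eq_zero.mp h0).resolve_left h2I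
    rw [this, smul_zero] at hw' hwI
    exact hwI hw'

theorem map_smul_of_map_I_smul {S : Submodule ℂ H} {V : H → H}
    (hV : ∀ u ∈ S, ∀ v ∈ S, (inner ℂ (V u) (V v)).re = (inner ℂ u v).re) {ι : ℂ}
    (hI : ∀ z ∈ S, V (Complex.I • z) = ι • V z) (t : ℂ) {z : H} (hz : z ∈ S) :
    V (t • z) = ((t.re : ℂ) + t.im * ι) • V z := by
  have hIz : Complex.I • z ∈ (S : Set H) := S.smul_mem _ hz
  have h := map_real_combination (S := (S : Set H)) hV t.re t.im (y := z) hz hIz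
  rw [hI z hz, smul_smul, smul_smul, ← add_smul, ← add_smul, Complex.re_add_im] at h
  exact h (S.smul_mem _ hz)

variable [Nontrivial H]

theorem overlap_ray_mul {u v : H} (hu : u ≠ 0) (hv : v ≠ 0) :
    overlap (ray u) (ray v) * (‖u‖ * ‖v‖) = ‖inner ℂ u v‖ := by
  obtain ⟨x, hx, hux⟩ := exists_normalization hu
  obtain ⟨y, hy, hvy⟩ := exists_normalization hv
  have hu' : (‖u‖ : ℂ) ≠ 0 := by exact_mod_cast norm_ne_zero_iff.mpr hu
  have hv' : (‖v‖ : ℂ) ≠ 0 := by exact_mod_cast norm_ne_zero_iff.mpr hv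
  have e1 : ray u = ray x := by rw [hux, ray_smul (by simpa using hu') (ne_zero_of_norm_one hx)]
  have e2 : ray v = ray y := by rw [hvy, ray_smul (by simpa using hv') (ne_zero_of_norm_one hy)]
  have e3 : inner ℂ u v = ‖u‖ * (‖v‖ * inner ℂ x y) := by
    conv_lhs => rw [hux, hvy]
    rw [inner_smul_left, inner_smul_right, Complex.conj_ofReal]
  rw [e1, e2, overlap_ray hx hy, e3, norm_mul, norm_mul, Complex.norm_real, Complex.norm_real,
    norm_norm, norm_norm]
  ring

/-- Lifting to a semilinear isometry from its values on the complement of a unit vector. -/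
theorem exists_semilinear_lift {σ : ℂ →+* ℂ} [RingHomInvPair σ σ] (hσ : ∀ z, ‖σ z‖ = ‖z‖)
    {φ : ℙ ℂ H → ℙ ℂ H} (hφ : Function.Surjective φ) {e₀ e₀' : H} (he₀ : ‖e₀‖ = 1)
    (he₀' : ‖e₀'‖ = 1) {V : H → H} (hadd : ∀ x ∈ (ℂ ∙ e₀)ᗮ, ∀ y ∈ (ℂ ∙ e₀)ᗮ, V (x + y) = V x + V y)
    (hsmul : ∀ t : ℂ, ∀ x ∈ (ℂ ∙ e₀)ᗮ, V (t • x) = σ t • V x)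
    (hnorm : ∀ x ∈ (ℂ ∙ e₀)ᗮ, ‖V x‖ = ‖x‖) (horth : ∀ x ∈ (ℂ ∙ e₀)ᗮ, inner ℂ e₀' (V x) = 0)
    (h₁ : ∀ x ∈ (ℂ ∙ e₀)ᗮ, φ (ray (e₀ + x)) = ray (e₀' + V x))
    (h₂ : ∀ x ∈ (ℂ ∙ e₀)ᗮ, x ≠ 0 → φ (ray x) = ray (V x)) :
    ∃ U : H ≃ₛₗᵢ[σ] H, ∀ v, v ≠ 0 → φ (ray v) = ray (U v) := by
  let P : H → H := fun x => x - inner ℂ e₀ x • e₀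
  have hP : ∀ x, P x ∈ (ℂ ∙ e₀)ᗮ := by
    intro x
    rw [Submodule.mem_orthogonal_singleton_iff_inner_right, inner_sub_right, inner_smul_right,
      inner_self_of_norm_one he₀, mul_one, sub_self]
  have hPx : ∀ x, x = inner ℂ e₀ x • e₀ + P x := fun x => (add_sub_cancel _ _).symm
  have hnsq : ∀ (t : ℂ) {f y : H}, ‖f‖ = 1 → inner ℂ f y = 0 → ‖t • f + y‖ ^ 2 = ‖t‖ ^ 2 + ‖y‖ ^ 2 := by
    intro t f y hf hfy
    have := norm_add_sq_eq_norm_sq_add_norm_sq_of_inner_eq_zero (𝕜 := ℂ) (t • f) y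
      (by rw [inner_smul_left, hfy, mul_zero])
    rw [norm_smul, hf, mul_one] at this
    simpa [sq] using this
  let T : H →ₛₗ[σ] H :=
    { toFun := fun x => σ (inner ℂ e₀ x) • e₀' + V (P x)
      map_add' := by
        intro x y
        have : P (x + y) = P x + P y := by
          simp only [P, inner_add_right, add_smul]
          abel
        rw [this, hadd _ (hP x) _ (hP y), inner_add_right, map_add, add_smul]
        abel
      map_smul' := by
        intro t x
        have : P (t • x) = t • P x := by
          simp only [P, inner_smul_right, smul_sub, smul_smul]
        rw [this, hsmul _ _ (hP x), inner_smul_right, map_mul, smul_add, smul_smul] }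
  have hT : ∀ x, T x = σ (inner ℂ e₀ x) • e₀' + V (P x) := fun _ => rfl
  have hTn : ∀ x, ‖T x‖ = ‖x‖ := by
    intro x
    refine (pow_left_inj₀ (norm_nonneg _) (norm_nonneg _) two_ne_zero).mp ?_
    rw [hT, hnsq _ he₀' (horth _ (hP x)), hσ, hnorm _ (hP x)]
    conv_rhs => rw [hPx x, hnsq _ he₀
      ((Submodule.mem_orthogonal_singleton_iff_inner_right).mp (hP x))]
  have hT0 : ∀ x, x ≠ 0 → T x ≠ 0 := fun x hx h => by
    have := hTn x
    rw [h, norm_zero] at this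
    exact hx (norm_eq_zero.mp this.symm)
  have hray : ∀ v, v ≠ 0 → φ (ray v) = ray (T v) := by
    intro v hv
    by_cases h0 : inner ℂ e₀ v = 0
    · have hPv : P v = v := by simp only [P, h0, zero_smul, sub_zero]
      rw [hT, h0, map_zero, zero_smul, zero_add, hPv]
      exact h₂ v (hPv ▸ hP v) hv
    · have hs : σ (inner ℂ e₀ v) ≠ 0 := (map_ne_zero σ).mpr h0
      have hv' : inner ℂ e₀ v • (e₀ + (inner ℂ e₀ v)⁻¹ • P v) = v := by
        rw [smul_add, smul_inv_smul₀ h0, ← hPx v]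
      have hTv : σ (inner ℂ e₀ v) • (e₀' + V ((inner ℂ e₀ v)⁻¹ • P v)) = T v := by
        rw [hsmul _ _ (hP v), map_inv₀, smul_add, smul_inv_smul₀ hs, ← hT]
      rw [← hv', ray_smul h0 (right_ne_zero_of_smul (hv' ▸ hv)), h₁ _ (Submodule.smul_mem _ _ (hP v)),
        hv', ← hTv, ray_smul hs (right_ne_zero_of_smul (hTv ▸ hT0 v hv))]
  have hsurj : Function.Surjective T := by
    intro y
    by_cases hy : y = 0
    · exact ⟨0, by rw [hy, map_zero]⟩
    obtain ⟨p, hp⟩ := hφ (ray y)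
    obtain ⟨x, hx, rfl⟩ := exists_ray p
    have hx0 := ne_zero_of_norm_one hx
    rw [hray x hx0, eq_comm, ray_eq_ray_iff hy (hT0 x hx0)] at hp
    obtain ⟨t, ht⟩ := hp
    exact ⟨σ t • x, by rw [map_smulₛₗ, RingHomInvPair.comp_apply_eq, ht]⟩
  exact ⟨LinearIsometryEquiv.ofSurjective ⟨T, hTn⟩ hsurj, hray⟩

end Wigner

/-! ### Wigner's theorem -/

section WignerTheorem

variable {H : Type*} [NormedAddCommGroup H] [InnerProductSpace ℂ H]

theorem unit_add_ne_zero {f x : H} (hf : ‖f‖ = 1) (hfx : inner ℂ f x = 0) : f + x ≠ 0 := by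
  intro h
  have : inner ℂ f (f + x) = 0 := by rw [h, inner_zero_right]
  rw [inner_add_right, inner_self_of_norm_one hf, hfx, add_zero] at this
  exact one_ne_zero this

theorem norm_sq_unit_add {f x : H} (hf : ‖f‖ = 1) (hfx : inner ℂ f x = 0) :
    ‖f + x‖ ^ 2 = 1 + ‖x‖ ^ 2 := by
  have := norm_add_sq_eq_norm_sq_add_norm_sq_of_inner_eq_zero (𝕜 := ℂ) f x hfx
  rw [hf] at this
  simpa [sq] using this

theorem inner_unit_add {f x y : H} (hf : ‖f‖ = 1) (hfx : inner ℂ f x = 0) (hfy : inner ℂ f y = 0) :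
    inner ℂ (f + x) (f + y) = 1 + inner ℂ x y := by
  rw [inner_add_left, inner_add_right, inner_add_right, inner_self_of_norm_one hf, hfy,
    inner_eq_zero_comm' hfx, add_zero, zero_add]

variable [Nontrivial H]

/-- Points not orthogonal to a given one have an affine coordinate. -/
theorem exists_affine_coordinate {f : H} (hf : ‖f‖ = 1) {p : ℙ ℂ H} (hp : overlap (ray f) p ≠ 0) :
    ∃ y, inner ℂ f y = 0 ∧ p = ray (f + y) := by
  obtain ⟨x, hx, rfl⟩ := exists_ray p
  rw [overlap_ray hf hx, norm_ne_zero_iff] at hp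
  refine ⟨(inner ℂ f x)⁻¹ • x - f, ?_, ?_⟩
  · rw [inner_sub_right, inner_smul_right, inv_mul_cancel₀ hp, inner_self_of_norm_one hf, sub_self]
  · rw [add_sub_cancel, ray_smul (inv_ne_zero hp) (ne_zero_of_norm_one hx)]

theorem overlap_ray_unit_add {f x : H} (hf : ‖f‖ = 1) (hfx : inner ℂ f x = 0) :
    overlap (ray f) (ray (f + x)) * ‖f + x‖ = 1 := by
  have := overlap_ray_mul (ne_zero_of_norm_one hf) (unit_add_ne_zero hf hfx)
  rwa [hf, one_mul, inner_add_right, inner_self_of_norm_one hf, hfx, add_zero, norm_one] at this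

/-- Normalising by a fixed unit vector removes the phase ambiguity: in the affine charts e₀ + x and
e₀' + y the map becomes a function V on the hyperplane. It preserves both moduli and real parts of
inner products, so it is complex linear or conjugate linear. -/
theorem wigner {φ : ℙ ℂ H → ℙ ℂ H} (hφ : Function.Surjective φ)
    (h : ∀ p q, overlap (φ p) (φ q) = overlap p q) :
    (∃ U : H ≃ₗᵢ[ℂ] H, ∀ v, v ≠ 0 → φ (ray v) = ray (U v)) ∨
      ∃ U : H ≃ₛₗᵢ[starRingEnd ℂ] H, ∀ v, v ≠ 0 → φ (ray v) = ray (U v) := by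
  obtain ⟨x₀, hx₀⟩ := exists_ne (0 : H)
  obtain ⟨e₀, he₀, -⟩ := exists_normalization hx₀
  obtain ⟨e₀', he₀', hee⟩ := exists_ray (φ (ray e₀))
  have hex : ∀ x, ∃ y, inner ℂ e₀ x = 0 → inner ℂ e₀' y = 0 ∧ φ (ray (e₀ + x)) = ray (e₀' + y) := by
    intro x
    by_cases hx : inner ℂ e₀ x = 0
    · have h1 := overlap_ray_unit_add he₀ hx
      obtain ⟨y, hy⟩ := exists_affine_coordinate he₀' (p := φ (ray (e₀ + x)))
        (by rw [hee, h]; exact left_ne_zero_of_mul (h1 ▸ one_ne_zero))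
      exact ⟨y, fun _ => hy⟩
    · exact ⟨0, fun h0 => (hx h0).elim⟩
  choose V hV using hex
  have hadd : ∀ x, inner ℂ e₀ x = 0 → ‖e₀' + V x‖ = ‖e₀ + x‖ := by
    intro x hx
    have h1 := overlap_ray_unit_add he₀ hx
    have h2 := overlap_ray_unit_add he₀' (hV x hx).1
    rw [← (hV x hx).2, hee, h] at h2
    exact mul_left_cancel₀ (left_ne_zero_of_mul (h1 ▸ one_ne_zero)) (h2.trans h1.symm)
  have hnorm : ∀ x, inner ℂ e₀ x = 0 → ‖V x‖ = ‖x‖ := by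
    intro x hx
    have h1 := norm_sq_unit_add he₀' (hV x hx).1
    rw [hadd x hx, norm_sq_unit_add he₀ hx] at h1
    exact (pow_left_inj₀ (norm_nonneg _) (norm_nonneg _) two_ne_zero).mp (add_left_cancel h1).symm
  have hV0 : ∀ x, inner ℂ e₀ x = 0 → x ≠ 0 → V x ≠ 0 := fun x hx h0 => by
    rwa [← norm_ne_zero_iff, hnorm x hx, norm_ne_zero_iff]
  have hray : ∀ x, inner ℂ e₀ x = 0 → x ≠ 0 → φ (ray x) = ray (V x) := by
    intro x hx h0
    obtain ⟨u, hu, hue⟩ := exists_ray (φ (ray x))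
    have hu0 := ne_zero_of_norm_one hu
    have ho : inner ℂ u e₀' = 0 := by
      have h1 := overlap_ray_mul h0 (ne_zero_of_norm_one he₀)
      rw [inner_eq_zero_comm' hx, norm_zero, ← h, ← hue, ← hee, overlap_ray hu he₀'] at h1
      rw [he₀, mul_one, mul_eq_zero, norm_eq_zero, norm_eq_zero] at h1
      exact h1.resolve_right h0
    have h1 := overlap_ray_mul h0 (unit_add_ne_zero he₀ hx)
    have h2 := overlap_ray_mul hu0 (unit_add_ne_zero he₀' (hV x hx).1)
    rw [hue, ← (hV x hx).2, h, hu, one_mul, hadd x hx, inner_add_right, ho, zero_add] at h2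
    rw [inner_add_right, inner_eq_zero_comm' hx, zero_add, inner_self_eq_norm_sq_to_K] at h1
    -- The overlap of x with e₀ + x forces equality in Cauchy–Schwarz for u and `V x`, so they span
    -- the same ray.
    have h3 : ‖inner ℂ u (V x)‖ = ‖u‖ * ‖V x‖ := by
      rw [← h2, hu, one_mul, hnorm x hx]
      refine mul_left_cancel₀ (norm_ne_zero_iff.mpr h0) ?_
      rw [norm_pow] at h1
      simp only [Complex.coe_algebraMap, Complex.norm_real, norm_norm] at h1
      linarith
    obtain ⟨r, hr, hrV⟩ := (norm_inner_eq_norm_iff (𝕜 := ℂ) hu0 (hV0 x hx h0)).mp h3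
    rw [← hue, hrV, ray_smul hr hu0]
  have hnI : ∀ x, inner ℂ e₀ x = 0 → ∀ y, inner ℂ e₀ y = 0 →
      ‖inner ℂ (V x) (V y)‖ = ‖inner ℂ x y‖ := by
    intro x hx y hy
    by_cases hx0 : x = 0
    · have := hnorm x hx
      rw [hx0, norm_zero, norm_eq_zero] at this
      rw [hx0, this, inner_zero_left, inner_zero_left]
    by_cases hy0 : y = 0
    · have := hnorm y hy
      rw [hy0, norm_zero, norm_eq_zero] at this
      rw [hy0, this, inner_zero_right, inner_zero_right]
    rw [← overlap_ray_mul hx0 hy0, ← overlap_ray_mul (hV0 x hx hx0) (hV0 y hy hy0), hnorm x hx,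
      hnorm y hy, ← hray x hx hx0, ← hray y hy hy0, h]
  -- In the charts |1 + ⟪x, y⟫| is preserved; together with |⟪x, y⟫| it determines the real part.
  have hre : ∀ x, inner ℂ e₀ x = 0 → ∀ y, inner ℂ e₀ y = 0 →
      (inner ℂ (V x) (V y)).re = (inner ℂ x y).re := by
    intro x hx y hy
    have h1 := overlap_ray_mul (unit_add_ne_zero he₀ hx) (unit_add_ne_zero he₀ hy)
    have h2 := overlap_ray_mul (unit_add_ne_zero he₀' (hV x hx).1)
      (unit_add_ne_zero he₀' (hV y hy).1)
    rw [← (hV x hx).2, ← (hV y hy).2, h, hadd x hx, hadd y hy, h1, inner_unit_add he₀ hx hy,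
      inner_unit_add he₀' (hV x hx).1 (hV y hy).1] at h2
    have h3 := congrArg (· ^ 2) h2
    have h4 := congrArg (· ^ 2) (hnI x hx y hy)
    simp only [Complex.sq_norm, Complex.normSq_apply, Complex.add_re, Complex.add_im,
      Complex.one_re, Complex.one_im, zero_add] at h3 h4
    linarith
  have hmem : ∀ {x}, x ∈ (ℂ ∙ e₀)ᗮ ↔ inner ℂ e₀ x = 0 :=
    Submodule.mem_orthogonal_singleton_iff_inner_right
  simp only [← hmem] at *
  have hVadd : ∀ x ∈ (ℂ ∙ e₀)ᗮ, ∀ y ∈ (ℂ ∙ e₀)ᗮ, V (x + y) = V x + V y := by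
    intro x hx y hy
    have := map_real_combination (S := ((ℂ ∙ e₀)ᗮ : Submodule ℂ H)) hre 1 1 (y := x) (z := y) hx hy
      (by simpa using Submodule.add_mem _ hx hy)
    simpa using this
  rcases map_I_smul_uniform hre hnI with hI | hI
  · left
    refine exists_semilinear_lift (σ := RingHom.id ℂ) (fun _ => rfl) hφ he₀ he₀' hVadd ?_ hnorm
      (fun x hx => (hV x hx).1) (fun x hx => (hV x hx).2) hray
    intro t x hx
    rw [map_smul_of_map_I_smul hre hI t hx, Complex.re_add_im, RingHom.id_apply]
  · right
    refine exists_semilinear_lift Complex.norm_conj hφ he₀ he₀' hVadd ?_ hnorm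
      (fun x hx => (hV x hx).1) (fun x hx => (hV x hx).2) hray
    intro t x hx
    rw [map_smul_of_map_I_smul hre hI t hx]
    congr 1
    apply Complex.ext <;> simp

end WignerTheorem

/-! ### The main theorem -/

theorem mainTheorem1 {H : Type*} [NormedAddCommGroup H] [InnerProductSpace ℂ H] [CompleteSpace H]
    (hdim : 3 ≤ Module.rank ℂ H) (α : ℝ) (hα₁ : Real.pi / 4 < α) (hα₂ : α < Real.pi / 2)
    (φ : ℙ ℂ H → ℙ ℂ H) (hφ : Function.Bijective φ)
    (hpres : ∀ p q : ℙ ℂ H, quantumAngle p q = α ↔ quantumAngle (φ p) (φ q) = α) :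
    IsWignerSymmetry φ := by
  have hperp : ∀ u v : H, ∃ w : H, ‖w‖ = 1 ∧ inner ℂ u w = 0 ∧ inner ℂ v w = 0 := by
    intro u v
    have hne : (Submodule.span ℂ {u, v})ᗮ ≠ ⊥ := by
      rw [Ne, Submodule.orthogonal_eq_bot_iff]
      intro htop
      have h1 : Module.rank ℂ (Submodule.span ℂ {u, v}) ≤ 2 := by
        refine (rank_span_le _).trans ?_
        calc Cardinal.mk ({u, v} : Set H) ≤ Cardinal.mk ({v} : Set H) + 1 := Cardinal.mk_insert_le
          _ = 2 := by rw [Cardinal.mk_singleton, one_add_one_eq_two]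
      rw [htop, rank_top] at h1
      have := hdim.trans h1
      norm_num at this
    obtain ⟨x, hx, hx0⟩ := Submodule.exists_mem_ne_zero_of_ne_bot hne
    obtain ⟨w, hw, hxw⟩ := exists_normalization hx0
    have hxn : (‖x‖ : ℂ) ≠ 0 := by exact_mod_cast norm_ne_zero_iff.mpr hx0
    rw [hxw, Submodule.smul_mem_iff _ hxn, Submodule.mem_orthogonal] at hx
    exact ⟨w, hw, hx u (Submodule.subset_span (by simp)), hx v (Submodule.subset_span (by simp))⟩
  obtain ⟨w, hw, -⟩ := hperp 0 0
  have : Nontrivial H := ⟨w, 0, ne_zero_of_norm_one hw⟩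
  have hpi := Real.pi_pos
  have hc : 0 < Real.cos α := Real.cos_pos_of_mem_Ioo ⟨by linarith, hα₂⟩
  -- This is cos 2α < 0, and it is where α > π/4 enters.
  have hc2 : 2 * Real.cos α ^ 2 < 1 := by
    have : Real.cos (2 * α) < 0 := Real.cos_neg_of_pi_div_two_lt_of_lt (by linarith) (by linarith)
    rw [Real.cos_two_mul] at this
    linarith
  have hangle : ∀ p q : ℙ ℂ H, quantumAngle p q = α ↔ overlap p q = Real.cos α := by
    intro p q
    change Real.arccos (overlap p q) = α ↔ _
    constructor
    · rintro rfl
      exact (Real.cos_arccos (by linarith [overlap_nonneg p q]) (overlap_le_one p q)).symm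
    · rintro h
      rw [h, Real.arccos_cos (by linarith) (by linarith)]
  have he : ∀ p q, overlap p q = Real.cos α ↔
      overlap (Equiv.ofBijective φ hφ p) (Equiv.ofBijective φ hφ q) = Real.cos α := by
    intro p q
    rw [← hangle, ← hangle]
    exact hpres p q
  have hpair := overlap_map hc hc2 he hperp
  rcases wigner hφ.surjective hpair with ⟨U, hU⟩ | ⟨U, hU⟩
  · refine Or.inl ⟨U, fun v hv => ?_⟩
    rw [← ray_eq_mk hv, hU v hv, ray_eq_mk]
  · refine Or.inr ⟨U, fun v hv => ?_⟩
    rw [← ray_eq_mk hv, hU v hv, ray_eq_mk]
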